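/- A partition of $[n]=\{1,\dots,n\}$ with $m$ blocks $B_1,\dots,B_m$ (nonempty, pairwise disjoint, with union $[n]$), listed so that $\min B_1<\min B_2<\cdots<\min B_m$, is identified with its canonical sequence $\pi=\pi_1\pi_2\cdots\pi_n$, where $\pi_i=j$ if and only if $i\in B_j$. A partition $\pi$ of $[n]$ contains a partition (pattern) $\sigma$ of $[k]$ if there are indices $1\le f(1)<f(2)<\cdots<f(k)\le n$ such that for all $i,j\in[k]$ one has $\pi_{f(i)}<\pi_{f(j)}$ if and only if $\sigma_i<\sigma_j$; otherwise $\pi$ avoids $\sigma$. Let $p(n;\sigma)$ denote the number of partitions of $[n]$ that avoid $\sigma$; two patterns $\sigma,\sigma'$ are equivalent if $p(n;\sigma)=p(n;\sigma')$ for every $n$. **Theorem 5.2.** The pattern $12112$ is equivalent to the pattern $12212$. In fact, for every $m$ and $n$ there is a bijection between the $12112$-avoiding partitions of $[n]$ with $m$ blocks and the $12212$-avoiding partitions of $[n]$ with $m$ blocks. -/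

import Mathlib

/-- A set partition of an `n`-element linearly ordered ground set. The ground set `[n] = {1, …, n}`
is modelled by `Fin n`, and the blocks are the elements of `P.parts` (nonempty, pairwise disjoint,
with union the whole ground set). -/
abbrev SetPartition (n : ℕ) : Type := Finpartition (Finset.univ : Finset (Fin n))

namespace SetPartition

/-- The canonical sequence of a partition. If the blocks are listed as `B₁, B₂, …, B_d` in the
increasing order of their minima, then the `i`-th term is the number `k` with `i ∈ B_k`, that is,
the number of blocks whose minimum is at most the minimum of the block of `i`. -/
def canonicalSeq {n : ℕ} (P : SetPartition n) (i : Fin n) : ℕ :=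
  (P.parts.filter fun B => B.min ≤ (P.part i).min).card

/-- `P` contains the pattern `S`: the canonical sequence of `P` has a subsequence that is
order-isomorphic to the canonical sequence of `S`. -/
def Contains {n k : ℕ} (P : SetPartition n) (S : SetPartition k) : Prop :=
  ∃ f : Fin k → Fin n, StrictMono f ∧
    ∀ i j : Fin k, P.canonicalSeq (f i) < P.canonicalSeq (f j) ↔
      S.canonicalSeq i < S.canonicalSeq j

/-- `P` avoids the pattern `S`. -/
def Avoids {n k : ℕ} (P : SetPartition n) (S : SetPartition k) : Prop :=
  ¬ P.Contains S

/-- The number `p(n; S)` of partitions of `[n]` that avoid `S`. -/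
noncomputable def numAvoiding (n : ℕ) {k : ℕ} (S : SetPartition k) : ℕ :=
  Nat.card {P : SetPartition n // P.Avoids S}

/-- Two patterns are equivalent if, for every `n`, they are avoided by equally many partitions
of `[n]`. -/
def Equivalent {k l : ℕ} (S : SetPartition k) (T : SetPartition l) : Prop :=
  ∀ n : ℕ, numAvoiding n S = numAvoiding n T

/-- The pattern `12112`: the partition of `{1, …, 5}` with blocks `{1, 3, 4}` and `{2, 5}`
(written from `0` in `Fin 5`). -/
def pattern12112 : SetPartition 5 where
  parts := {{0, 2, 3}, {1, 4}}
  supIndep := by decide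
  sup_parts := by decide
  bot_notMem := by decide

/-- The pattern `12212`: the partition of `{1, …, 5}` with blocks `{1, 4}` and `{2, 3, 5}`
(written from `0` in `Fin 5`). -/
def pattern12212 : SetPartition 5 where
  parts := {{0, 3}, {1, 2, 4}}
  supIndep := by decide
  sup_parts := by decide
  bot_notMem := by decide

theorem canonicalSeq_pattern12112 : pattern12112.canonicalSeq = ![1, 2, 1, 1, 2] := by
  decide

theorem canonicalSeq_pattern12212 : pattern12212.canonicalSeq = ![1, 2, 2, 1, 2] := by
  decide

end SetPartition

/-! Write canonical sequences with letters from 0; they are the restricted growth functions (RGFs).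
Before the first b of an RGF every smaller a has occurred, so the leading 1 of both patterns is
free: avoiding 12112 means having no subsequence b a a b with a < b (`TypeA`), avoiding 12212 means
having no b b a b (`TypeB`). Words are counted with weight w^(number of letters) for rational w ≠ 0.
Equality of these polynomials in w gives equal numbers for each number of blocks, and the bijection
is just an equality of cardinalities.

Let c(N, k) count RGFs of length N followed by k old letters (`coverSum`), and M(N, k) RGFs of
length N followed by the next new letter m and k letters ≤ m (`maxSum`). Cutting at the first
largest letter expresses c(N + 1, ·) through M at lengths ≤ N, so it is enough that both types
satisfy M(N, k) = c(N, k) + ∑_{j<k} (j + 1) c(N, j) for N ≥ 1. For `TypeB` this is direct: the later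
m's form one run, which has j + 1 possible places among the j other letters. For `TypeA` it amounts
to ζ_{k+1} = ζ_k + (k + 1)(Φ_k - ζ_k), where Φ = M and ζ counts the words in which m occurs again
(`barSum_newTail_succ_eq`).

In a `TypeA` word a letter below c occurs at most once between the first and the last c. Hence a
word with marked last letter c splits into a low part and a high part that are independent up to
interleaving (`barWord_iff`, `sum_splitFinset`). This gives recursions for Φ, for ζ and for the
number τ of words whose tail is distinct and avoids m; τ is the kernel of all of them.

The arrays are encoded as operators on power series in y, where the exponent of y is the length of
the word before the bar, with the derivation X' = [X, -y⁻¹]: τ_k = T^(k) 1. Splitting tails by the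
letter 0 gives T = E + g with E 1 = 1. The recursions become T' = T g, T^(k) 1 = T (E^(k) 1), ζ_k =
K_k 1 and Φ_k = K_k T 1, where K_0 = 1 and K_{k+1} = K_k T + K_k'. If E' = g E, then K_{k+1} = K_k
(E + (k + 1) g), and applying this to 1 is the wanted recursion (`array_identity`).

The core is E' = g E (`der_eq_mul`). Cancelling T yields E^(k) 1 = F_k 1 with T^(k) = T F_k, which
would give the claim at once if g commuted with its derivatives. The relation τ_1(N) = τ_0(N + 1) -
w τ_0(N) says that g maps 1 + w - y⁻¹ to -w, and therefore C = E g - g E - w⁻¹ g³ kills that series.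
With D = E' - g E, an induction along the degree filtration shows C = D = 0: C' consists of
multiples of C and D by small factors, and g' = g² + w⁻¹ g³ + C - D, so g commutes with its
derivatives to one order more. -/

/-! ### The ring of skew power series. -/

/-- Skew power series `∑ yˢ pₛ(n)` with coefficients functions `ℤ → ℚ`, where
`p(n) y = y p(n + 1)`. -/
structure SkewSeries : Type where
  /-- The coefficient functions. -/
  coeff : ℕ → ℤ → ℚ

namespace SkewSeries

instance : CoeFun SkewSeries (fun _ => ℕ → ℤ → ℚ) := ⟨coeff⟩

@[ext] theorem ext {p q : SkewSeries} (h : ∀ s n, p s n = q s n) : p = q := by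
  cases p; cases q; congr; exact funext fun s => funext fun n => h s n

instance : Zero SkewSeries := ⟨⟨0⟩⟩
instance : Add SkewSeries := ⟨fun p q => ⟨fun s => p s + q s⟩⟩
instance : Neg SkewSeries := ⟨fun p => ⟨fun s => -p s⟩⟩
instance : Sub SkewSeries := ⟨fun p q => ⟨fun s => p s - q s⟩⟩
instance : SMul ℕ SkewSeries := ⟨fun c p => ⟨fun s => c • p s⟩⟩
instance : SMul ℤ SkewSeries := ⟨fun c p => ⟨fun s => c • p s⟩⟩

instance : Mul SkewSeries :=
  ⟨fun p q => ⟨fun s n => ∑ ab ∈ Finset.HasAntidiagonal.antidiagonal s, p ab.1 (n + ab.2) * q ab.2 n⟩⟩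

instance : One SkewSeries := ⟨⟨fun s _ => if s = 0 then 1 else 0⟩⟩

theorem mul_apply (p q : SkewSeries) (s : ℕ) (n : ℤ) :
    (p * q) s n = ∑ ab ∈ Finset.HasAntidiagonal.antidiagonal s, p ab.1 (n + ab.2) * q ab.2 n := rfl

theorem one_apply (s : ℕ) (n : ℤ) : (1 : SkewSeries) s n = if s = 0 then 1 else 0 := rfl

@[simp] theorem add_apply (p q : SkewSeries) (s : ℕ) (n : ℤ) : (p + q) s n = p s n + q s n := rfl
@[simp] theorem zero_apply (s : ℕ) (n : ℤ) : (0 : SkewSeries) s n = 0 := rfl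

theorem mul_assoc_aux (p q r : SkewSeries) : p * q * r = p * (q * r) := by
  ext s n
  simp only [mul_apply, Finset.sum_mul, Finset.mul_sum]
  rw [Finset.sum_sigma', Finset.sum_sigma']
  refine Finset.sum_nbij' (fun x => ⟨(x.2.1, x.2.2 + x.1.2), (x.2.2, x.1.2)⟩)
    (fun x => ⟨(x.1.1 + x.2.1, x.2.2), (x.1.1, x.2.1)⟩) ?_ ?_ ?_ ?_ ?_
  · rintro ⟨⟨a, b⟩, c, d⟩ h; simp at h ⊢; omega
  · rintro ⟨⟨a, b⟩, c, d⟩ h; simp at h ⊢; omega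
  · rintro ⟨⟨a, b⟩, c, d⟩ h; simp at h ⊢; omega
  · rintro ⟨⟨a, b⟩, c, d⟩ h; simp at h ⊢; omega
  · rintro ⟨⟨a, b⟩, c, d⟩ h
    simp only [Nat.cast_add]
    rw [show n + (b : ℤ) + d = n + (d + b) by ring]; ring

instance : Ring SkewSeries where
  __ := (Function.Injective.addCommGroup coeff (fun _ _ h => by ext s n; rw [h]) rfl
    (fun _ _ => rfl) (fun _ => rfl) (fun _ _ => rfl) (fun _ _ => rfl) (fun _ _ => rfl) :
    AddCommGroup SkewSeries)
  mul_assoc := mul_assoc_aux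
  one_mul p := by
    ext s n
    rw [mul_apply, Finset.sum_eq_single (0, s)]
    · simp [one_apply]
    · rintro ⟨a, b⟩ h hne
      have : a ≠ 0 := by rintro rfl; simp at h; exact hne (by simp [h])
      simp [one_apply, this]
    · simp
  mul_one p := by
    ext s n
    rw [mul_apply, Finset.sum_eq_single (s, 0)]
    · simp [one_apply]
    · rintro ⟨a, b⟩ h hne
      have : b ≠ 0 := by rintro rfl; simp at h; exact hne (by simp [h])
      simp [one_apply, this]
    · simp
  left_distrib p q r := by
    ext s n; simp [mul_apply, mul_add, Finset.sum_add_distrib]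
  right_distrib p q r := by
    ext s n; simp [mul_apply, add_mul, Finset.sum_add_distrib]
  zero_mul p := by ext s n; simp [mul_apply]
  mul_zero p := by ext s n; simp [mul_apply]

end SkewSeries

/-! ### Polynomial functions on ℤ, described by vanishing differences. -/

/-- The backward difference of a function on the integers. -/
def bwdDiff (f : ℤ → ℚ) : ℤ → ℚ := fun n => f n - f (n - 1)

/-- `VanishDiff k f`: the `k`-th difference of `f` vanishes, i.e. `f` is a polynomial function of
degree less than `k`. -/
def VanishDiff : ℕ → (ℤ → ℚ) → Prop
  | 0, f => f = 0
  | k + 1, f => VanishDiff k (bwdDiff f)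

namespace VanishDiff

theorem zero (k : ℕ) : VanishDiff k 0 := by
  induction k with
  | zero => rfl
  | succ k ih =>
    have : bwdDiff 0 = 0 := by ext n; simp [bwdDiff]
    simpa [VanishDiff, this] using ih

theorem add {k : ℕ} {f g : ℤ → ℚ} (hf : VanishDiff k f) (hg : VanishDiff k g) :
    VanishDiff k (f + g) := by
  induction k generalizing f g with
  | zero => simp_all [VanishDiff]
  | succ k ih =>
    have : bwdDiff (f + g) = bwdDiff f + bwdDiff g := by ext n; simp [bwdDiff]; ring
    simpa [VanishDiff, this] using ih hf hg

theorem smul {k : ℕ} {f : ℤ → ℚ} (c : ℚ) (hf : VanishDiff k f) : VanishDiff k (c • f) := by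
  induction k generalizing f with
  | zero => simp_all [VanishDiff]
  | succ k ih =>
    have : bwdDiff (c • f) = c • bwdDiff f := by ext n; simp [bwdDiff]; ring
    simpa [VanishDiff, this] using ih hf

theorem neg {k : ℕ} {f : ℤ → ℚ} (hf : VanishDiff k f) : VanishDiff k (-f) := by
  simpa using hf.smul (-1)

theorem sum {ι : Type*} {k : ℕ} {s : Finset ι} {f : ι → ℤ → ℚ}
    (h : ∀ i ∈ s, VanishDiff k (f i)) : VanishDiff k (∑ i ∈ s, f i) := by
  classical
  induction s using Finset.induction_on with
  | empty => exact zero k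
  | insert a s ha ih =>
    rw [Finset.sum_insert ha]
    exact (h a (by simp)).add (ih fun i hi => h i (by simp [hi]))

theorem succ {k : ℕ} {f : ℤ → ℚ} (hf : VanishDiff k f) : VanishDiff (k + 1) f := by
  induction k generalizing f with
  | zero =>
    rw [show f = 0 from hf]; exact zero _
  | succ k ih => exact ih (f := bwdDiff f) hf

theorem mono {k l : ℕ} {f : ℤ → ℚ} (hf : VanishDiff k f) (h : k ≤ l) : VanishDiff l f := by
  induction h with
  | refl => exact hf
  | step _ ih => exact ih.succ

theorem shift {k : ℕ} {f : ℤ → ℚ} (hf : VanishDiff k f) (c : ℤ) :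
    VanishDiff k (fun n => f (n + c)) := by
  induction k generalizing f with
  | zero => ext n; rw [show f = 0 from hf]; rfl
  | succ k ih =>
    have := ih (f := bwdDiff f) hf
    have e : bwdDiff (fun n => f (n + c)) = fun n => bwdDiff f (n + c) := by
      ext n; simp only [bwdDiff]; rw [show n - 1 + c = n + c - 1 by ring]
    simpa [VanishDiff, e] using this

theorem mul {k l : ℕ} {f g : ℤ → ℚ} (hf : VanishDiff (k + 1) f) (hg : VanishDiff (l + 1) g) :
    VanishDiff (k + l + 1) (f * g) := by
  -- Truncated `k + l - 1` lets `k = 0` or `l = 0` (a zero factor) take part, so the product rule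
  -- for differences closes the induction.
  have key : ∀ t k l : ℕ, k + l ≤ t → ∀ f g : ℤ → ℚ, VanishDiff k f → VanishDiff l g →
      VanishDiff (k + l - 1) (f * g) := by
    intro t
    induction t with
    | zero =>
      intro k l h f g hf hg
      obtain rfl : k = 0 := by omega
      rw [show f = 0 from hf, zero_mul]; exact zero _
    | succ t ih =>
      intro k l h f g hf hg
      rcases k with _ | k
      · rw [show f = 0 from hf, zero_mul]; exact zero _
      rcases l with _ | l
      · rw [show g = 0 from hg, mul_zero]; exact zero _
      have e : bwdDiff (f * g) = bwdDiff f * g + (fun n => f (n + (-1))) * bwdDiff g := by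
        ext n; simp [bwdDiff, ← sub_eq_add_neg]; ring
      have h1 := ih k (l + 1) (by omega) (bwdDiff f) g hf hg
      have h2 := ih (k + 1) l (by omega) _ (bwdDiff g) (hf.shift (-1)) hg
      rw [show k + 1 + (l + 1) - 1 = (k + l) + 1 by omega]
      show VanishDiff (k + l) (bwdDiff (f * g))
      rw [e]
      exact (h1.mono (by omega)).add (h2.mono (by omega))
  exact (key _ (k + 1) (l + 1) le_rfl f g hf hg).mono (by omega)

end VanishDiff

theorem eq_const_of_bwdDiff_eq_zero {f : ℤ → ℚ} (h : bwdDiff f = 0) (n : ℤ) : f n = f 0 := by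
  have step : ∀ n : ℤ, f n = f (n - 1) := fun n => by
    have := congrFun h n; simp [bwdDiff] at this; linarith
  induction n using Int.induction_on with
  | zero => rfl
  | succ i ih => rw [step, ← ih]; congr 1; ring
  | pred i ih => rw [← ih, step (-(i : ℤ))]

/-- The `k`-th difference of a polynomial of degree at most `k` is constant, so its value at 0
decides whether the degree drops. -/
theorem VanishDiff.of_iterate {k : ℕ} {f : ℤ → ℚ} (hf : VanishDiff (k + 1) f)
    (h0 : (bwdDiff^[k]) f 0 = 0) : VanishDiff k f := by
  induction k generalizing f with
  | zero =>
    ext n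
    rw [eq_const_of_bwdDiff_eq_zero (show bwdDiff f = 0 from hf) n]
    simpa using h0
  | succ k ih => exact ih (f := bwdDiff f) hf (by simpa using h0)

/-! ### The degree filtration, the algebra `gapOp` and its derivation. -/

/-- The operators of filtration degree at least `n`. -/
def SkewSeries.Filt (n : ℕ) (p : SkewSeries) : Prop := ∀ s, VanishDiff (s + 1 - n) (p s)

namespace SkewSeries

theorem Filt.mul {m n : ℕ} {p q : SkewSeries} (hp : Filt m p) (hq : Filt n q) :
    Filt (m + n) (p * q) := by
  intro s
  have e : (p * q) s = ∑ ab ∈ Finset.HasAntidiagonal.antidiagonal s, (fun n => p ab.1 (n + ab.2)) * q ab.2 := by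
    ext n; simp [mul_apply]
  rw [e]
  refine VanishDiff.sum fun ⟨a, b⟩ hab => ?_
  rw [Finset.HasAntidiagonal.mem_antidiagonal] at hab
  simp only
  by_cases ha : a < m
  · have := hp a
    rw [show a + 1 - m = 0 by omega] at this
    rw [show p a = 0 from this]
    have : (fun n : ℤ => (0 : ℤ → ℚ) (n + b)) = 0 := rfl
    rw [this, zero_mul]; exact VanishDiff.zero _
  by_cases hb : b < n
  · have := hq b
    rw [show b + 1 - n = 0 by omega] at this
    rw [show q b = 0 from this, mul_zero]; exact VanishDiff.zero _
  have h1 := (hp a).shift b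
  have h2 := hq b
  rw [show a + 1 - m = (a - m) + 1 by omega] at h1
  rw [show b + 1 - n = (b - n) + 1 by omega] at h2
  exact (h1.mul h2).mono (by omega)

theorem Filt.add {n : ℕ} {p q : SkewSeries} (hp : Filt n p) (hq : Filt n q) : Filt n (p + q) :=
  fun s => (hp s).add (hq s)

theorem Filt.neg {n : ℕ} {p : SkewSeries} (hp : Filt n p) : Filt n (-p) := fun s => (hp s).neg

theorem Filt.zero (n : ℕ) : Filt n 0 := fun _ => VanishDiff.zero _

theorem Filt.one : Filt 0 1 := by
  intro s
  rcases s with _ | s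
  · show bwdDiff _ = 0
    ext n; simp [bwdDiff, one_apply]
  · have : (1 : SkewSeries) (s + 1) = 0 := by ext n; simp [one_apply]
    rw [this]; exact VanishDiff.zero _

end SkewSeries

/-- The ring of operators `∑ yˢ pₛ(n)` with `pₛ` polynomial of degree at most `s`. -/
def gapOp : Subring SkewSeries where
  carrier := {p | p.Filt 0}
  mul_mem' hp hq := by simpa using SkewSeries.Filt.mul hp hq
  one_mem' := SkewSeries.Filt.one
  add_mem' := SkewSeries.Filt.add
  zero_mem' := SkewSeries.Filt.zero 0
  neg_mem' := SkewSeries.Filt.neg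

namespace gapOp

instance : CoeFun gapOp (fun _ => ℕ → ℤ → ℚ) := ⟨fun X => X.1.coeff⟩

theorem coe_mul (X Y : gapOp) (s : ℕ) (n : ℤ) :
    (X * Y) s n = ∑ ab ∈ Finset.HasAntidiagonal.antidiagonal s, X ab.1 (n + ab.2) * Y ab.2 n := rfl

theorem apply_zero (X : gapOp) (n : ℤ) : X 0 n = X 0 (n - 1) := by
  have h : bwdDiff (X 0) = 0 := X.2 0
  have := congrFun h n
  simp only [bwdDiff, Pi.zero_apply] at this
  linarith

/-- The commutator with multiplication by `-y⁻¹`. -/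
def der : gapOp →+ gapOp where
  toFun X := ⟨⟨fun s => bwdDiff (X (s + 1))⟩, fun s => X.2 (s + 1)⟩
  map_zero' := by
    apply Subtype.ext; ext s n
    show (0 : ℚ) - 0 = 0
    ring
  map_add' X Y := by
    apply Subtype.ext; ext s n
    show (X (s + 1) n + Y (s + 1) n) - (X (s + 1) (n - 1) + Y (s + 1) (n - 1)) =
      (X (s + 1) n - X (s + 1) (n - 1)) + (Y (s + 1) n - Y (s + 1) (n - 1))
    ring

theorem der_apply (X : gapOp) (s : ℕ) : der X s = bwdDiff (X (s + 1)) := rfl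

/-- A commutator is a derivation. In coefficients, the boundary terms of the antidiagonal of `s + 1`
vanish because `X 0` and `Y 0` are constant. -/
theorem der_mul (X Y : gapOp) : der (X * Y) = der X * Y + X * der Y := by
  apply Subtype.ext; ext s n
  show (X * Y) (s + 1) n - (X * Y) (s + 1) (n - 1) = (der X * Y) s n + (X * der Y) s n
  have e : (X * Y) (s + 1) n - (X * Y) (s + 1) (n - 1) =
      (∑ ab ∈ Finset.HasAntidiagonal.antidiagonal (s + 1),
        (X ab.1 (n + ab.2) - X ab.1 (n + ab.2 - 1)) * Y ab.2 n) +
      ∑ ab ∈ Finset.HasAntidiagonal.antidiagonal (s + 1),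
        X ab.1 (n + ab.2 - 1) * (Y ab.2 n - Y ab.2 (n - 1)) := by
    rw [coe_mul, coe_mul, ← Finset.sum_sub_distrib, ← Finset.sum_add_distrib]
    refine Finset.sum_congr rfl fun ab _ => ?_
    rw [show n - 1 + (ab.2 : ℤ) = n + ab.2 - 1 by ring]
    ring
  rw [e, Finset.Nat.sum_antidiagonal_succ, Finset.Nat.sum_antidiagonal_succ', coe_mul, coe_mul]
  rw [← apply_zero X, ← apply_zero Y]
  simp only [sub_self, zero_mul, mul_zero, zero_add, der_apply, bwdDiff, Nat.cast_add, Nat.cast_one]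
  congr 1
  refine Finset.sum_congr rfl fun ab _ => ?_
  rw [show n + ((ab.2 : ℤ) + 1) - 1 = n + ab.2 by ring]

theorem der_one : der 1 = 0 := by
  have := der_mul 1 1
  simpa using this

theorem iterate_der_apply (k : ℕ) (X : gapOp) (s : ℕ) :
    (der^[k] X) s = (bwdDiff^[k]) (X (s + k)) := by
  induction k generalizing X with
  | zero => rfl
  | succ k ih =>
    rw [Function.iterate_succ_apply, ih, Function.iterate_succ_apply, der_apply, add_assoc]

/-- The value of an operator at the power series `1`. -/
def ev : gapOp →+ (ℕ → ℚ) where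
  toFun X := fun s => X s 0
  map_zero' := rfl
  map_add' _ _ := rfl

theorem ev_apply (X : gapOp) (s : ℕ) : ev X s = X s 0 := rfl

/-- The action of an operator on power series. -/
def act (X : gapOp) (v : ℕ → ℚ) : ℕ → ℚ :=
  fun s => ∑ ab ∈ Finset.HasAntidiagonal.antidiagonal s, X ab.1 ab.2 * v ab.2

theorem ev_mul (X Y : gapOp) : ev (X * Y) = act X (ev Y) := by
  ext s
  simp only [ev_apply, act, coe_mul, zero_add]

/-- The two-sided ideals of the filtration. -/
def Filt (n : ℕ) (X : gapOp) : Prop := SkewSeries.Filt n X.1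

theorem Filt.mul {m n : ℕ} {X Y : gapOp} (hX : Filt m X) (hY : Filt n Y) : Filt (m + n) (X * Y) :=
  SkewSeries.Filt.mul hX hY

theorem Filt.all (X : gapOp) : Filt 0 X := X.2

theorem Filt.mul_left {n : ℕ} (X : gapOp) {Y : gapOp} (hY : Filt n Y) : Filt n (X * Y) := by
  simpa using (Filt.all X).mul hY

theorem Filt.mul_right {n : ℕ} {X : gapOp} (hX : Filt n X) (Y : gapOp) : Filt n (X * Y) := by
  simpa using hX.mul (Filt.all Y)

theorem Filt.add {n : ℕ} {X Y : gapOp} (hX : Filt n X) (hY : Filt n Y) : Filt n (X + Y) :=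
  SkewSeries.Filt.add hX hY

theorem Filt.neg {n : ℕ} {X : gapOp} (hX : Filt n X) : Filt n (-X) := SkewSeries.Filt.neg hX

theorem Filt.sub {n : ℕ} {X Y : gapOp} (hX : Filt n X) (hY : Filt n Y) : Filt n (X - Y) := by
  rw [sub_eq_add_neg]; exact hX.add hY.neg

theorem Filt.zero (n : ℕ) : Filt n 0 := SkewSeries.Filt.zero n

theorem Filt.der {n : ℕ} {X : gapOp} (hX : Filt n X) : Filt n (der X) := by
  intro s
  by_cases h : s < n
  · have h1 : VanishDiff (s + 1 + 1 - n) (X (s + 1)) := hX (s + 1)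
    rw [show s + 1 - n = 0 by omega]
    show bwdDiff (X (s + 1)) = 0
    exact h1.mono (show _ ≤ 1 by omega)
  · have h1 : VanishDiff (s + 1 + 1 - n) (X (s + 1)) := hX (s + 1)
    rw [show s + 1 + 1 - n = (s + 1 - n) + 1 by omega] at h1
    exact h1

theorem Filt.iterate_der {n : ℕ} {X : gapOp} (hX : Filt n X) (k : ℕ) : Filt n (gapOp.der^[k] X) := by
  induction k generalizing X with
  | zero => exact hX
  | succ k ih => exact ih hX.der

theorem Filt.apply_eq_zero {n : ℕ} {X : gapOp} (hX : Filt n X) {s : ℕ} (hs : s < n) (m : ℤ) :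
    X s m = 0 := by
  have h : VanishDiff (s + 1 - n) (X s) := hX s
  rw [show s + 1 - n = 0 by omega] at h
  exact congrFun h m

theorem Filt.ev_eq_zero {n : ℕ} {X : gapOp} (hX : Filt n X) {s : ℕ} (hs : s < n) : ev X s = 0 :=
  hX.apply_eq_zero hs 0

/-- The value at 1 of the `k`-th derivative carries, in position `j`, the top difference of the
coefficient `j + k`. If it is zero, that coefficient loses one degree; this is repeated for each `j
< n`. -/
theorem filt_of_ev {n : ℕ} {X : gapOp} (h : ∀ k, ∀ s < n, ev (der^[k] X) s = 0) : Filt n X := by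
  have key : ∀ j ≤ n, ∀ s, VanishDiff (s + 1 - j) (X s) := by
    intro j
    induction j with
    | zero => exact fun _ s => X.2 s
    | succ j ih =>
      intro hj s
      have h1 := ih (by omega) s
      by_cases hs : s + 1 ≤ j
      · exact h1.mono (by omega)
      · obtain ⟨k, rfl⟩ : ∃ k, s = j + k := ⟨s - j, by omega⟩
        rw [show j + k + 1 - j = k + 1 by omega] at h1
        rw [show j + k + 1 - (j + 1) = k by omega]
        refine h1.of_iterate ?_
        rw [← iterate_der_apply]
        exact h k j (by omega)
  exact key n le_rfl

theorem eq_zero_of_filt {X : gapOp} (h : ∀ n, Filt n X) : X = 0 := by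
  apply Subtype.ext; ext s m
  exact (h (s + 1)).apply_eq_zero (Nat.lt_succ_self s) m

/-- An operator is thus determined by the array of the values of its derivatives at 1. Identities
between operators are checked on these arrays. -/
theorem ext_ev {X Y : gapOp} (h : ∀ k, ev (der^[k] X) = ev (der^[k] Y)) : X = Y := by
  rw [← sub_eq_zero]
  refine eq_zero_of_filt fun n => filt_of_ev fun k s _ => ?_
  rw [iterate_map_sub, map_sub, h, sub_self, Pi.zero_apply]

/-! ### Operators with a prescribed array. -/

/-- `mc k n` counts multisets of size `k` on `n` elements, extended to all integers `n`. -/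
def mc (k : ℕ) (n : ℤ) : ℚ := ((Ring.multichoose n k : ℤ) : ℚ)

theorem mc_zero (n : ℤ) : mc 0 n = 1 := by simp [mc]

theorem mc_natCast (k n : ℕ) : mc k n = (Nat.multichoose n k : ℚ) := by
  induction k generalizing n with
  | zero => simp [mc]
  | succ k ihk =>
    induction n with
    | zero => simp [mc]
    | succ n ihn =>
      have h1 := Ring.multichoose_succ_succ (n : ℤ) k
      have h2 := ihk (n + 1)
      simp only [mc, Nat.cast_add, Nat.cast_one] at ihn h2 ⊢
      rw [h1, Nat.multichoose_succ_succ]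
      push_cast
      rw [ihn, h2]

theorem bwdDiff_mc_zero : bwdDiff (mc 0) = 0 := by
  ext n; simp [bwdDiff, mc_zero]

theorem bwdDiff_mc_succ (k : ℕ) : bwdDiff (mc (k + 1)) = mc k := by
  ext n
  have := Ring.multichoose_succ_succ (n - 1) k
  rw [sub_add_cancel] at this
  simp only [bwdDiff, mc, this]
  push_cast; ring

theorem vanishDiff_mc (k : ℕ) : VanishDiff (k + 1) (mc k) := by
  induction k with
  | zero => exact bwdDiff_mc_zero
  | succ k ih =>
    show VanishDiff (k + 1) (bwdDiff (mc (k + 1)))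
    rwa [bwdDiff_mc_succ]

/-- The operator `∑ x k N yᴺ δ^k / k!`, where `δ = y² d/dy`. -/
def ofArray (x : ℕ → ℕ → ℚ) : gapOp :=
  ⟨⟨fun s n => ∑ ab ∈ Finset.HasAntidiagonal.antidiagonal s, x ab.1 ab.2 * mc ab.1 n⟩, by
    intro s
    have e : (fun n => ∑ ab ∈ Finset.HasAntidiagonal.antidiagonal s, x ab.1 ab.2 * mc ab.1 n) =
        ∑ ab ∈ Finset.HasAntidiagonal.antidiagonal s, x ab.1 ab.2 • mc ab.1 := by
      ext n; simp
    show VanishDiff _ (fun n => _)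
    rw [e]
    refine VanishDiff.sum fun ab hab => ((vanishDiff_mc ab.1).smul _).mono ?_
    have := Finset.HasAntidiagonal.mem_antidiagonal.1 hab
    omega⟩

theorem ofArray_apply (x : ℕ → ℕ → ℚ) (s : ℕ) (n : ℤ) :
    ofArray x s n = ∑ ab ∈ Finset.HasAntidiagonal.antidiagonal s, x ab.1 ab.2 * mc ab.1 n := rfl

theorem der_ofArray (x : ℕ → ℕ → ℚ) : der (ofArray x) = ofArray fun k => x (k + 1) := by
  apply Subtype.ext; ext s n
  show ofArray x (s + 1) n - ofArray x (s + 1) (n - 1) = _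
  rw [ofArray_apply, ofArray_apply, ← Finset.sum_sub_distrib, Finset.Nat.sum_antidiagonal_succ]
  have h : ∀ k, mc (k + 1) n - mc (k + 1) (n - 1) = mc k n := fun k =>
    congrFun (bwdDiff_mc_succ k) n
  simp only [← mul_sub, h, mc_zero, sub_self, zero_add]
  rfl

theorem iterate_der_ofArray (x : ℕ → ℕ → ℚ) (j : ℕ) :
    der^[j] (ofArray x) = ofArray fun k => x (k + j) := by
  induction j with
  | zero => rfl
  | succ j ih =>
    rw [Function.iterate_succ_apply', ih, der_ofArray]
    congr 1; ext k : 1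
    rw [show k + 1 + j = k + (j + 1) by ring]

theorem ev_ofArray (x : ℕ → ℕ → ℚ) : ev (ofArray x) = x 0 := by
  ext s
  rw [ev_apply, ofArray_apply, Finset.sum_eq_single (0, s)]
  · simp [mc_zero]
  · rintro ⟨a, b⟩ h hne
    rcases a with _ | a
    · simp at h; exact absurd (by simp [h]) hne
    · have : mc (a + 1) 0 = 0 := by simp [mc]
      simp [this]
  · simp

theorem ev_iterate_der_ofArray (x : ℕ → ℕ → ℚ) (k : ℕ) : ev (der^[k] (ofArray x)) = x k := by
  rw [iterate_der_ofArray, ev_ofArray, zero_add]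

/-- The meeting point with combinatorics: the multichoose number counts the ways to put `k` small
letters into the gaps behind `n` large ones (`card_gapMaskFinset`). -/
theorem act_ofArray (x : ℕ → ℕ → ℚ) (v : ℕ → ℚ) (s : ℕ) :
    act (ofArray x) v s = ∑ ab ∈ Finset.HasAntidiagonal.antidiagonal s,
      ∑ kN ∈ Finset.HasAntidiagonal.antidiagonal ab.1,
        x kN.1 kN.2 * (Nat.multichoose ab.2 kN.1 : ℚ) * v ab.2 := by
  simp only [act, ofArray_apply, Finset.sum_mul, mc_natCast]

end gapOp

/-! ### Leibniz formulas. -/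

/-- The usual induction with Pascal's rule works modulo any subgroup stable under `ρ`. The
approximate version is needed where `g` commutes with its derivatives only up to the filtration. -/
theorem iterate_map_mul_sub_mem {R : Type*} [Ring R] (I : AddSubgroup R) (ρ : R →+ R)
    (hI : ∀ x ∈ I, ρ x ∈ I) (F : ℕ → R)
    (h : ∀ i z, ρ (F i * z) - (F (i + 1) * z + F i * ρ z) ∈ I) (z : R) (k : ℕ) :
    ρ^[k] (F 0 * z) - ∑ ij ∈ Finset.HasAntidiagonal.antidiagonal k,
      k.choose ij.1 • (F ij.1 * ρ^[ij.2] z) ∈ I := by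
  induction k with
  | zero => simp
  | succ k ih =>
    have h1 := hI _ ih
    rw [map_sub, map_sum] at h1
    have h2 : ∑ ij ∈ Finset.HasAntidiagonal.antidiagonal k,
        (ρ (k.choose ij.1 • (F ij.1 * ρ^[ij.2] z)) -
          k.choose ij.1 • (F (ij.1 + 1) * ρ^[ij.2] z + F ij.1 * ρ (ρ^[ij.2] z))) ∈ I := by
      refine I.sum_mem fun ij _ => ?_
      rw [map_nsmul, ← nsmul_sub]
      exact I.nsmul_mem (h _ _) _
    have h3 := I.add_mem h1 h2
    rw [Function.iterate_succ_apply',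
      Finset.sum_antidiagonal_choose_succ_nsmul (fun i j => F i * ρ^[j] z)]
    convert h3 using 1
    rw [Finset.sum_sub_distrib]
    simp only [Function.iterate_succ_apply', nsmul_add, Finset.sum_add_distrib]
    have e : ∑ ij ∈ Finset.HasAntidiagonal.antidiagonal k,
        k.choose ij.2 • (F (ij.1 + 1) * ρ^[ij.2] z) =
        ∑ ij ∈ Finset.HasAntidiagonal.antidiagonal k,
          k.choose ij.1 • (F (ij.1 + 1) * ρ^[ij.2] z) := by
      refine Finset.sum_congr rfl fun ij hij => ?_
      rw [← Finset.HasAntidiagonal.mem_antidiagonal.1 hij, Nat.choose_symm_add]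
    rw [e]
    abel

theorem iterate_map_mul_leibniz {R : Type*} [Ring R] (ρ : R →+ R) (F : ℕ → R)
    (h : ∀ i z, ρ (F i * z) = F (i + 1) * z + F i * ρ z) (z : R) (k : ℕ) :
    ρ^[k] (F 0 * z) = ∑ ij ∈ Finset.HasAntidiagonal.antidiagonal k,
      k.choose ij.1 • (F ij.1 * ρ^[ij.2] z) := by
  rw [← sub_eq_zero]
  exact iterate_map_mul_sub_mem ⊥ ρ (fun x hx => by simp_all) F (fun i z => by simp [h]) z k

namespace gapOp

theorem iterate_der_mul (X Y : gapOp) (k : ℕ) :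
    der^[k] (X * Y) = ∑ ij ∈ Finset.HasAntidiagonal.antidiagonal k,
      k.choose ij.1 • (der^[ij.1] X * der^[ij.2] Y) :=
  iterate_map_mul_leibniz der (fun i => der^[i] X)
    (fun i z => by rw [der_mul, Function.iterate_succ_apply']) Y k

/-- Multiplication by a rational number. -/
def const (c : ℚ) : gapOp :=
  ⟨⟨fun s _ => if s = 0 then c else 0⟩, by
    intro s
    rcases s with _ | s
    · show bwdDiff _ = 0
      ext n; simp [bwdDiff]
    · exact VanishDiff.zero _⟩

theorem const_mul_apply (c : ℚ) (X : gapOp) (s : ℕ) (n : ℤ) : (const c * X) s n = c * X s n := by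
  rw [coe_mul, Finset.sum_eq_single (0, s)]
  · simp [const]
  · rintro ⟨a, b⟩ h hne
    have : a ≠ 0 := by rintro rfl; simp at h; exact hne (by simp [h])
    simp [const, this]
  · simp

theorem mul_const (c : ℚ) (X : gapOp) : X * const c = const c * X := by
  apply Subtype.ext; ext s n
  show (X * const c) s n = (const c * X) s n
  rw [const_mul_apply, coe_mul, Finset.sum_eq_single (s, 0)]
  · simp [const, mul_comm]
  · rintro ⟨a, b⟩ h hne
    have : b ≠ 0 := by rintro rfl; simp at h; exact hne (by simp [h])
    simp [const, this]
  · simp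

theorem der_const (c : ℚ) : der (const c) = 0 := by
  apply Subtype.ext; ext s n
  show (const c) (s + 1) n - (const c) (s + 1) (n - 1) = 0
  simp [const]

/-! ### Values at the Laurent series 1 + w - y⁻¹. -/

/-- The value of `y X` at the Laurent series `1 + w - y⁻¹`. -/
def evPolar (w : ℚ) (X : gapOp) (s : ℕ) : ℚ :=
  -X s (-1) + (1 + w) * if s = 0 then 0 else X (s - 1) 0

/-- Because of the extra factor `y`, the coefficient in position `b` belongs to the exponent `b -
1`, and this is where the coefficients of `X` are evaluated. -/
theorem evPolar_mul (w : ℚ) (X Y : gapOp) (s : ℕ) :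
    evPolar w (X * Y) s =
      ∑ ab ∈ Finset.HasAntidiagonal.antidiagonal s, X ab.1 (ab.2 - 1) * evPolar w Y ab.2 := by
  simp only [evPolar, coe_mul, mul_add, Finset.sum_add_distrib]
  congr 1
  · rw [← Finset.sum_neg_distrib]
    refine Finset.sum_congr rfl fun ab _ => ?_
    rw [show (-1 : ℤ) + ab.2 = ab.2 - 1 by ring]; ring
  · rcases s with _ | s
    · simp
    · rw [Finset.Nat.sum_antidiagonal_succ']
      simp only [Nat.add_sub_cancel, Nat.succ_ne_zero, if_false, if_true, mul_zero, zero_add,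
        Nat.cast_add, Nat.cast_one, add_sub_cancel_right, Finset.mul_sum]
      refine Finset.sum_congr rfl fun ab _ => by ring

theorem evPolar_mul_succ {w : ℚ} {Y : gapOp} {v : ℕ → ℚ} (h0 : evPolar w Y 0 = 0)
    (h : ∀ s, evPolar w Y (s + 1) = v s) (X : gapOp) (s : ℕ) :
    evPolar w (X * Y) (s + 1) = act X v s := by
  rw [evPolar_mul, Finset.Nat.sum_antidiagonal_succ']
  simp [h0, h, act]

theorem evPolar_sub (w : ℚ) (X Y : gapOp) (s : ℕ) :
    evPolar w (X - Y) s = evPolar w X s - evPolar w Y s := by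
  have h : ∀ s n, (X - Y) s n = X s n - Y s n := fun _ _ => rfl
  simp only [evPolar, h]
  split_ifs <;> ring

theorem evPolar_const_mul (w c : ℚ) (X : gapOp) (s : ℕ) :
    evPolar w (const c * X) s = c * evPolar w X s := by
  simp only [evPolar, const_mul_apply]
  split_ifs <;> ring

theorem apply_neg_one (X : gapOp) (s : ℕ) : X (s + 1) (-1) = ev X (s + 1) - ev (der X) s := by
  simp [ev_apply, der_apply, bwdDiff]

/-- Since X(-y⁻¹) = -y⁻¹ X(1) + X'(1), vanishing at 1 + w - y⁻¹ determines the coefficients of X(1)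
one after another from those of X'(1). So the order of X'(1) passes to X(1). -/
theorem filt_of_evPolar {w : ℚ} {n : ℕ} {X : gapOp} (hd : Filt n (der X))
    (h : ∀ s, evPolar w X s = 0) : Filt n X := by
  have h0 : ∀ s < n, ev X s = 0 := by
    intro s
    induction s with
    | zero =>
      intro _
      have := h 0
      rw [evPolar] at this
      rw [ev_apply, apply_zero X]
      simp at this
      simpa using this
    | succ s ih =>
      intro hs
      have := h (s + 1)
      rw [evPolar, apply_neg_one, hd.ev_eq_zero (by omega)] at this
      have h2 := ih (by omega)
      rw [ev_apply] at h2
      simp [h2] at this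
      linarith
  refine filt_of_ev fun k s hs => ?_
  rcases k with _ | k
  · exact h0 s hs
  · rw [Function.iterate_succ_apply]
    exact (hd.iterate_der k).ev_eq_zero hs

theorem act_const_mul_one (X : gapOp) (c : ℚ) :
    act X (fun s => if s = 0 then c else 0) = fun s => c * ev X s := by
  ext s
  rw [act, Finset.sum_eq_single (s, 0)]
  · simp [ev_apply, mul_comm]
  · rintro ⟨a, b⟩ h hne
    have : b ≠ 0 := by rintro rfl; simp at h; exact hne (by simp [h])
    simp [this]
  · simp

theorem ev_one : ev 1 = fun s => if s = 0 then 1 else 0 := rfl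

/-- The operator is unitriangular on coefficients. -/
theorem act_injective {X : gapOp} (hX : Filt 1 (X - 1)) {v v' : ℕ → ℚ} (h : act X v = act X v') :
    v = v' := by
  have h0 : ∀ n, X 0 n = 1 := fun n => by
    have := hX.apply_eq_zero (Nat.zero_lt_one) n
    have e : (X - 1 : gapOp) 0 n = X 0 n - 1 := rfl
    linarith
  ext s
  induction s using Nat.strong_induction_on with
  | _ s ih =>
    have := congrFun h s
    simp only [act] at this
    rcases s with _ | s
    · simpa [h0] using this
    · rw [Finset.Nat.sum_antidiagonal_succ, Finset.Nat.sum_antidiagonal_succ] at this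
      rw [Finset.sum_congr rfl fun ab hab => by
        rw [ih ab.2 (by have := Finset.HasAntidiagonal.mem_antidiagonal.1 hab; omega)]] at this
      simpa [h0] using this

end gapOp

/-! ### The differential equation E' = g E. -/

/-- With `e` for E' and `x` for g', the left side is the derivative of C = E g - g E - u g³. On the
right every term is a product of C, of D = e - g E or of C - D with at least one factor `g` or `E -
1`, both of filtration degree 1; this is the gain of one order in `der_eq_mul`. -/
theorem commutator_defect_identity {R : Type*} [Ring R] {E g u x e : R} (hug : g * u = u * g)
    (huE : E * u = u * E) (hx : x = (E + g) * g - e) :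
    e * g + E * x - (x * E + g * e) - u * (x * (g * g) + g * (x * g) + g * (g * x)) =
      (2 • (g * (E * g - g * E - u * (g * (g * g)))) + (E * g - g * E - u * (g * (g * g))) * g)
      + u * (g * (g * (E * g - g * E - u * (g * (g * g))))
        + g * ((E * g - g * E - u * (g * (g * g))) * g)
        + (E * g - g * E - u * (g * (g * g))) * (g * g))
      + ((e - g * E) * g - g * (e - g * E))
      + ((E - 1) * ((E * g - g * E - u * (g * (g * g))) - (e - g * E))
        - ((E * g - g * E - u * (g * (g * g))) - (e - g * E)) * (E - 1))
      - u * (((E * g - g * E - u * (g * (g * g))) - (e - g * E)) * (g * g)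
        + g * (((E * g - g * E - u * (g * (g * g))) - (e - g * E)) * g)
        + g * (g * ((E * g - g * E - u * (g * (g * g))) - (e - g * E)))) := by
  have h1 : ∀ z, g * (u * z) = u * (g * z) := fun z => by rw [← mul_assoc, hug, mul_assoc]
  have h2 : ∀ z, E * (u * z) = u * (E * z) := fun z => by rw [← mul_assoc, huE, mul_assoc]
  subst hx
  simp only [mul_add, add_mul, mul_sub, sub_mul, mul_assoc, h1, h2, two_nsmul, one_mul,
    mul_one]
  abel

namespace gapOp

/-- The derivatives of `T` are the products `T * expFactor g k`, if the first one is `T * g`. -/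
def expFactor (g : gapOp) : ℕ → gapOp
  | 0 => 1
  | k + 1 => g * expFactor g k + der (expFactor g k)

theorem iterate_der_eq_mul_expFactor {T g : gapOp} (hT : der T = T * g) (k : ℕ) :
    der^[k] T = T * expFactor g k := by
  induction k with
  | zero => simp [expFactor]
  | succ k ih =>
    rw [Function.iterate_succ_apply', ih, der_mul, hT, expFactor, mul_add, mul_assoc]

/-- The map `X ↦ g X + X'`. -/
def expStep (g : gapOp) : gapOp →+ gapOp := AddMonoidHom.mulLeft g + der

theorem iterate_expStep (g : gapOp) (k : ℕ) : (expStep g)^[k] 1 = expFactor g k := by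
  induction k with
  | zero => rfl
  | succ k ih => rw [Function.iterate_succ_apply', ih]; rfl

/-- The filtration ideals as additive subgroups. -/
def filtSubgroup (n : ℕ) : AddSubgroup gapOp where
  carrier := {X | Filt n X}
  add_mem' := Filt.add
  zero_mem' := Filt.zero n
  neg_mem' := Filt.neg

/-- Operators that are polynomial in `g` up to filtration degree `n`. -/
def NearPoly (n : ℕ) (g u : gapOp) (X : gapOp) : Prop :=
  ∃ Y ∈ Subring.closure {g, u}, Filt n (X - Y)

theorem NearPoly.add {n : ℕ} {g u X Y : gapOp} (hX : NearPoly n g u X) (hY : NearPoly n g u Y) :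
    NearPoly n g u (X + Y) := by
  obtain ⟨A, hA, hA'⟩ := hX
  obtain ⟨B, hB, hB'⟩ := hY
  exact ⟨A + B, add_mem hA hB, by
    have := hA'.add hB'
    rwa [show X - A + (Y - B) = X + Y - (A + B) by abel] at this⟩

theorem NearPoly.neg {n : ℕ} {g u X : gapOp} (hX : NearPoly n g u X) :
    NearPoly n g u (-X) := by
  obtain ⟨A, hA, hA'⟩ := hX
  exact ⟨-A, neg_mem hA, by
    have := hA'.neg
    rwa [show -(X - A) = -X - -A by abel] at this⟩

theorem NearPoly.of_mem {n : ℕ} {g u X : gapOp} (hX : X ∈ Subring.closure {g, u}) :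
    NearPoly n g u X := ⟨X, hX, by rw [sub_self]; exact Filt.zero n⟩

theorem NearPoly.of_filt {n : ℕ} {g u X : gapOp} (hX : Filt n X) :
    NearPoly n g u X := ⟨0, zero_mem _, by rwa [sub_zero]⟩

theorem NearPoly.mul {n : ℕ} {g u X Y : gapOp} (hX : NearPoly n g u X) (hY : NearPoly n g u Y) :
    NearPoly n g u (X * Y) := by
  obtain ⟨A, hA, hA'⟩ := hX
  obtain ⟨B, hB, hB'⟩ := hY
  refine ⟨A * B, mul_mem hA hB, ?_⟩
  have := (hA'.mul_right Y).add (Filt.mul_left A hB')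
  rwa [show (X - A) * Y + A * (Y - B) = X * Y - A * B by noncomm_ring] at this

theorem NearPoly.der {n : ℕ} {g u X : gapOp} (hg : NearPoly n g u (der g)) (hu : der u = 0)
    (hX : NearPoly n g u X) : NearPoly n g u (gapOp.der X) := by
  have key : ∀ Y ∈ Subring.closure {g, u}, NearPoly n g u (gapOp.der Y) := by
    intro Y hY
    induction hY using Subring.closure_induction with
    | mem x hx =>
      rcases hx with rfl | rfl
      · exact hg
      · rw [hu]; exact NearPoly.of_mem (zero_mem _)
    | zero => rw [map_zero]; exact NearPoly.of_mem (zero_mem _)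
    | one => rw [der_one]; exact NearPoly.of_mem (zero_mem _)
    | add x y _ _ hx hy => rw [map_add]; exact hx.add hy
    | neg x _ hx => rw [map_neg]; exact hx.neg
    | mul x y hx' hy' hx hy =>
      rw [der_mul]
      exact (hx.mul (NearPoly.of_mem hy')).add ((NearPoly.of_mem hx').mul hy)
  obtain ⟨A, hA, hA'⟩ := hX
  have := (key A hA).add (NearPoly.of_filt hA'.der)
  rwa [map_sub, add_sub_cancel] at this

/-- The polynomial part commutes with `g` exactly; the error is multiplied by `g`, which has
filtration degree 1. -/
theorem NearPoly.commute {n : ℕ} {g u X : gapOp} (hg : Filt 1 g) (hug : g * u = u * g)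
    (hX : NearPoly n g u X) : Filt (n + 1) (g * X - X * g) := by
  obtain ⟨A, hA, hA'⟩ := hX
  have hc : ∀ B ∈ Subring.closure {g, u}, g * B = B * g := by
    intro B hB
    induction hB using Subring.closure_induction with
    | mem x hx =>
      rcases hx with rfl | rfl
      · rfl
      · exact hug
    | zero => simp
    | one => simp
    | add x y _ _ hx hy => rw [mul_add, add_mul, hx, hy]
    | neg x _ hx => rw [mul_neg, neg_mul, hx]
    | mul x y _ _ hx hy => rw [← mul_assoc, hx, mul_assoc, hy, mul_assoc]
  have h1 := hg.mul hA'
  have h2 := hA'.mul hg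
  rw [add_comm] at h1
  have := h1.sub h2
  rwa [show g * (X - A) - (X - A) * g = g * X - X * g - (g * A - A * g) by noncomm_ring, hc A hA,
    sub_self, sub_zero] at this

/-- If `T = E + g` satisfies `T' = T g` and the coefficients of `T` are the images under `T` of
those of `E`, then `E' = g E`. -/
theorem der_eq_mul {w : ℚ} (hw : w ≠ 0) {T g E : gapOp} (hTE : T = E + g) (hg : Filt 1 g)
    (hE : Filt 1 (E - 1)) (hE1 : ev E = ev 1) (hT : der T = T * g)
    (hmin : ∀ k, ev (der^[k] T) = act T (ev (der^[k] E)))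
    (hnew : ∀ s, ev (der T) s = ev T (s + 1) - w * ev T s) : der E = g * E := by
  set u := const w⁻¹ with hu
  have hug : ∀ X, X * u = u * X := fun X => mul_const _ X
  have hT1 : Filt 1 (T - 1) := by
    have := hE.add hg
    rwa [show E - 1 + g = T - 1 by rw [hTE]; abel] at this
  -- `T` maps both sides to `ev (der^[k] T)`, and `T` can be cancelled.
  have hEk : ∀ k, ev (der^[k] E) = ev (expFactor g k) := by
    intro k
    apply act_injective hT1
    rw [← hmin, iterate_der_eq_mul_expFactor hT, ev_mul]
  have hE1' : ev (der E) = ev g := by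
    have := hEk 1
    simpa [expFactor, der_one] using this
  have evT : ∀ s, ev T s = (if s = 0 then 1 else 0) + ev g s := by
    intro s; rw [hTE, map_add, hE1, ev_one]; rfl
  have dg : ∀ s, ev (der g) s = ev g (s + 1) - (if s = 0 then w else 0) - w * ev g s - ev g s := by
    intro s
    have h1 := hnew s
    have h2 : ev (der T) s = ev g s + ev (der g) s := by
      rw [hTE, map_add, map_add, hE1']; rfl
    rw [h2, evT, evT] at h1
    simp at h1
    split_ifs at h1 ⊢ <;> linarith
  have p00 : ∀ {X : gapOp}, Filt 1 X → evPolar w X 0 = 0 := fun h => by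
    rw [evPolar, h.apply_eq_zero Nat.zero_lt_one]; simp
  have pg0 : evPolar w g 0 = 0 := p00 hg
  -- In operator terms `hnew` becomes: `g` sends q = 1 + w - y⁻¹ to the constant -w.
  have pg : ∀ s, evPolar w g (s + 1) = (fun s => if s = 0 then -w else 0) s := by
    intro s
    rw [evPolar, apply_neg_one, dg]
    simp only [Nat.succ_ne_zero, if_false, Nat.add_sub_cancel, ev_apply]
    split_ifs <;> ring
  set C := E * g - g * E - u * (g * (g * g)) with hC
  set D := der E - g * E with hD
  -- With g q = -w and E 1 = 1: E g q = -w, g E q = -w + g² 1 and w⁻¹ g³ q = -g² 1, so these cancel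
  -- in C q.
  have pC : ∀ s, evPolar w C s = 0 := by
    have hpu := evPolar_const_mul w w⁻¹ (g * (g * g))
    intro s
    rw [hC, evPolar_sub, evPolar_sub, hpu]
    rcases s with _ | s
    · rw [p00 (Filt.mul_left _ hg), p00 (hg.mul_right _), p00 (hg.mul_right _)]; simp
    · have e1 : evPolar w (E * g) (s + 1) = -w * ev E s := by
        rw [evPolar_mul_succ pg0 pg, act_const_mul_one]
      have e3 : evPolar w (g * (g * g)) (s + 1) = -w * ev (g * g) s := by
        rw [← mul_assoc, evPolar_mul_succ pg0 pg, act_const_mul_one]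
      -- Here E q = q + g 1, because E 1 = 1 and E' 1 = g 1.
      have e2 : evPolar w (g * E) (s + 1) = evPolar w g (s + 1) + ev (g * g) s := by
        have hE0 : ev (E - 1) = 0 := by rw [map_sub, hE1, sub_self]
        have p0 : evPolar w (E - 1) 0 = 0 := p00 hE
        have p1 : ∀ s, evPolar w (E - 1) (s + 1) = ev g s := by
          intro s
          rw [evPolar, apply_neg_one, hE0, map_sub der E 1, der_one, sub_zero, hE1']
          have : (E - 1 : gapOp) s 0 = ev (E - 1) s := rfl
          simp only [Nat.add_sub_cancel, this, hE0]
          simp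
        have := evPolar_mul_succ p0 p1 g s
        rw [mul_sub, mul_one, evPolar_sub, ← ev_mul] at this
        linarith
      rw [e1, e2, e3, pg, hE1, ev_one]
      field_simp
      split_ifs <;> simp
  have hx : der g = (E + g) * g - der E := by
    rw [← hTE, ← hT, hTE, map_add]; abel
  have hdC : der C = _ :=
    calc der C = der E * g + E * der g - (der g * E + g * der E)
          - u * (der g * (g * g) + g * (der g * g) + g * (g * der g)) := by
          rw [hC, map_sub, map_sub, der_mul, der_mul, der_mul u, der_const, zero_mul, zero_add,
            der_mul g, der_mul g]
          noncomm_ring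
      _ = _ := commutator_defect_identity (hug g) (hug E) hx
  -- Order `n` of both defects gives order `n + 1` of `C`, through `der C` and the value at q. Order
  -- `n + 1` of `D` then follows from the near commutativity of `g` with its derivatives.
  have main : ∀ n, Filt n C ∧ Filt n D := by
    intro n
    induction n with
    | zero => exact ⟨Filt.all _, Filt.all _⟩
    | succ n ih =>
      obtain ⟨ihC, ihD⟩ := ih
      have ihCD := ihC.sub ihD
      have gl : ∀ {X : gapOp}, Filt n X → Filt (n + 1) (g * X) := fun h => by
        have := hg.mul h; rwa [add_comm] at this
      have gr : ∀ {X : gapOp}, Filt n X → Filt (n + 1) (X * g) := fun h => h.mul hg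
      have El : ∀ {X : gapOp}, Filt n X → Filt (n + 1) ((E - 1) * X) := fun h => by
        have := hE.mul h; rwa [add_comm] at this
      have Er : ∀ {X : gapOp}, Filt n X → Filt (n + 1) (X * (E - 1)) := fun h => h.mul hE
      have cub : ∀ {X : gapOp}, Filt n X →
          Filt (n + 1) (u * (X * (g * g) + g * (X * g) + g * (g * X))) := fun {X} h => by
        refine Filt.mul_left _ (((?_ : Filt (n + 1) _).add ?_).add ?_)
        · rw [← mul_assoc]; exact (gr h).mul_right _
        · exact Filt.mul_left _ (gr h)
        · exact Filt.mul_left _ (gl h)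
      have cub' : ∀ {X : gapOp}, Filt n X →
          Filt (n + 1) (u * (g * (g * X) + g * (X * g) + X * (g * g))) := fun {X} h => by
        have := cub h
        rwa [show X * (g * g) + g * (X * g) + g * (g * X) =
          g * (g * X) + g * (X * g) + X * (g * g) by abel] at this
      have hdC' : Filt (n + 1) (der C) := by
        rw [hdC, two_nsmul]
        exact (((((gl ihC).add (gl ihC)).add (gr ihC)).add (cub' ihC)).add
          ((gr ihD).sub (gl ihD))).add ((El ihCD).sub (Er ihCD)) |>.sub (cub ihCD)
      have hC' : Filt (n + 1) C := filt_of_evPolar hdC' pC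
      refine ⟨hC', ?_⟩
      have hdg : der g = g * g + u * (g * (g * g)) + (C - D) := by
        rw [hx, hC, hD]; noncomm_ring
      have npg : NearPoly n g u (der g) := by
        rw [hdg]
        have mg : g ∈ Subring.closure {g, u} := Subring.subset_closure (by simp)
        have mu : u ∈ Subring.closure {g, u} := Subring.subset_closure (by simp)
        exact (NearPoly.of_mem (add_mem (mul_mem mg mg)
          (mul_mem mu (mul_mem mg (mul_mem mg mg))))).add (NearPoly.of_filt ihCD)
      have npk : ∀ k, NearPoly n g u (der^[k] g) := by
        intro k
        induction k with
        | zero => exact NearPoly.of_mem (Subring.subset_closure (by simp))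
        | succ k ih =>
          rw [Function.iterate_succ_apply']
          exact NearPoly.der npg (der_const _) ih
      -- For ρ X = g X + X', the failure of ρ(g^(i) z) = g^(i+1) z + g^(i) ρ z is the commutator of
      -- g and g^(i) times z, which has order `n + 1`.
      have leib := fun k => iterate_map_mul_sub_mem (filtSubgroup (n + 1)) (expStep g)
        (fun x hx => (Filt.mul_left g hx).add (Filt.der hx)) (fun i => der^[i] g)
        (fun i z => by
          have h1 := (NearPoly.commute hg (hug g) (npk i)).mul_right z
          have e : expStep g (der^[i] g * z) - (der^[i + 1] g * z + der^[i] g * expStep g z) =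
              (g * der^[i] g - der^[i] g * g) * z := by
            rw [Function.iterate_succ_apply']
            show g * (der^[i] g * z) + der (der^[i] g * z) -
              (der (der^[i] g) * z + der^[i] g * (g * z + der z)) = _
            rw [der_mul]
            noncomm_ring
          show Filt _ _
          rw [e]; exact h1) 1 k
      -- By `hEk`, the `k`-th derivative of E' at 1 is ρ^k (g · 1) at 1, and that of g E at 1 is the
      -- corresponding Leibniz sum. They agree to the order given by `leib`.
      refine filt_of_ev fun k s hs => ?_
      have h1 : ev (der^[k] (der E)) = ev ((expStep g)^[k] (g * 1)) := by
        rw [← Function.iterate_succ_apply, hEk, mul_one, ← iterate_expStep,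
          Function.iterate_succ_apply]
        have : expStep g 1 = g := by
          show g * 1 + der 1 = g
          rw [der_one, mul_one, add_zero]
        rw [this]
      have h2 : ev (der^[k] (g * E)) = ev (∑ ij ∈ Finset.HasAntidiagonal.antidiagonal k,
          k.choose ij.1 • (der^[ij.1] g * (expStep g)^[ij.2] 1)) := by
        rw [iterate_der_mul, map_sum, map_sum]
        refine Finset.sum_congr rfl fun ij _ => ?_
        rw [map_nsmul, map_nsmul, ev_mul, ev_mul, hEk, iterate_expStep]
      have h3 : Filt (n + 1) _ := leib k
      rw [hD, iterate_map_sub, map_sub, h1, h2, ← map_sub]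
      exact h3.ev_eq_zero hs
  rw [← sub_eq_zero]
  exact eq_zero_of_filt fun n => (main n).2

end gapOp

/-! ### Ordered exponentials and the identity for arrays. -/

namespace gapOp

/-- The iterates of `1` under `X ↦ X T + X'`. -/
def orderedExp (T : gapOp) : ℕ → gapOp
  | 0 => 1
  | k + 1 => orderedExp T k * T + der (orderedExp T k)

/-- Joint induction: the derivative formula at `k` gives the product formula at `k`. Differentiating
the latter with E' = g E and g' = (E + g) g - g E gives the derivative formula at `k + 1`. -/
theorem orderedExp_succ {T E g : gapOp} (hTE : T = E + g) (hT : der T = T * g)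
    (hE : der E = g * E) (k : ℕ) :
    der (orderedExp T k) = k • (orderedExp T k * g) ∧
      orderedExp T (k + 1) = orderedExp T k * (E + (k + 1) • g) := by
  have hdg : der g = (E + g) * g - g * E := by
    rw [← hE, ← hTE, ← hT, hTE, map_add]; abel
  have second : ∀ k, der (orderedExp T k) = k • (orderedExp T k * g) →
      orderedExp T (k + 1) = orderedExp T k * (E + (k + 1) • g) := by
    intro k h
    rw [orderedExp, h, hTE, mul_add, mul_add, mul_smul_comm, succ_nsmul]
    abel
  induction k with
  | zero =>
    have h : der (orderedExp T 0) = 0 • (orderedExp T 0 * g) := by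
      rw [zero_nsmul]; exact der_one
    exact ⟨h, second 0 h⟩
  | succ k ih =>
    have h : der (orderedExp T (k + 1)) = (k + 1) • (orderedExp T (k + 1) * g) := by
      rw [ih.2, der_mul, ih.1, map_add, map_nsmul, hE, hdg]
      generalize orderedExp T k = K
      simp only [mul_add, add_mul, mul_sub, nsmul_add, nsmul_sub, smul_mul_assoc, mul_smul_comm,
        succ_nsmul, mul_assoc]
      abel
    exact ⟨h, second _ h⟩

/-- The definition adds a factor `T` on the right, whereas the word recursions apply derivatives of
`T` on the left. Both agree by Leibniz for X ↦ X T + X', applied to T · 1. -/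
theorem orderedExp_succ_eq_sum (T : gapOp) (k : ℕ) :
    orderedExp T (k + 1) = ∑ ij ∈ Finset.HasAntidiagonal.antidiagonal k,
      k.choose ij.1 • (der^[ij.1] T * orderedExp T ij.2) := by
  let ρ : gapOp →+ gapOp := AddMonoidHom.mulRight T + der
  have hρ : ∀ X, ρ X = X * T + der X := fun _ => rfl
  have hk : ∀ k, ρ^[k] 1 = orderedExp T k := by
    intro k
    induction k with
    | zero => rfl
    | succ k ih => rw [Function.iterate_succ_apply', ih]; rfl
  have := iterate_map_mul_leibniz ρ (fun i => der^[i] T) (fun i z => by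
    rw [hρ, hρ, der_mul, Function.iterate_succ_apply', mul_add, mul_assoc]; abel) 1 k
  simp only [hk] at this
  rw [← this, ← hk, Function.iterate_succ_apply]
  congr 1
  rw [hρ, der_one]
  simp

theorem ofArray_add (x y : ℕ → ℕ → ℚ) : ofArray (x + y) = ofArray x + ofArray y := by
  refine ext_ev fun k => ?_
  rw [iterate_map_add, map_add]
  simp only [ev_iterate_der_ofArray]
  rfl

/-- The action on `v` of the `i`-th derivative of the operator with array `x`. -/
def shiftAct (x : ℕ → ℕ → ℚ) (i : ℕ) (v : ℕ → ℚ) : ℕ → ℚ :=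
  act (ofArray fun k => x (k + i)) v

theorem shiftAct_eq (x : ℕ → ℕ → ℚ) (i : ℕ) (v : ℕ → ℚ) :
    shiftAct x i v = act (der^[i] (ofArray x)) v := by
  rw [iterate_der_ofArray, shiftAct]

/-- The hypotheses are the word recursions. They translate into T' = T g, Φ_k = K_k T 1 and ζ_k =
K_k 1 for the ordered exponentials K_k. Then K_{k+1} = K_k E + (k + 1) K_k (T - E) is applied to 1,
where E 1 = 1. -/
theorem array_identity {w : ℚ} (hw : w ≠ 0) {τ γ ε Φ ζ : ℕ → ℕ → ℚ}
    (hsplit : τ = ε + γ) (hγ : ∀ k, γ k 0 = 0) (hε : ∀ k, ε k 0 = if k = 0 then 1 else 0)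
    (hε0 : ∀ N, ε 0 N = if N = 0 then 1 else 0)
    (hmin : ∀ k, τ k = shiftAct τ 0 (ε k))
    (hlast : ∀ k, τ (k + 1) = ∑ ij ∈ Finset.HasAntidiagonal.antidiagonal k,
      k.choose ij.1 • shiftAct τ ij.1 (γ ij.2))
    (hnew : ∀ N, τ 1 N = τ 0 (N + 1) - w * τ 0 N)
    (hΦ0 : Φ 0 = τ 0)
    (hΦ : ∀ k, Φ (k + 1) = ∑ ij ∈ Finset.HasAntidiagonal.antidiagonal k,
      k.choose ij.1 • shiftAct τ ij.1 (Φ ij.2))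
    (hζ0 : ∀ N, ζ 0 N = if N = 0 then 1 else 0)
    (hζ : ∀ k, ζ (k + 1) = ∑ ij ∈ Finset.HasAntidiagonal.antidiagonal k,
      k.choose ij.1 • shiftAct τ ij.1 (ζ ij.2)) (k N : ℕ) :
    ζ (k + 1) N = ζ k N + (k + 1) * (Φ k N - ζ k N) := by
  have hTE : ofArray τ = ofArray ε + ofArray γ := by rw [hsplit, ofArray_add]
  have hE1 : ev (ofArray ε) = ev 1 := by rw [ev_ofArray, ev_one]; exact funext hε0
  have one_succ : ∀ k, der^[k + 1] (1 : gapOp) = 0 := fun k => by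
    rw [Function.iterate_succ_apply, der_one, iterate_map_zero]
  have hg : Filt 1 (ofArray γ) := filt_of_ev fun k s hs => by
    obtain rfl : s = 0 := by omega
    rw [ev_iterate_der_ofArray, hγ]
  have hE : Filt 1 (ofArray ε - 1) := filt_of_ev fun k s hs => by
    obtain rfl : s = 0 := by omega
    rw [iterate_map_sub, map_sub, ev_iterate_der_ofArray, Pi.sub_apply, hε]
    rcases k with _ | k
    · simp [ev_one]
    · simp [one_succ]
  have hT : der (ofArray τ) = ofArray τ * ofArray γ := by
    refine ext_ev fun k => ?_
    rw [← Function.iterate_succ_apply, ev_iterate_der_ofArray, hlast, iterate_der_mul, map_sum]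
    refine Finset.sum_congr rfl fun ij _ => ?_
    rw [map_nsmul, ev_mul, ev_iterate_der_ofArray, shiftAct_eq]
  have hEd : der (ofArray ε) = ofArray γ * ofArray ε :=
    der_eq_mul hw hTE hg hE hE1 hT
      (fun k => by rw [ev_iterate_der_ofArray, ev_iterate_der_ofArray, hmin]; rfl)
      (fun s => by
        have := ev_iterate_der_ofArray τ 1
        rw [Function.iterate_one] at this
        rw [this, ev_ofArray, hnew])
  have hΦk : ∀ k, Φ k = ev (orderedExp (ofArray τ) k * ofArray τ) := by
    intro k
    induction k using Nat.strong_induction_on with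
    | _ k ih =>
      rcases k with _ | k
      · rw [hΦ0, orderedExp, one_mul, ev_ofArray]
      · rw [hΦ, orderedExp_succ_eq_sum, Finset.sum_mul, map_sum]
        refine Finset.sum_congr rfl fun ij hij => ?_
        have := Finset.HasAntidiagonal.mem_antidiagonal.1 hij
        rw [ih ij.2 (by omega), shiftAct_eq, ← ev_mul, smul_mul_assoc, map_nsmul, mul_assoc]
  have hζk : ∀ k, ζ k = ev (orderedExp (ofArray τ) k) := by
    intro k
    induction k using Nat.strong_induction_on with
    | _ k ih =>
      rcases k with _ | k
      · rw [orderedExp, ev_one]; exact funext hζ0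
      · rw [hζ, orderedExp_succ_eq_sum, map_sum]
        refine Finset.sum_congr rfl fun ij hij => ?_
        have := Finset.HasAntidiagonal.mem_antidiagonal.1 hij
        rw [ih ij.2 (by omega), shiftAct_eq, ← ev_mul, map_nsmul]
  have h1 := (orderedExp_succ hTE hT hEd k).2
  rw [hζk, hζk, hΦk, h1, hTE, mul_add, mul_add, map_add, map_add, ev_mul _ (ofArray ε), hE1,
    ← ev_mul, mul_one, mul_smul_comm, map_nsmul]
  simp only [Pi.add_apply]
  rw [Pi.smul_apply, nsmul_eq_mul]
  push_cast
  ring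

end gapOp

/-! ### Words, masks, and the low and high parts of a word. -/

/-- The lists of length `n` with entries less than `M`. -/
def wordFinset (M : ℕ) : ℕ → Finset (List ℕ)
  | 0 => {[]}
  | n + 1 => (Finset.range M ×ˢ wordFinset M n).image fun p => p.1 :: p.2

theorem mem_wordFinset {M n : ℕ} {l : List ℕ} :
    l ∈ wordFinset M n ↔ l.length = n ∧ ∀ x ∈ l, x < M := by
  induction n generalizing l with
  | zero =>
    simp only [wordFinset, Finset.mem_singleton, List.length_eq_zero_iff]
    constructor
    · rintro rfl; simp
    · exact fun h => h.1
  | succ n ih =>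
    simp only [wordFinset, Finset.mem_image, Finset.mem_product, Finset.mem_range, ih, Prod.exists]
    constructor
    · rintro ⟨a, l, ⟨ha, hl, h⟩, rfl⟩
      simp_all
    · rintro ⟨hl, h⟩
      rcases l with _ | ⟨a, l⟩
      · simp at hl
      · simp at hl h
        exact ⟨a, l, ⟨h.1, hl, h.2⟩, rfl⟩

/-- The Boolean lists with `i` entries `true` and `j` entries `false`. -/
def maskFinset : ℕ → ℕ → Finset (List Bool)
  | 0, j => {List.replicate j false}
  | i + 1, 0 => {List.replicate (i + 1) true}
  | i + 1, j + 1 => (maskFinset i (j + 1)).image (List.cons true) ∪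
      (maskFinset (i + 1) j).image (List.cons false)

theorem mem_maskFinset {i j : ℕ} {l : List Bool} :
    l ∈ maskFinset i j ↔ l.count true = i ∧ l.count false = j := by
  induction l generalizing i j with
  | nil =>
    rcases i with _ | i <;> rcases j with _ | j <;> simp [maskFinset, List.replicate_succ]
  | cons b l ih =>
    have all_false : ∀ l : List Bool, ∀ j, l = List.replicate j false ↔
        l.count true = 0 ∧ l.count false = j := by
      intro l
      induction l with
      | nil => intro j; rcases j with _ | j <;> simp [List.replicate_succ]
      | cons b l ih => intro j; rcases j with _ | j <;> cases b <;> simp [List.replicate_succ, ih]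
    have all_true : ∀ l : List Bool, ∀ j, l = List.replicate j true ↔
        l.count true = j ∧ l.count false = 0 := by
      intro l
      induction l with
      | nil => intro j; rcases j with _ | j <;> simp [List.replicate_succ]
      | cons b l ih => intro j; rcases j with _ | j <;> cases b <;> simp [List.replicate_succ, ih]
    rcases i with _ | i
    · rw [maskFinset, Finset.mem_singleton, all_false]
    rcases j with _ | j
    · rw [maskFinset, Finset.mem_singleton, all_true]
    · cases b <;> simp [maskFinset, ih]

theorem card_maskFinset (i j : ℕ) : (maskFinset i j).card = (i + j).choose i := by
  induction i generalizing j with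
  | zero => simp [maskFinset]
  | succ i ihi =>
    induction j with
    | zero => simp [maskFinset]
    | succ j ihj =>
      rw [maskFinset, Finset.card_union_of_disjoint, Finset.card_image_of_injective _
        List.cons_injective, Finset.card_image_of_injective _ List.cons_injective, ihi, ihj]
      · rw [show i + 1 + (j + 1) = (i + (j + 1)) + 1 by ring, Nat.choose_succ_succ,
          show i + 1 + j = i + (j + 1) by ring]
      · rw [Finset.disjoint_left]
        intro l h1 h2
        simp only [Finset.mem_image] at h1 h2
        obtain ⟨a, _, rfl⟩ := h1
        obtain ⟨b, _, h⟩ := h2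
        simp at h

/-- The Boolean lists with `l` entries `true` and `n` entries `false` that do not start
with `true`. -/
def gapMaskFinset (n l : ℕ) : Finset (List Bool) :=
  (maskFinset l n).filter fun μ => μ.head? ≠ some true

theorem mem_gapMaskFinset {n l : ℕ} {μ : List Bool} : μ ∈ gapMaskFinset n l ↔
    (μ.count true = l ∧ μ.count false = n) ∧ μ.head? ≠ some true := by
  rw [gapMaskFinset, Finset.mem_filter, mem_maskFinset]

/-- Each `true` lies in the gap after one of the `n` entries `false`: a multiset of `l` gaps. After
the forced initial `false` the mask is arbitrary. -/
theorem card_gapMaskFinset (n l : ℕ) : (gapMaskFinset n l).card = n.multichoose l := by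
  rcases n with _ | n
  · rcases l with _ | l
    · simp [gapMaskFinset, maskFinset, Finset.filter_singleton]
    · rw [Nat.multichoose_zero_succ, Finset.card_eq_zero, Finset.eq_empty_iff_forall_notMem]
      intro μ h
      rw [mem_gapMaskFinset] at h
      rcases μ with _ | ⟨b, μ⟩
      · simp at h
      · cases b <;> simp at h
  · have : gapMaskFinset (n + 1) l = (maskFinset l n).image (List.cons false) := by
      ext μ
      rw [mem_gapMaskFinset, Finset.mem_image]
      constructor
      · rintro ⟨⟨h1, h2⟩, h3⟩
        rcases μ with _ | ⟨b, μ⟩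
        · simp at h2
        · cases b
          · simp at h1 h2
            exact ⟨μ, mem_maskFinset.2 ⟨h1, h2⟩, rfl⟩
          · simp at h3
      · rintro ⟨μ, h, rfl⟩
        rw [mem_maskFinset] at h
        simp [h]
    rw [this, Finset.card_image_of_injective _ List.cons_injective, card_maskFinset,
      Nat.multichoose_eq, show n + 1 + l - 1 = l + n by omega]

/-- The entries of a list that are less than `c`. -/
def lowPart (c : ℕ) (R : List ℕ) : List ℕ := R.filter (· < c)

/-- The entries of a list that are at least `c`, reduced by `c`. -/
def highPart (c : ℕ) (R : List ℕ) : List ℕ := (R.filter (c ≤ ·)).map (· - c)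

/-- The positions of the entries less than `c`. -/
def lowMask (c : ℕ) (R : List ℕ) : List Bool := R.map (· < c)

/-- The list whose low part, high part and mask are given. -/
def riffle (c : ℕ) : List Bool → List ℕ → List ℕ → List ℕ
  | true :: μ, x :: L, H => x :: riffle c μ L H
  | false :: μ, L, y :: H => (y + c) :: riffle c μ L H
  | _, _, _ => []

theorem riffle_parts (c : ℕ) (R : List ℕ) :
    riffle c (lowMask c R) (lowPart c R) (highPart c R) = R := by
  induction R with
  | nil => rfl
  | cons x R ih =>
    by_cases h : x < c
    · have h' : ¬ c ≤ x := by omega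
      simpa [lowMask, lowPart, highPart, h, h', riffle] using ih
    · have h' : c ≤ x := by omega
      have := ih
      simp only [lowMask, lowPart, highPart] at this
      simp [lowMask, lowPart, highPart, h, h', riffle, this]

theorem parts_riffle {c : ℕ} {μ : List Bool} {L H : List ℕ} (hL : ∀ x ∈ L, x < c)
    (h1 : μ.count true = L.length) (h2 : μ.count false = H.length) :
    lowMask c (riffle c μ L H) = μ ∧ lowPart c (riffle c μ L H) = L ∧
      highPart c (riffle c μ L H) = H := by
  induction μ generalizing L H with
  | nil =>
    simp at h1 h2
    rw [eq_comm, List.length_eq_zero_iff] at h1 h2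
    subst h1 h2
    simp [riffle, lowMask, lowPart, highPart]
  | cons b μ ih =>
    cases b
    · rcases H with _ | ⟨y, H⟩
      · simp at h2
      · simp at h1 h2
        have := ih hL h1 h2
        simp only [lowMask, lowPart, highPart] at this
        simp [riffle, lowMask, lowPart, highPart, this]
    · rcases L with _ | ⟨x, L⟩
      · simp at h1
      · simp at h1 h2 hL
        have := ih hL.2 h1 h2
        simp only [lowMask, lowPart, highPart] at this
        have h' : ¬ c ≤ x := by omega
        simp [riffle, lowMask, lowPart, highPart, this, hL.1, h']

theorem lowPart_append (c : ℕ) (R R' : List ℕ) :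
    lowPart c (R ++ R') = lowPart c R ++ lowPart c R' := by simp [lowPart]

theorem highPart_append (c : ℕ) (R R' : List ℕ) :
    highPart c (R ++ R') = highPart c R ++ highPart c R' := by simp [highPart]

theorem mem_lowPart {c x : ℕ} {R : List ℕ} : x ∈ lowPart c R ↔ x ∈ R ∧ x < c := by simp [lowPart]

theorem mem_highPart {c x : ℕ} {R : List ℕ} : x ∈ highPart c R ↔ x + c ∈ R := by
  simp only [highPart, List.mem_map, List.mem_filter, decide_eq_true_eq]
  constructor
  · rintro ⟨y, ⟨h1, h2⟩, rfl⟩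
    rwa [Nat.sub_add_cancel h2]
  · exact fun h => ⟨x + c, ⟨h, by omega⟩, by omega⟩

theorem count_lowMask (c : ℕ) (R : List ℕ) : (lowMask c R).count true = (lowPart c R).length ∧
    (lowMask c R).count false = (highPart c R).length := by
  induction R with
  | nil => simp [lowMask, lowPart, highPart]
  | cons x R ih =>
    simp only [lowMask, lowPart, highPart] at ih
    by_cases h : x < c
    · have h' : ¬ c ≤ x := by omega
      simp [lowMask, lowPart, highPart, h, h'] at ih ⊢
      exact ih
    · have h' : c ≤ x := by omega
      simp [lowMask, lowPart, highPart, h, h'] at ih ⊢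
      exact ih

theorem length_parts (c : ℕ) (R : List ℕ) :
    (lowPart c R).length + (highPart c R).length = R.length := by
  induction R with
  | nil => rfl
  | cons x R ih =>
    simp only [lowPart, highPart, List.length_map] at ih
    by_cases h : x < c
    · have h' : ¬ c ≤ x := by omega
      simp [lowPart, highPart, h, h']; omega
    · have h' : c ≤ x := by omega
      simp [lowPart, highPart, h, h']; omega

theorem highPart_sublist_iff {c : ℕ} {l R : List ℕ} :
    l.Sublist (highPart c R) ↔ (l.map (· + c)).Sublist R := by
  constructor
  · intro h
    have h1 := h.map (· + c)
    refine h1.trans ?_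
    rw [highPart, List.map_map]
    have e : (R.filter (c ≤ ·)).map ((· + c) ∘ (· - c)) = R.filter (c ≤ ·) := by
      conv_rhs => rw [← List.map_id (R.filter (c ≤ ·))]
      refine List.map_congr_left fun x hx => ?_
      have : c ≤ x := by simpa using (List.mem_filter.1 hx).2
      simp only [Function.comp, id]; omega
    rw [e]
    exact List.filter_sublist
  · intro h
    have h1 := (h.filter (c ≤ ·)).map (· - c)
    have e : ((l.map (· + c)).filter (c ≤ ·)).map (· - c) = l := by
      rw [List.filter_eq_self.2 (by simp), List.map_map]
      conv_rhs => rw [← List.map_id l]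
      exact List.map_congr_left fun x _ => by simp
    rwa [e] at h1

theorem lowPart_sublist_iff {c : ℕ} {l R : List ℕ} (hl : ∀ x ∈ l, x < c) :
    l.Sublist (lowPart c R) ↔ l.Sublist R := by
  constructor
  · exact fun h => h.trans List.filter_sublist
  · intro h
    have h1 := h.filter (· < c)
    rwa [List.filter_eq_self.2 (by simpa using hl)] at h1

/-! ### Restricted growth functions, bar words and their splitting at a letter. -/

/-- Restricted growth functions: every letter is preceded by all smaller ones. -/
def Rgf (l : List ℕ) : Prop := ∀ l₁ x l₂, l = l₁ ++ x :: l₂ → ∀ y < x, y ∈ l₁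

/-- The number of distinct letters. -/
def numLetters (l : List ℕ) : ℕ := l.toFinset.card

/-- The words without a subsequence `b a a b`, `a < b`. -/
def TypeA (l : List ℕ) : Prop := ∀ a b, a < b → ¬ [b, a, a, b].Sublist l

theorem numLetters_eq {l : List ℕ} {m : ℕ} (h : ∀ x, x ∈ l ↔ x < m) : numLetters l = m := by
  have : l.toFinset = Finset.range m := by ext x; simp [h]
  rw [numLetters, this, Finset.card_range]

theorem numLetters_le_length (l : List ℕ) : numLetters l ≤ l.length := List.toFinset_card_le l

theorem Rgf.mem_iff {l : List ℕ} (hl : Rgf l) {x : ℕ} : x ∈ l ↔ x < numLetters l := by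
  have down : ∀ y ∈ l, ∀ z < y, z ∈ l := by
    intro y hy z hz
    obtain ⟨l₁, l₂, h⟩ := List.append_of_mem hy
    rw [h]; exact List.mem_append_left _ (hl l₁ y l₂ h z hz)
  have : ∃ m, ∀ x, x ∈ l ↔ x < m := by
    rcases l.toFinset.eq_empty_or_nonempty with h | h
    · exact ⟨0, fun x => by
        have : x ∉ l.toFinset := by rw [h]; simp
        simpa using this⟩
    · refine ⟨l.toFinset.max' h + 1, fun x => ?_⟩
      constructor
      · intro hx
        have := l.toFinset.le_max' x (by simpa using hx)
        omega
      · intro hx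
        have hm := List.mem_toFinset.1 (l.toFinset.max'_mem h)
        rcases Nat.lt_or_ge x (l.toFinset.max' h) with h1 | h1
        · exact down _ hm _ h1
        · rwa [show x = l.toFinset.max' h by omega]
  obtain ⟨m, hm⟩ := this
  rw [numLetters_eq hm, hm]

theorem Rgf.of_prefix {l l' : List ℕ} (h : Rgf (l ++ l')) : Rgf l := by
  intro l₁ x l₂ e y hy
  exact h l₁ x (l₂ ++ l') (by rw [e]; simp) y hy

theorem TypeA.sublist {l l' : List ℕ} (h : TypeA l') (hs : l.Sublist l') : TypeA l :=
  fun a b hab h1 => h a b hab (h1.trans hs)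

/-- A restricted growth function `P` with a bar after it, followed by a word `V` over the letters of
`P` and the next larger letter, which is considered to be present at the bar. -/
def BarWord (P V : List ℕ) : Prop :=
  Rgf P ∧ (∀ x ∈ V, x ≤ numLetters P) ∧ TypeA (P ++ numLetters P :: V)

/-- Bar words whose second part consists of distinct letters of the first one. -/
def DistinctTail (P V : List ℕ) : Prop := V.Nodup ∧ numLetters P ∉ V

theorem sublist_of_cons_sublist_append {x : ℕ} {l A B : List ℕ} (h : (x :: l).Sublist (A ++ B))
    (hx : x ∉ A) : (x :: l).Sublist B := by
  induction A with
  | nil => exact h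
  | cons a A ih =>
    simp only [List.mem_cons, not_or] at hx
    rw [List.cons_append] at h
    rcases List.sublist_cons_iff.1 h with h1 | ⟨r, h1, h2⟩
    · exact ih h1 hx.2
    · rw [List.cons.injEq] at h1; exact absurd h1.1 hx.1

/-- An occurrence of b a a b with b ≥ c lies in `Z`, as its first letter is not in `L`; then a < c
would be a repeated small letter of `Z`. So each occurrence is entirely low or entirely high. -/
theorem typeA_append_iff {c : ℕ} {L Z : List ℕ} (hL : ∀ x ∈ L, x < c)
    (hn : (lowPart c Z).Nodup) :
    TypeA (L ++ Z) ↔ TypeA (L ++ lowPart c Z) ∧ TypeA (highPart c Z) := by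
  constructor
  · intro h
    refine ⟨h.sublist (List.Sublist.append_left List.filter_sublist L), fun a b hab h1 => ?_⟩
    rw [highPart_sublist_iff] at h1
    exact h (a + c) (b + c) (by omega) (h1.trans (List.sublist_append_right L Z))
  · rintro ⟨h1, h2⟩ a b hab h
    by_cases hb : b < c
    · refine h1 a b hab ?_
      have e : L ++ lowPart c Z = lowPart c (L ++ Z) := by
        rw [lowPart_append]; congr 1
        exact (List.filter_eq_self.2 (by simpa using hL)).symm
      rw [e, lowPart_sublist_iff]
      · exact h
      · intro x hx
        simp at hx
        omega
    · have h3 := sublist_of_cons_sublist_append h (fun hb' => hb (hL b hb'))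
      by_cases ha : a < c
      · have h4 : [a, a].Sublist (lowPart c Z) := by
          rw [lowPart_sublist_iff (by simp [ha])]
          refine List.Sublist.trans ?_ h3
          exact (((List.Sublist.refl [a]).cons_cons a).trans (List.sublist_append_left [a, a] [b])).cons b
        exact List.nodup_iff_sublist.1 hn a h4
      · refine h2 (a - c) (b - c) (by omega) ?_
        rw [highPart_sublist_iff]
        simpa [Nat.sub_add_cancel (Nat.le_of_not_lt ha), Nat.sub_add_cancel (Nat.le_of_not_lt hb)]
          using h3

/-- A single largest letter can be neither a, which is not maximal, nor b, which is needed twice. -/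
theorem typeA_insert_iff {A B : List ℕ} {c : ℕ} (hA : ∀ x ∈ A, x < c) (hB : ∀ x ∈ B, x < c) :
    TypeA (A ++ c :: B) ↔ TypeA (A ++ B) := by
  constructor
  · exact fun h => h.sublist (List.Sublist.append_left (List.sublist_cons_self _ _) _)
  · intro h a b hab h1
    have key : ∀ x ∈ A ++ c :: B, x ≤ c := by
      intro x hx
      simp only [List.mem_append, List.mem_cons] at hx
      rcases hx with hx | rfl | hx
      · exact (hA x hx).le
      · exact le_rfl
      · exact (hB x hx).le
    have hb : b ≤ c := key b (h1.subset (by simp))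
    rcases hb.lt_or_eq with hb | rfl
    · refine h a b hab ?_
      have h2 := h1.filter (· < c)
      rw [List.filter_eq_self.2 (by intro x hx; simp at hx ⊢; omega), List.filter_append,
        List.filter_cons_of_neg (by simp), List.filter_eq_self.2 (by simpa using hA),
        List.filter_eq_self.2 (by simpa using hB)] at h2
      exact h2
    · have h2 := h1.count_le b
      have cA : A.count b = 0 := List.count_eq_zero.2 fun h => lt_irrefl _ (hA b h)
      have cB : B.count b = 0 := List.count_eq_zero.2 fun h => lt_irrefl _ (hB b h)
      rw [List.count_append, List.count_cons_self (l := B), cA, cB] at h2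
      simp [hab.ne] at h2

theorem highPart_eq_nil {c : ℕ} {L : List ℕ} (h : ∀ x ∈ L, x < c) : highPart c L = [] := by
  rw [highPart, List.map_eq_nil_iff, List.filter_eq_nil_iff]
  intro x hx
  have := h x hx
  simpa using this

/-- The part of a list before the first entry that is at least `c`. -/
def initPart (c : ℕ) (P : List ℕ) : List ℕ := P.takeWhile (· < c)

/-- The part of a list from the first entry on that is at least `c`. -/
def restPart (c : ℕ) (P : List ℕ) : List ℕ := P.dropWhile (· < c)

theorem initPart_append_restPart (c : ℕ) (P : List ℕ) : initPart c P ++ restPart c P = P :=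
  List.takeWhile_append_dropWhile

theorem lt_of_mem_initPart {c x : ℕ} {P : List ℕ} (h : x ∈ initPart c P) : x < c := by
  simpa using List.mem_takeWhile_imp h

theorem head?_lowMask_restPart (c : ℕ) (P : List ℕ) :
    (lowMask c (restPart c P)).head? ≠ some true := by
  have h := List.head?_dropWhile_not (p := fun x => decide (x < c)) (l := P)
  rw [lowMask, List.head?_map, restPart]
  cases hc : (P.dropWhile (· < c)).head? with
  | none => simp
  | some x =>
    rw [hc] at h
    simp at h ⊢
    omega

theorem initPart_append {c : ℕ} {L R : List ℕ} (hL : ∀ x ∈ L, x < c)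
    (hR : (lowMask c R).head? ≠ some true) : initPart c (L ++ R) = L ∧ restPart c (L ++ R) = R := by
  have h : initPart c R = [] ∧ restPart c R = R := by
    rcases R with _ | ⟨x, R⟩
    · simp [initPart, restPart]
    · simp [lowMask] at hR
      have : ¬ x < c := by omega
      simp [initPart, restPart, this]
  constructor
  · rw [initPart, List.takeWhile_append_of_pos (by simpa using hL)]
    rw [← initPart, h.1, List.append_nil]
  · rw [restPart, List.dropWhile_append_of_pos (by simpa using hL)]
    exact h.2

theorem Rgf.numLetters_initPart {c : ℕ} {P : List ℕ} (hP : Rgf P) (hc : c ≤ numLetters P) :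
    numLetters (initPart c P) = c := by
  apply numLetters_eq
  intro x
  refine ⟨lt_of_mem_initPart, fun hx => ?_⟩
  rcases h : restPart c P with _ | ⟨z, R⟩
  · have e := initPart_append_restPart c P
    rw [h, List.append_nil] at e
    rw [e]
    exact hP.mem_iff.2 (by omega)
  · have e := initPart_append_restPart c P
    rw [h] at e
    have hz : ¬ z < c := by
      have := head?_lowMask_restPart c P
      rw [h] at this
      simpa [lowMask] using this
    exact hP _ z R e.symm x (by omega)

theorem Rgf.highPart_restPart {c : ℕ} {P : List ℕ} (hP : Rgf P) :
    Rgf (highPart c (restPart c P)) := by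
  intro l₁ x l₂ h y hy
  rw [highPart, List.map_eq_append_iff] at h
  obtain ⟨a, b, hab, rfl, hb⟩ := h
  rw [List.map_eq_cons_iff] at hb
  obtain ⟨z, b', rfl, rfl, rfl⟩ := hb
  rw [List.filter_eq_append_iff] at hab
  obtain ⟨r₁, r₂, hr, rfl, hr2⟩ := hab
  rw [List.filter_eq_cons_iff] at hr2
  obtain ⟨s₁, s₂, rfl, hs1, hz, -⟩ := hr2
  have hz' : c ≤ z := by simpa using hz
  have e := initPart_append_restPart c P
  rw [hr] at e
  have h1 := hP (initPart c P ++ r₁ ++ s₁) z s₂ (e.symm.trans (by simp)) (y + c) (by omega)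
  rw [List.mem_append, List.mem_append] at h1
  rcases h1 with (h1 | h1) | h1
  · exact absurd (lt_of_mem_initPart h1) (by omega)
  · exact mem_highPart.2 h1
  · exact absurd (by simp) (hs1 _ h1)

theorem Rgf.append {c : ℕ} {L R : List ℕ} (hL : Rgf L) (hc : numLetters L = c)
    (hR : Rgf (highPart c R)) : Rgf (L ++ R) := by
  intro l₁ x l₂ h y hy
  rw [List.append_eq_append_iff] at h
  rcases h with ⟨a, rfl, ha⟩ | ⟨a, rfl, ha⟩
  · rw [List.mem_append]
    by_cases hyc : y < c
    · exact Or.inl (hL.mem_iff.2 (by omega))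
    · right
      have hx : c ≤ x := by omega
      have e : highPart c R = highPart c a ++ (x - c) :: highPart c l₂ := by
        rw [ha, highPart_append]; simp [highPart, hx]
      have := hR _ _ _ e (y - c) (by omega)
      rw [mem_highPart, Nat.sub_add_cancel (by omega)] at this
      exact this
  · rcases a with _ | ⟨z, a⟩
    · simp at ha
      subst ha
      by_cases hyc : y < c
      · rw [List.append_nil] at hL hc; exact hL.mem_iff.2 (by omega)
      · have hx : c ≤ x := by omega
        have e : highPart c (x :: l₂) = [] ++ (x - c) :: highPart c l₂ := by
          simp [highPart, hx]
        have := hR _ _ _ e (y - c) (by omega)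
        simp at this
    · rw [List.cons_append, List.cons.injEq] at ha
      obtain ⟨rfl, -⟩ := ha
      exact hL l₁ x a rfl y hy

theorem Rgf.numLetters_append {c : ℕ} {L R : List ℕ} (hL : Rgf L) (hc : numLetters L = c)
    (hR : Rgf (highPart c R)) : numLetters (L ++ R) = c + numLetters (highPart c R) := by
  have h := hL.append hc hR
  apply numLetters_eq
  intro x
  rw [List.mem_append, hL.mem_iff, hc]
  constructor
  · rintro (h1 | h1)
    · omega
    · by_cases hx : x < c
      · omega
      · have : x - c ∈ highPart c R := mem_highPart.2 (by rwa [Nat.sub_add_cancel (by omega)])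
        rw [hR.mem_iff] at this
        omega
  · intro h1
    by_cases hx : x < c
    · exact Or.inl hx
    · right
      have : x - c ∈ highPart c R := hR.mem_iff.2 (by omega)
      rwa [mem_highPart, Nat.sub_add_cancel (by omega)] at this

/-- A bar word is determined by its low part and its high part with respect to a letter `c` such
that smaller letters occur at most once after the first `c`. -/
theorem barWord_iff {c : ℕ} {L RP V : List ℕ} (hL : Rgf L) (hc : numLetters L = c)
    (hRP : Rgf (highPart c RP)) (hn : (lowPart c (RP ++ V)).Nodup) :
    BarWord (L ++ RP) V ↔
      BarWord L (lowPart c (RP ++ V)) ∧ BarWord (highPart c RP) (highPart c V) := by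
  have hLc : ∀ x ∈ L, x < c := fun x hx => by rw [← hc]; exact hL.mem_iff.1 hx
  have hnum := hL.numLetters_append hc hRP
  set m := numLetters (highPart c RP) with hm
  have e1 : lowPart c (RP ++ (c + m) :: V) = lowPart c (RP ++ V) := by
    simp [lowPart]
  have e2 : highPart c (RP ++ (c + m) :: V) = highPart c RP ++ m :: highPart c V := by
    simp [highPart]
  have hA : TypeA (L ++ RP ++ (c + m) :: V) ↔
      TypeA (L ++ c :: lowPart c (RP ++ V)) ∧ TypeA (highPart c RP ++ m :: highPart c V) := by
    rw [List.append_assoc, typeA_append_iff hLc (by rw [e1]; exact hn), e1, e2,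
      typeA_insert_iff hLc fun x hx => (mem_lowPart.1 hx).2]
  unfold BarWord
  rw [hnum, hc, hA, ← hm]
  constructor
  · rintro ⟨h1, h2, h3, h4⟩
    refine ⟨⟨hL, fun x hx => (mem_lowPart.1 hx).2.le, h3⟩, hRP, fun x hx => ?_, h4⟩
    have := h2 _ (mem_highPart.1 hx)
    omega
  · rintro ⟨⟨-, -, h3⟩, -, h2, h4⟩
    refine ⟨hL.append hc hRP, fun x hx => ?_, h3, h4⟩
    by_cases hx' : x < c
    · omega
    · have := h2 (x - c) (mem_highPart.2 (by rwa [Nat.sub_add_cancel (by omega)]))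
      omega

/-! ### Weighted counts of bar words and of split words. -/

open scoped Classical in
/-- The bar words with `N` letters before and `k` letters after the bar that satisfy `R`. -/
noncomputable def barFinset (R : List ℕ → List ℕ → Prop) (N k : ℕ) : Finset (List ℕ × List ℕ) :=
  (wordFinset (N + 1) N ×ˢ wordFinset (N + 1) k).filter fun q => BarWord q.1 q.2 ∧ R q.1 q.2

theorem mem_barFinset {R : List ℕ → List ℕ → Prop} {N k : ℕ} {q : List ℕ × List ℕ} :
    q ∈ barFinset R N k ↔ q.1.length = N ∧ q.2.length = k ∧ BarWord q.1 q.2 ∧ R q.1 q.2 := by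
  classical
  rw [barFinset, Finset.mem_filter, Finset.mem_product, mem_wordFinset, mem_wordFinset]
  constructor
  · rintro ⟨⟨⟨h1, -⟩, h2, -⟩, h3⟩
    exact ⟨h1, h2, h3⟩
  · rintro ⟨h1, h2, h3⟩
    have hN := numLetters_le_length q.1
    refine ⟨⟨⟨h1, fun x hx => ?_⟩, h2, fun x hx => ?_⟩, h3⟩
    · have := h3.1.1.mem_iff.1 hx
      omega
    · have := h3.1.2.1 x hx
      omega

/-- The weighted number of bar words satisfying `R`. -/
noncomputable def barSum (w : ℚ) (R : List ℕ → List ℕ → Prop) (k N : ℕ) : ℚ :=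
  ∑ q ∈ barFinset R N k, w ^ numLetters q.1

/-- Bar words with a marked letter `c` such that smaller letters occur at most once after the
first `c`, with given numbers of small and large letters after the bar. -/
structure SplitWord (R : List ℕ → List ℕ → Prop) (N i j : ℕ) (x : ℕ × List ℕ × List ℕ) : Prop where
  length_eq : x.2.1.length = N
  barWord : BarWord x.2.1 x.2.2
  le : x.1 ≤ numLetters x.2.1
  low : (lowPart x.1 x.2.2).length = i
  high : (highPart x.1 x.2.2).length = j
  nodup : (lowPart x.1 (restPart x.1 x.2.1 ++ x.2.2)).Nodup
  rel : R (highPart x.1 (restPart x.1 x.2.1)) (highPart x.1 x.2.2)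

open scoped Classical in
/-- The finite set of split words. -/
noncomputable def splitFinset (R : List ℕ → List ℕ → Prop) (N i j : ℕ) :
    Finset (ℕ × List ℕ × List ℕ) :=
  (Finset.range (N + 1) ×ˢ wordFinset (N + 1) N ×ˢ wordFinset (N + 1) (i + j)).filter
    (SplitWord R N i j)

theorem mem_splitFinset {R : List ℕ → List ℕ → Prop} {N i j : ℕ} {x : ℕ × List ℕ × List ℕ} :
    x ∈ splitFinset R N i j ↔ SplitWord R N i j x := by
  classical
  rw [splitFinset, Finset.mem_filter]
  refine ⟨fun h => h.2, fun h => ⟨?_, h⟩⟩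
  have hN := numLetters_le_length x.2.1
  have h1 := h.length_eq
  have h2 := h.le
  have h3 := length_parts x.1 x.2.2
  rw [h.low, h.high] at h3
  rw [Finset.mem_product, Finset.mem_product, mem_wordFinset, mem_wordFinset, Finset.mem_range]
  refine ⟨by omega, ⟨h1, fun y hy => ?_⟩, h3.symm, fun y hy => ?_⟩
  · have := h.barWord.1.mem_iff.1 hy
    omega
  · have := h.barWord.2.1 y hy
    omega

/-- The low and high parts of a split word and the ways in which they are interleaved. -/
def splitParts (x : ℕ × List ℕ × List ℕ) :
    List Bool × List Bool × (List ℕ × List ℕ) × (List ℕ × List ℕ) :=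
  (lowMask x.1 x.2.2, lowMask x.1 (restPart x.1 x.2.1),
    (initPart x.1 x.2.1, lowPart x.1 (restPart x.1 x.2.1 ++ x.2.2)),
    (highPart x.1 (restPart x.1 x.2.1), highPart x.1 x.2.2))

/-- The split word with given low and high parts. -/
def joinParts (l : ℕ) (p : List Bool × List Bool × (List ℕ × List ℕ) × (List ℕ × List ℕ)) :
    ℕ × List ℕ × List ℕ :=
  (numLetters p.2.2.1.1,
    p.2.2.1.1 ++ riffle (numLetters p.2.2.1.1) p.2.1 (p.2.2.1.2.take l) p.2.2.2.1,
    riffle (numLetters p.2.2.1.1) p.1 (p.2.2.1.2.drop l) p.2.2.2.2)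

theorem joinParts_splitParts {R : List ℕ → List ℕ → Prop} {N i j l : ℕ} {x : ℕ × List ℕ × List ℕ}
    (h : SplitWord R N i j x) (hl : (lowPart x.1 (restPart x.1 x.2.1)).length = l) :
    joinParts l (splitParts x) = x := by
  obtain ⟨c, P, V⟩ := x
  have hc := h.barWord.1.numLetters_initPart h.le
  simp only at hc hl
  simp only [joinParts, splitParts, hc, lowPart_append]
  rw [List.take_left' hl, List.drop_left' hl, riffle_parts, riffle_parts, initPart_append_restPart]

theorem splitParts_mem {R : List ℕ → List ℕ → Prop} {N i j l n N' : ℕ} {x : ℕ × List ℕ × List ℕ}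
    (h : SplitWord R N i j x) (hN : (initPart x.1 x.2.1).length = N')
    (hl : (lowPart x.1 (restPart x.1 x.2.1)).length = l)
    (hn : (highPart x.1 (restPart x.1 x.2.1)).length = n) :
    splitParts x ∈ maskFinset i j ×ˢ gapMaskFinset n l ×ˢ barFinset DistinctTail N' (l + i) ×ˢ
      barFinset R n j := by
  obtain ⟨c, P, V⟩ := x
  obtain ⟨h1, h2, h3, h4, h5, h6, h7⟩ := h
  simp only at *
  have hc := h2.1.numLetters_initPart h3
  have hI : Rgf (initPart c P) :=
    Rgf.of_prefix (l' := restPart c P) (by rw [initPart_append_restPart]; exact h2.1)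
  have hB := h2
  rw [← initPart_append_restPart c P, barWord_iff hI hc h2.1.highPart_restPart h6] at hB
  simp only [splitParts, Finset.mem_product, mem_maskFinset, mem_gapMaskFinset, mem_barFinset]
  refine ⟨?_, ⟨?_, head?_lowMask_restPart c P⟩, ⟨hN, ?_, hB.1, h6, ?_⟩, hn, h5, hB.2, h7⟩
  · rw [(count_lowMask c V).1, (count_lowMask c V).2]
    exact ⟨h4, h5⟩
  · rw [(count_lowMask c _).1, (count_lowMask c _).2]
    exact ⟨hl, hn⟩
  · rw [lowPart_append, List.length_append, hl, h4]
  · rw [hc]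
    exact fun h => lt_irrefl _ (mem_lowPart.1 h).2

theorem joinParts_spec {R : List ℕ → List ℕ → Prop} {N i j l n N' : ℕ}
    {p : List Bool × List Bool × (List ℕ × List ℕ) × (List ℕ × List ℕ)}
    (hp : p ∈ maskFinset i j ×ˢ gapMaskFinset n l ×ˢ barFinset DistinctTail N' (l + i) ×ˢ
      barFinset R n j) (hN : N' + l + n = N) :
    SplitWord R N i j (joinParts l p) ∧ splitParts (joinParts l p) = p ∧
      numLetters (joinParts l p).2.1 = numLetters p.2.2.1.1 + numLetters p.2.2.2.1 := by
  obtain ⟨μ, ν, ⟨L, Q⟩, HP, HV⟩ := p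
  simp only [Finset.mem_product, mem_maskFinset, mem_gapMaskFinset, mem_barFinset] at hp
  obtain ⟨⟨m1, m2⟩, ⟨⟨n1, n2⟩, n3⟩, ⟨hL, hQ, hLQ, hQn, hQm⟩, hHP, hHV, hH, hR⟩ := hp
  obtain ⟨c, hc⟩ : ∃ c, numLetters L = c := ⟨_, rfl⟩
  have hQc : ∀ x ∈ Q, x < c := fun x hx => by
    have := hLQ.2.1 x hx
    rcases this.lt_or_eq with h | h
    · omega
    · exact absurd (h ▸ hx) hQm
  have hLc : ∀ x ∈ L, x < c := fun x hx => by rw [← hc]; exact hLQ.1.mem_iff.1 hx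
  obtain ⟨a1, a2, a3⟩ := parts_riffle (c := c) (μ := μ) (L := Q.drop l) (H := HV)
    (fun x hx => hQc x (List.mem_of_mem_drop hx)) (by simp; omega) (by omega)
  obtain ⟨b1, b2, b3⟩ := parts_riffle (c := c) (μ := ν) (L := Q.take l) (H := HP)
    (fun x hx => hQc x (List.mem_of_mem_take hx)) (by simp; omega) (by omega)
  set V := riffle c μ (Q.drop l) HV with hV
  set RP := riffle c ν (Q.take l) HP with hRP
  have hi := initPart_append (c := c) (L := L) (R := RP) hLc (by rw [b1]; exact n3)
  have hQ' : lowPart c (RP ++ V) = Q := by rw [lowPart_append, a2, b2, List.take_append_drop]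
  have hrgf : Rgf (highPart c RP) := by rw [b3]; exact hH.1
  have hnum := hLQ.1.numLetters_append hc hrgf
  have hlen := length_parts c RP
  rw [b2, b3, List.length_take] at hlen
  have hj : joinParts l (μ, ν, (L, Q), HP, HV) = (c, L ++ RP, V) := by
    simp only [joinParts, hc, hV, hRP]
  rw [hj]
  refine ⟨⟨?_, ?_, ?_, ?_, ?_, ?_, ?_⟩, ?_, ?_⟩
  · simp only [List.length_append]; omega
  · simp only
    rw [barWord_iff hLQ.1 hc hrgf (by rw [hQ']; exact hQn), hQ', b3, a3]
    exact ⟨hLQ, hH⟩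
  · simp only; omega
  · simp only [a2, List.length_drop]; omega
  · simp only [a3, hHV]
  · simp only [hi.2, hQ', hQn]
  · simp only [hi.2, a3, b3, hR]
  · simp only [splitParts, hi.1, hi.2, a1, a3, b1, b3, hQ']
  · simp only [hnum, b3, hc]

/-- Four independent choices: the interleaving behind the bar, the interleaving of the rest of `P`
(which cannot start with a low letter), the low bar word and the high bar word. The first `l`
letters of the low tail belong before the bar, the other `i` behind it. Numbers of letters add, so
weights multiply. -/
theorem sum_splitFinset_fiber (w : ℚ) (R : List ℕ → List ℕ → Prop) {N i j l n N' : ℕ}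
    (hN : N' + l + n = N) :
    ∑ x ∈ splitFinset R N i j with ((lowPart x.1 (restPart x.1 x.2.1)).length = l ∧
      (initPart x.1 x.2.1).length = N') ∧ (highPart x.1 (restPart x.1 x.2.1)).length = n,
      w ^ numLetters x.2.1 = ((i + j).choose i : ℚ) *
        (barSum w DistinctTail (l + i) N' * (Nat.multichoose n l : ℚ) * barSum w R j n) := by
  have hprod : ((i + j).choose i : ℚ) *
        (barSum w DistinctTail (l + i) N' * (Nat.multichoose n l : ℚ) * barSum w R j n) =
      ∑ p ∈ maskFinset i j ×ˢ gapMaskFinset n l ×ˢ barFinset DistinctTail N' (l + i) ×ˢ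
        barFinset R n j, w ^ (numLetters p.2.2.1.1 + numLetters p.2.2.2.1) := by
    simp only [Finset.sum_product, pow_add, ← Finset.mul_sum, ← Finset.sum_mul, Finset.sum_const,
      nsmul_eq_mul, card_maskFinset, card_gapMaskFinset, barSum]
    ring
  rw [hprod]
  refine Finset.sum_nbij' splitParts (joinParts l) ?_ ?_ ?_ ?_ ?_
  · intro x hx
    rw [Finset.mem_filter, mem_splitFinset] at hx
    exact splitParts_mem hx.1 hx.2.1.2 hx.2.1.1 hx.2.2
  · intro p hp
    obtain ⟨h1, h2, -⟩ := joinParts_spec hp hN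
    rw [Finset.mem_filter, mem_splitFinset]
    rw [← h2] at hp
    generalize joinParts l p = x at hp h1
    obtain ⟨c, P, V⟩ := x
    simp only [splitParts, Finset.mem_product, mem_maskFinset, mem_gapMaskFinset,
      mem_barFinset] at hp
    refine ⟨h1, ⟨?_, hp.2.2.1.1⟩, hp.2.2.2.1⟩
    rw [← (count_lowMask c _).1]
    exact hp.2.1.1.1
  · intro x hx
    rw [Finset.mem_filter, mem_splitFinset] at hx
    exact joinParts_splitParts hx.1 hx.2.1.1
  · intro p hp
    exact (joinParts_spec hp hN).2.1
  · intro x hx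
    rw [Finset.mem_filter, mem_splitFinset] at hx
    have hp := splitParts_mem hx.1 hx.2.1.2 hx.2.1.1 hx.2.2
    rw [← (joinParts_spec hp hN).2.2, joinParts_splitParts hx.1 hx.2.1.1]

/-- The decomposition of split words into low parts and high parts. -/
theorem sum_splitFinset (w : ℚ) (R : List ℕ → List ℕ → Prop) (N i j : ℕ) :
    ∑ x ∈ splitFinset R N i j, w ^ numLetters x.2.1 =
      ((i + j).choose i : ℚ) * gapOp.shiftAct (barSum w DistinctTail) i (barSum w R j) N := by
  classical
  rw [gapOp.shiftAct, gapOp.act_ofArray, Finset.mul_sum]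
  have len : ∀ (c : ℕ) (P : List ℕ), (lowPart c (restPart c P)).length +
      (initPart c P).length + (highPart c (restPart c P)).length = P.length := fun c P => by
    have h1 := length_parts c (restPart c P)
    have h2 := congrArg List.length (initPart_append_restPart c P)
    rw [List.length_append] at h2
    omega
  rw [← Finset.sum_fiberwise_of_maps_to (t := Finset.HasAntidiagonal.antidiagonal N)
    (g := fun x => ((lowPart x.1 (restPart x.1 x.2.1)).length + (initPart x.1 x.2.1).length,
      (highPart x.1 (restPart x.1 x.2.1)).length))]
  · refine Finset.sum_congr rfl fun ab hab => ?_
    rw [Finset.mul_sum, ← Finset.sum_fiberwise_of_maps_to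
      (t := Finset.HasAntidiagonal.antidiagonal ab.1)
      (g := fun x => ((lowPart x.1 (restPart x.1 x.2.1)).length, (initPart x.1 x.2.1).length))]
    · refine Finset.sum_congr rfl fun kN hkN => ?_
      rw [Finset.HasAntidiagonal.mem_antidiagonal] at hab hkN
      rw [← sum_splitFinset_fiber w R (l := kN.1) (N' := kN.2) (n := ab.2) (N := N) (by omega),
        Finset.filter_filter]
      refine Finset.sum_congr (Finset.filter_congr fun x _ => ?_) fun _ _ => rfl
      simp only [Prod.ext_iff]
      constructor
      · rintro ⟨⟨h1, h2⟩, h3, h4⟩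
        exact ⟨⟨h3, h4⟩, h2⟩
      · rintro ⟨⟨h3, h4⟩, h2⟩
        exact ⟨⟨by omega, h2⟩, h3, h4⟩
    · intro x hx
      rw [Finset.mem_filter, Prod.ext_iff] at hx
      exact Finset.HasAntidiagonal.mem_antidiagonal.2 hx.2.1
  · intro x hx
    rw [Finset.HasAntidiagonal.mem_antidiagonal, len]
    exact (mem_splitFinset.1 hx).length_eq

/-! ### Recursions for the bar word counts. -/

theorem typeA_nil : TypeA [] := fun _ _ _ h => by simp at h

theorem rgf_nil : Rgf [] := fun l₁ x l₂ h => by simp at h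

@[simp] theorem numLetters_nil : numLetters [] = 0 := rfl

theorem Rgf.numLetters_eq_zero {P : List ℕ} (hP : Rgf P) : numLetters P = 0 ↔ P = [] := by
  constructor
  · intro h
    refine List.eq_nil_iff_forall_not_mem.2 fun x hx => ?_
    have := hP.mem_iff.1 hx
    omega
  · rintro rfl; rfl

theorem barWord_nil {V : List ℕ} : BarWord [] V ↔ ∀ x ∈ V, x = 0 := by
  constructor
  · intro h x hx
    simpa using h.2.1 x hx
  · intro h
    refine ⟨rgf_nil, fun x hx => (h x hx).le, fun a b hab h1 => ?_⟩
    have : ∀ x ∈ ([] : List ℕ) ++ numLetters [] :: V, x = 0 := by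
      intro x hx
      simp only [List.nil_append, numLetters_nil, List.mem_cons] at hx
      rcases hx with rfl | hx
      · rfl
      · exact h x hx
    have := this b (h1.subset (by simp))
    omega

theorem barWord_right_nil {P : List ℕ} : BarWord P [] ↔ Rgf P ∧ TypeA P := by
  constructor
  · rintro ⟨h1, -, h3⟩
    exact ⟨h1, h3.sublist (List.sublist_append_left _ _)⟩
  · rintro ⟨h1, h3⟩
    refine ⟨h1, by simp, ?_⟩
    rw [typeA_insert_iff (fun x hx => h1.mem_iff.1 hx) (by simp), List.append_nil]
    exact h3

theorem nodup_of_nodup_parts {c : ℕ} {V : List ℕ} (h1 : (lowPart c V).Nodup)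
    (h2 : (highPart c V).Nodup) : V.Nodup := by
  rw [List.nodup_iff_sublist]
  intro a h
  by_cases ha : a < c
  · exact List.nodup_iff_sublist.1 h1 a ((lowPart_sublist_iff (by simp [ha])).2 h)
  · refine List.nodup_iff_sublist.1 h2 (a - c) (highPart_sublist_iff.2 ?_)
    simpa [Nat.sub_add_cancel (Nat.le_of_not_lt ha)] using h

theorem nodup_highPart {c : ℕ} {V : List ℕ} (h : V.Nodup) : (highPart c V).Nodup := by
  rw [List.nodup_iff_sublist] at h ⊢
  intro a ha
  exact h (a + c) (by simpa using highPart_sublist_iff.1 ha)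

/-- The first letter ≥ c of a restricted growth function is c itself; if there is none, c is the new
letter at the bar. -/
theorem Rgf.restPart_sublist {c : ℕ} {P V : List ℕ} (hP : Rgf P) (hc : c ≤ numLetters P) :
    (c :: lowPart c (restPart c P ++ V)).Sublist (P ++ numLetters P :: V) := by
  rcases h : restPart c P with _ | ⟨z, R⟩
  · have e := initPart_append_restPart c P
    rw [h, List.append_nil] at e
    have : numLetters P = c := by rw [← hP.numLetters_initPart hc, e]
    rw [this]
    exact (List.Sublist.cons_cons c List.filter_sublist).trans (List.sublist_append_right _ _)
  · have hz := head?_lowMask_restPart c P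
    rw [h] at hz
    simp only [lowMask, List.map_cons, List.head?_cons, ne_eq, Option.some.injEq,
      decide_eq_true_eq, not_lt] at hz
    have hc' : z = c := by
      have h1 := hP.highPart_restPart (c := c)
      rw [h] at h1
      by_contra hne
      have := h1 [] (z - c) (highPart c R) (by simp [highPart, hz]) 0 (by omega)
      simp at this
    subst hc'
    have e := initPart_append_restPart z P
    rw [h] at e
    have h2 : lowPart z (z :: R ++ V) = lowPart z (R ++ V) := by simp [lowPart]
    rw [h2]
    conv_rhs => rw [← e]
    rw [List.append_assoc, List.cons_append]
    refine List.Sublist.trans ?_ (List.sublist_append_right _ _)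
    refine List.Sublist.cons_cons z (List.filter_sublist.trans ?_)
    exact List.Sublist.append_left (List.sublist_cons_self _ _) _

/-- In a bar word, letters smaller than `c` occur at most once between the first and the last
occurrence of `c`. -/
theorem BarWord.nodup_lowPart {c : ℕ} {P V V' : List ℕ} (h : BarWord P (V ++ c :: V'))
    (hc : c ≤ numLetters P) : (lowPart c (restPart c P ++ V)).Nodup := by
  rw [List.nodup_iff_sublist]
  intro a ha
  have hac : a < c := (mem_lowPart.1 (ha.subset (by simp))).2
  have h1 := h.1.restPart_sublist (V := V) hc
  have h2 : [c, a, a].Sublist (P ++ numLetters P :: V) := (ha.cons_cons c).trans h1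
  have h3 : [c, a, a, c].Sublist (P ++ numLetters P :: (V ++ c :: V')) := by
    have := List.Sublist.append h2 (List.singleton_sublist.2 (List.mem_cons_self (a := c) (l := V')))
    simpa using this
  exact h.2.2 a c hac h3

/-- In the high part the appended `c` becomes 0, which cannot be the b of a pattern, and the low
part does not change. So distinctness of the smaller letters after the first `c` is the only new
condition besides the bound on `c`. -/
theorem barWord_append_singleton {c : ℕ} {P V : List ℕ} : BarWord P (V ++ [c]) ↔
    BarWord P V ∧ c ≤ numLetters P ∧ (lowPart c (restPart c P ++ V)).Nodup := by
  constructor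
  · intro h
    have hc : c ≤ numLetters P := h.2.1 c (by simp)
    refine ⟨⟨h.1, fun x hx => h.2.1 x (by simp [hx]), ?_⟩, hc, h.nodup_lowPart hc⟩
    exact h.2.2.sublist (List.Sublist.append_left
      (List.Sublist.cons_cons _ (List.sublist_append_left _ _)) _)
  · rintro ⟨h1, hc, hn⟩
    have hI : Rgf (initPart c P) :=
      Rgf.of_prefix (l' := restPart c P) (by rw [initPart_append_restPart]; exact h1.1)
    have hcI := h1.1.numLetters_initPart hc
    have e : lowPart c (restPart c P ++ (V ++ [c])) = lowPart c (restPart c P ++ V) := by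
      simp [lowPart]
    have e' : highPart c (V ++ [c]) = highPart c V ++ [0] := by simp [highPart]
    rw [← initPart_append_restPart c P,
      barWord_iff hI hcI h1.1.highPart_restPart (by rw [e]; exact hn), e, e']
    replace h1 := (barWord_iff hI hcI h1.1.highPart_restPart hn).1
      (by rw [initPart_append_restPart]; exact h1)
    refine ⟨h1.1, h1.2.1, fun x hx => ?_, fun a b hab h => ?_⟩
    · simp only [List.mem_append, List.mem_singleton] at hx
      rcases hx with hx | rfl
      · exact h1.2.2.1 x hx
      · omega
    · rw [← List.cons_append, ← List.append_assoc] at h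
      rcases List.sublist_append_iff.1 h with ⟨l₁, l₂, h3, h4, h5⟩
      rcases List.sublist_singleton.1 h5 with rfl | rfl
      · rw [List.append_nil] at h3
        refine h1.2.2.2 a b hab ?_
        rw [h3]; exact h4
      · have := congrArg (fun l => l.getLast?) h3
        simp at this
        omega

theorem BarWord.numLetters_eq {c : ℕ} {P V : List ℕ} (h : BarWord P V) (hc : c ≤ numLetters P) :
    numLetters P = c + numLetters (highPart c (restPart c P)) := by
  have hI : Rgf (initPart c P) :=
    Rgf.of_prefix (l' := restPart c P) (by rw [initPart_append_restPart]; exact h.1)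
  have := hI.numLetters_append (h.1.numLetters_initPart hc) h.1.highPart_restPart
  rwa [initPart_append_restPart] at this

/-- The recursion for bar words that is obtained by marking the last letter. -/
theorem barSum_succ (w : ℚ) {R R' : List ℕ → List ℕ → Prop}
    (hR : ∀ c P V, BarWord P V → c ≤ numLetters P → (lowPart c (restPart c P ++ V)).Nodup →
      (R' P (V ++ [c]) ↔ R (highPart c (restPart c P)) (highPart c V))) (k : ℕ) :
    barSum w R' (k + 1) = ∑ ij ∈ Finset.HasAntidiagonal.antidiagonal k,
      k.choose ij.1 • gapOp.shiftAct (barSum w DistinctTail) ij.1 (barSum w R ij.2) := by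
  classical
  ext N
  rw [Finset.sum_apply]
  have : ∀ ij ∈ Finset.HasAntidiagonal.antidiagonal k, (k.choose ij.1 •
      gapOp.shiftAct (barSum w DistinctTail) ij.1 (barSum w R ij.2)) N =
      ∑ x ∈ splitFinset R N ij.1 ij.2, w ^ numLetters x.2.1 := by
    intro ij hij
    rw [sum_splitFinset, Finset.HasAntidiagonal.mem_antidiagonal.1 hij, Pi.smul_apply,
      nsmul_eq_mul]
  rw [Finset.sum_congr rfl this, barSum, Finset.sum_sigma']
  -- The conditions on a marked letter are exactly those under which it can be appended to `V`.
  have key : ∀ c P V, SplitWord R N (lowPart c V).length (highPart c V).length (c, P, V) ↔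
      P.length = N ∧ BarWord P (V ++ [c]) ∧ R' P (V ++ [c]) := by
    intro c P V
    rw [barWord_append_singleton]
    constructor
    · rintro ⟨h1, h2, h3, -, -, h6, h7⟩
      exact ⟨h1, ⟨h2, h3, h6⟩, (hR c P V h2 h3 h6).2 h7⟩
    · rintro ⟨h1, ⟨h2, h3, h6⟩, h7⟩
      exact ⟨h1, h2, h3, rfl, rfl, h6, (hR c P V h2 h3 h6).1 h7⟩
  refine (Finset.sum_bij (fun y _ => (y.2.2.1, y.2.2.2 ++ [y.2.1])) ?_ ?_ ?_ ?_).symm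
  · rintro ⟨⟨i, j⟩, c, P, V⟩ hy
    rw [Finset.mem_sigma, Finset.HasAntidiagonal.mem_antidiagonal, mem_splitFinset] at hy
    obtain ⟨hk, hy⟩ := hy
    dsimp only at hk hy
    obtain rfl := hy.low
    obtain rfl := hy.high
    obtain ⟨h1, h2, h3⟩ := (key c P V).1 hy
    rw [mem_barFinset]
    have := length_parts c V
    simp only at hk ⊢
    exact ⟨h1, by simp; omega, h2, h3⟩
  · rintro ⟨⟨i, j⟩, c, P, V⟩ hy ⟨⟨i', j'⟩, c', P', V'⟩ hy' h
    rw [Finset.mem_sigma, mem_splitFinset] at hy hy'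
    dsimp only at hy hy'
    obtain rfl := hy.2.low
    obtain rfl := hy.2.high
    obtain rfl := hy'.2.low
    obtain rfl := hy'.2.high
    simp only [Prod.mk.injEq] at h
    obtain ⟨h1, h2⟩ := List.append_inj' h.2 rfl
    obtain rfl := h.1
    simp only [List.cons.injEq, and_true] at h2
    subst h1 h2
    rfl
  · rintro ⟨P, V'⟩ hq
    rw [mem_barFinset] at hq
    obtain ⟨h1, h2, h3, h4⟩ := hq
    simp only at h1 h2 h3 h4
    rcases List.eq_nil_or_concat V' with rfl | ⟨V, c, rfl⟩
    · simp at h2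
    · rw [List.concat_eq_append] at *
      have h5 := (key c P V).2 ⟨h1, h3, h4⟩
      refine ⟨⟨((lowPart c V).length, (highPart c V).length), c, P, V⟩, ?_, rfl⟩
      rw [Finset.mem_sigma, Finset.HasAntidiagonal.mem_antidiagonal, mem_splitFinset]
      refine ⟨?_, h5⟩
      simp at h2 ⊢
      rw [length_parts, h2]
  · intro y _
    rfl

/-- Bar words whose second part starts a new block, unless the first part is empty. -/
def NewTail (P V : List ℕ) : Prop := P = [] ∨ numLetters P ∈ V

/-- Distinct tails without the letter `0`. -/
def PosTail (P V : List ℕ) : Prop := DistinctTail P V ∧ P ≠ [] ∧ 0 ∉ V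

/-- Distinct tails with the letter `0`. -/
def ZeroTail (P V : List ℕ) : Prop := DistinctTail P V ∧ (P = [] ∨ 0 ∈ V)

theorem mem_iff_of_highPart {c : ℕ} {P V : List ℕ} (h : BarWord P V) (hc : c ≤ numLetters P) :
    numLetters (highPart c (restPart c P)) ∈ highPart c V ↔ numLetters P ∈ V := by
  rw [mem_highPart, h.numLetters_eq hc, add_comm]

theorem highPart_eq_nil_iff {c : ℕ} {P V : List ℕ} (h : BarWord P V) (hc : c ≤ numLetters P) :
    highPart c (restPart c P) = [] ↔ numLetters P = c := by
  rw [← h.1.highPart_restPart.numLetters_eq_zero, h.numLetters_eq hc]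
  omega

theorem barSum_true_succ (w : ℚ) (k : ℕ) :
    barSum w (fun _ _ => True) (k + 1) = ∑ ij ∈ Finset.HasAntidiagonal.antidiagonal k,
      k.choose ij.1 • gapOp.shiftAct (barSum w DistinctTail) ij.1
        (barSum w (fun _ _ => True) ij.2) :=
  barSum_succ w (fun _ _ _ _ _ _ => Iff.rfl) k

/-- The appended `c` is itself the new letter exactly when the high part of `P` is empty; this is
the reason for the alternative `P = []` in `NewTail`. -/
theorem barSum_newTail_succ (w : ℚ) (k : ℕ) :
    barSum w NewTail (k + 1) = ∑ ij ∈ Finset.HasAntidiagonal.antidiagonal k,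
      k.choose ij.1 • gapOp.shiftAct (barSum w DistinctTail) ij.1 (barSum w NewTail ij.2) := by
  refine barSum_succ w (fun c P V h hc _ => ?_) k
  rw [NewTail, NewTail, mem_iff_of_highPart h hc, highPart_eq_nil_iff h hc, List.mem_append,
    List.mem_singleton, ← h.1.numLetters_eq_zero]
  constructor
  · rintro (h1 | h1 | h1)
    · left; omega
    · exact Or.inr h1
    · exact Or.inl h1
  · rintro (h1 | h1)
    · exact Or.inr (Or.inr h1)
    · exact Or.inr (Or.inl h1)

/-- In the high part, `c` not being new means a nonempty first word, and `c` not being repeated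
means a tail without 0. These are the extra conditions of `PosTail`. -/
theorem barSum_distinctTail_succ (w : ℚ) (k : ℕ) :
    barSum w DistinctTail (k + 1) = ∑ ij ∈ Finset.HasAntidiagonal.antidiagonal k,
      k.choose ij.1 • gapOp.shiftAct (barSum w DistinctTail) ij.1 (barSum w PosTail ij.2) := by
  refine barSum_succ w (fun c P V h hc hn => ?_) k
  rw [PosTail, DistinctTail, DistinctTail, mem_iff_of_highPart h hc, Ne, highPart_eq_nil_iff h hc,
    List.nodup_append', mem_highPart, zero_add, List.mem_append, List.mem_singleton,
    List.disjoint_singleton]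
  have hV : (lowPart c V).Nodup := by
    rw [lowPart_append] at hn
    exact hn.of_append_right
  constructor
  · rintro ⟨⟨h1, -, h2⟩, h3⟩
    exact ⟨⟨nodup_highPart h1, fun h4 => h3 (Or.inl h4)⟩, fun h4 => h3 (Or.inr h4), h2⟩
  · rintro ⟨⟨h1, h2⟩, h3, h4⟩
    exact ⟨⟨nodup_of_nodup_parts hV h1, by simp, h4⟩, fun h5 => h5.elim h2 h3⟩

theorem barSum_congr (w : ℚ) {R R' : List ℕ → List ℕ → Prop} {k N : ℕ}
    (h : ∀ P V, P.length = N → V.length = k → BarWord P V → (R P V ↔ R' P V)) :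
    barSum w R k N = barSum w R' k N := by
  refine Finset.sum_congr (Finset.ext fun q => ?_) fun _ _ => rfl
  rw [mem_barFinset, mem_barFinset]
  constructor
  · rintro ⟨h1, h2, h3, h4⟩
    exact ⟨h1, h2, h3, (h _ _ h1 h2 h3).1 h4⟩
  · rintro ⟨h1, h2, h3, h4⟩
    exact ⟨h1, h2, h3, (h _ _ h1 h2 h3).2 h4⟩

theorem barSum_eq_zero (w : ℚ) {R : List ℕ → List ℕ → Prop} {k N : ℕ}
    (h : ∀ P V, P.length = N → V.length = k → BarWord P V → ¬ R P V) : barSum w R k N = 0 := by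
  refine Finset.sum_eq_zero fun q hq => ?_
  rw [mem_barFinset] at hq
  exact absurd hq.2.2.2 (h _ _ hq.1 hq.2.1 hq.2.2.1)

theorem barSum_zero_zero (w : ℚ) {R : List ℕ → List ℕ → Prop} (h : R [] []) :
    barSum w R 0 0 = 1 := by
  have : barFinset R 0 0 = {([], [])} := by
    ext ⟨P, V⟩
    rw [mem_barFinset, Finset.mem_singleton, Prod.mk.injEq]
    simp only [List.length_eq_zero_iff]
    constructor
    · exact fun h => ⟨h.1, h.2.1⟩
    · rintro ⟨rfl, rfl⟩
      exact ⟨rfl, rfl, barWord_nil.2 (by simp), h⟩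
  rw [barSum, this, Finset.sum_singleton, numLetters_nil, pow_zero]

theorem distinctTail_split (w : ℚ) :
    barSum w DistinctTail = barSum w ZeroTail + barSum w PosTail := by
  classical
  ext k N
  rw [Pi.add_apply, Pi.add_apply, barSum, barSum, barSum, ← Finset.sum_union]
  · refine Finset.sum_congr (Finset.ext fun q => ?_) fun _ _ => rfl
    simp only [Finset.mem_union, mem_barFinset, ZeroTail, PosTail]
    tauto
  · rw [Finset.disjoint_left]
    intro q h1 h2
    rw [mem_barFinset] at h1 h2
    exact h1.2.2.2.2.elim h2.2.2.2.2.1 h2.2.2.2.2.2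

theorem shiftAct_delta (x : ℕ → ℕ → ℚ) :
    gapOp.shiftAct x 0 (fun N => if N = 0 then 1 else 0) = x 0 := by
  ext N
  rw [gapOp.shiftAct, gapOp.act_ofArray, Finset.sum_eq_single (N, 0)]
  · rw [Finset.sum_eq_single (0, N)]
    · simp
    · rintro ⟨a, b⟩ h1 h2
      rcases a with _ | a
      · rw [Finset.HasAntidiagonal.mem_antidiagonal] at h1
        simp_all
      · simp
    · intro h
      simp at h
  · rintro ⟨a, b⟩ h1 h2
    have hb : b ≠ 0 := by
      rintro rfl
      rw [Finset.HasAntidiagonal.mem_antidiagonal] at h1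
      simp_all
    simp [hb]
  · intro h
    simp at h

theorem barSum_zeroTail_zero_left (w : ℚ) (N : ℕ) :
    barSum w ZeroTail 0 N = if N = 0 then 1 else 0 := by
  split_ifs with h
  · subst h
    exact barSum_zero_zero w ⟨⟨List.nodup_nil, by simp⟩, Or.inl rfl⟩
  · refine barSum_eq_zero w fun P V h1 h2 _ h3 => ?_
    rw [List.length_eq_zero_iff] at h2
    subst h2
    rcases h3.2 with rfl | h4
    · exact h h1.symm
    · simp at h4

theorem barSum_zeroTail_zero_right (w : ℚ) (k : ℕ) :
    barSum w ZeroTail k 0 = if k = 0 then 1 else 0 := by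
  split_ifs with h
  · subst h
    exact barSum_zero_zero w ⟨⟨List.nodup_nil, by simp⟩, Or.inl rfl⟩
  · refine barSum_eq_zero w fun P V h1 h2 hB h3 => h ?_
    rw [List.length_eq_zero_iff] at h1
    subst h1
    rw [barWord_nil] at hB
    rw [← h2, List.length_eq_zero_iff, List.eq_nil_iff_forall_not_mem]
    intro x hx
    have := hB x hx
    subst this
    exact h3.1.2 hx

theorem barSum_posTail_zero (w : ℚ) (k : ℕ) : barSum w PosTail k 0 = 0 :=
  barSum_eq_zero w fun _ _ h1 _ _ h3 => h3.2.1 (List.length_eq_zero_iff.1 h1)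

theorem barSum_newTail_zero (w : ℚ) (N : ℕ) :
    barSum w NewTail 0 N = if N = 0 then 1 else 0 := by
  split_ifs with h
  · subst h
    exact barSum_zero_zero w (Or.inl rfl)
  · refine barSum_eq_zero w fun P V h1 h2 _ h3 => ?_
    rw [List.length_eq_zero_iff] at h2
    subst h2
    rcases h3 with rfl | h4
    · exact h h1.symm
    · simp at h4

theorem barSum_true_zero (w : ℚ) : barSum w (fun _ _ => True) 0 = barSum w DistinctTail 0 := by
  ext N
  refine barSum_congr w fun P V _ h2 _ => ?_
  rw [List.length_eq_zero_iff] at h2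
  subst h2
  simp [DistinctTail]

/-- The recursion that is obtained by marking the smallest letter after the bar. -/
theorem barSum_min (w : ℚ) (k : ℕ) : barSum w DistinctTail k =
    gapOp.shiftAct (barSum w DistinctTail) 0 (barSum w ZeroTail k) := by
  rcases k with _ | k
  · have : barSum w ZeroTail 0 = fun N => if N = 0 then 1 else 0 :=
      funext (barSum_zeroTail_zero_left w)
    rw [this, shiftAct_delta]
  · ext N
    -- Marking the minimum of the tail leaves no low letter behind the bar, so only `i = 0` occurs
    -- and there is no binomial factor.
    have h0 := sum_splitFinset w ZeroTail N 0 (k + 1)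
    rw [Nat.choose_zero_right, Nat.cast_one, one_mul] at h0
    rw [← h0, barSum]
    have hmem : ∀ c P V, SplitWord ZeroTail N 0 (k + 1) (c, P, V) ↔ (P.length = N ∧
        V.length = k + 1 ∧ BarWord P V ∧ DistinctTail P V) ∧ c ∈ V ∧ ∀ x ∈ V, c ≤ x := by
      intro c P V
      constructor
      · rintro ⟨h1, h2, h3, h4, h5, h6, ⟨h7, h8⟩, h9⟩
        simp only at *
        have hlen := length_parts c V
        rw [List.length_eq_zero_iff] at h4
        have hlow : ∀ x ∈ V, c ≤ x := by
          intro x hx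
          by_contra h
          have : x ∈ lowPart c V := mem_lowPart.2 ⟨hx, by omega⟩
          rw [h4] at this
          simp at this
        -- Otherwise the high part of `P` is empty, `c` is the new letter, and the nonempty tail
        -- would contain it, against `DistinctTail`.
        have h0 : 0 ∈ highPart c V := by
          refine h9.resolve_left fun h10 => ?_
          rw [h10] at h8
          have hm := (highPart_eq_nil_iff h2 h3).1 h10
          obtain ⟨x, hx⟩ := List.exists_mem_of_length_pos (l := highPart c V) (by omega)
          have := h2.2.1 _ (mem_highPart.1 hx)
          obtain rfl : x = 0 := by omega
          exact h8 hx
        refine ⟨⟨h1, by simp [h4] at hlen; omega, h2, nodup_of_nodup_parts (c := c) (by simp [h4]) h7,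
          ?_⟩, ?_, hlow⟩
        · rwa [← mem_iff_of_highPart h2 h3]
        · simpa using mem_highPart.1 h0
      · rintro ⟨⟨h1, h2, h3, h4, h5⟩, h6, h7⟩
        have hc := h3.2.1 c h6
        have hlow : lowPart c V = [] := by
          rw [List.eq_nil_iff_forall_not_mem]
          intro x hx
          rw [mem_lowPart] at hx
          have := h7 x hx.1
          omega
        have hlen := length_parts c V
        rw [hlow] at hlen
        refine ⟨h1, h3, hc, by simp [hlow], by simp at hlen ⊢; omega, ?_, ⟨nodup_highPart h4, ?_⟩,
          Or.inr ?_⟩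
        · obtain ⟨V₁, V₂, rfl⟩ := List.append_of_mem h6
          have h8 := h3.nodup_lowPart hc
          simp only
          rw [lowPart_append, hlow, List.append_nil]
          rw [lowPart_append] at h8
          exact h8.of_append_left
        · simp only
          rwa [mem_iff_of_highPart h3 hc]
        · simp only
          rw [mem_highPart, zero_add]
          exact h6
    refine (Finset.sum_bij (fun x _ => x.2) ?_ ?_ ?_ ?_).symm
    · rintro ⟨c, P, V⟩ hx
      rw [mem_splitFinset, hmem] at hx
      exact mem_barFinset.2 hx.1
    · rintro ⟨c, P, V⟩ hx ⟨c', P', V'⟩ hx' h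
      rw [mem_splitFinset, hmem] at hx hx'
      simp only [Prod.mk.injEq] at h
      obtain ⟨rfl, rfl⟩ := h
      rw [le_antisymm (hx.2.2 _ hx'.2.1) (hx'.2.2 _ hx.2.1)]
    · rintro ⟨P, V⟩ hq
      rw [mem_barFinset] at hq
      obtain ⟨c, hc, hmin⟩ := V.toFinset.exists_min_image id (by
        obtain ⟨x, hx⟩ := List.exists_mem_of_length_pos (l := V) (by have := hq.2.1; simp at this; omega)
        exact ⟨x, by simpa using hx⟩)
      refine ⟨(c, P, V), ?_, rfl⟩
      rw [mem_splitFinset, hmem]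
      exact ⟨hq, by simpa using hc, fun x hx => hmin x (by simpa using hx)⟩
    · intro x _
      rfl

theorem rgf_append_singleton {P : List ℕ} {x : ℕ} :
    Rgf (P ++ [x]) ↔ Rgf P ∧ x ≤ numLetters P := by
  constructor
  · intro h
    have hP : Rgf P := h.of_prefix
    refine ⟨hP, ?_⟩
    by_contra hx
    have := hP.mem_iff.1 (h P x [] rfl (numLetters P) (by omega))
    omega
  · rintro ⟨hP, hx⟩ l₁ y l₂ h z hz
    rcases List.eq_nil_or_concat l₂ with rfl | ⟨l, t, rfl⟩
    · obtain ⟨rfl, h2⟩ := List.append_inj' h rfl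
      simp only [List.cons.injEq, and_true] at h2
      subst h2
      exact hP.mem_iff.2 (by omega)
    · rw [List.concat_eq_append, ← List.cons_append, ← List.append_assoc] at h
      exact hP l₁ y l (List.append_inj' h rfl).1 z hz

theorem numLetters_append_singleton {P : List ℕ} (hP : Rgf P) {x : ℕ} (hx : x ≤ numLetters P) :
    numLetters (P ++ [x]) = if x = numLetters P then numLetters P + 1 else numLetters P := by
  apply numLetters_eq
  intro y
  rw [List.mem_append, hP.mem_iff, List.mem_singleton]
  split_ifs <;> omega

/-- Remove the last letter of a word of length `N + 1`. An old letter becomes the one-letter tail,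
where the extra bar letter is harmless by `typeA_insert_iff`; a new letter only contributes the
factor `w`. -/
theorem barSum_one (w : ℚ) (N : ℕ) : barSum w DistinctTail 1 N =
    barSum w DistinctTail 0 (N + 1) - w * barSum w DistinctTail 0 N := by
  classical
  rw [eq_sub_iff_add_eq]
  have hA : ∀ n P V, (P, V) ∈ barFinset DistinctTail n 0 ↔
      P.length = n ∧ V = [] ∧ Rgf P ∧ TypeA P := by
    intro n P V
    rw [mem_barFinset]
    simp only [List.length_eq_zero_iff]
    constructor
    · rintro ⟨h1, rfl, h2, -⟩
      exact ⟨h1, rfl, barWord_right_nil.1 h2⟩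
    · rintro ⟨h1, rfl, h2⟩
      exact ⟨h1, rfl, barWord_right_nil.2 h2, List.nodup_nil, by simp⟩
  have hT : ∀ P x, Rgf P → x ≤ numLetters P → (TypeA (P ++ [x]) ↔ if x = numLetters P then TypeA P
      else TypeA (P ++ numLetters P :: [x])) := by
    intro P x hP hx
    split_ifs with h
    · subst h
      rw [typeA_insert_iff (fun y hy => hP.mem_iff.1 hy) (by simp), List.append_nil]
    · rw [typeA_insert_iff (fun y hy => hP.mem_iff.1 hy) (by simp; omega)]
  rw [barSum, barSum, barSum, Finset.mul_sum,
    ← Finset.sum_filter_add_sum_filter_not (barFinset DistinctTail (N + 1) 0)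
      (fun q => ∃ P x, q.1 = P ++ [x] ∧ x ≠ numLetters P)]
  congr 1
  · refine Finset.sum_bij (fun q _ => (q.1 ++ q.2, [])) ?_ ?_ ?_ ?_
    · rintro ⟨P, V⟩ hq
      rw [mem_barFinset] at hq
      obtain ⟨h1, h2, h3, h4⟩ := hq
      obtain ⟨x, rfl⟩ := List.length_eq_one_iff.1 h2
      simp only at *
      have hx := h3.2.1 x (by simp)
      have hne : x ≠ numLetters P := by
        rintro rfl
        exact h4.2 (by simp)
      rw [Finset.mem_filter, hA]
      refine ⟨⟨by simp [h1], rfl, rgf_append_singleton.2 ⟨h3.1, hx⟩, ?_⟩, P, x, rfl, hne⟩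
      rw [hT P x h3.1 hx, if_neg hne]
      exact h3.2.2
    · rintro ⟨P, V⟩ hq ⟨P', V'⟩ hq' h
      rw [mem_barFinset] at hq hq'
      simp only [Prod.mk.injEq, and_true] at h hq hq'
      obtain ⟨rfl, rfl⟩ := List.append_inj h (hq.1.trans hq'.1.symm)
      rfl
    · rintro ⟨P', V⟩ hq
      rw [Finset.mem_filter, hA] at hq
      obtain ⟨⟨h1, rfl, h2, h3⟩, P, x, rfl, hne⟩ := hq
      rw [rgf_append_singleton] at h2
      rw [hT P x h2.1 h2.2, if_neg hne] at h3
      refine ⟨(P, [x]), ?_, rfl⟩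
      rw [mem_barFinset]
      refine ⟨by simpa using h1, rfl, ⟨h2.1, by simpa using h2.2, h3⟩, by simp, ?_⟩
      simpa using Ne.symm hne
    · rintro ⟨P, V⟩ hq
      rw [mem_barFinset] at hq
      obtain ⟨h1, h2, h3, h4⟩ := hq
      obtain ⟨x, rfl⟩ := List.length_eq_one_iff.1 h2
      simp only at *
      have hx := h3.2.1 x (by simp)
      have hne : x ≠ numLetters P := by
        rintro rfl
        exact h4.2 (by simp)
      rw [numLetters_append_singleton h3.1 hx, if_neg hne]
  · refine Finset.sum_bij (fun q _ => (q.1 ++ [numLetters q.1], [])) ?_ ?_ ?_ ?_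
    · rintro ⟨P, V⟩ hq
      rw [hA] at hq
      obtain ⟨h1, rfl, h2, h3⟩ := hq
      rw [Finset.mem_filter, hA]
      refine ⟨⟨by simp [h1], rfl, rgf_append_singleton.2 ⟨h2, le_rfl⟩, ?_⟩, ?_⟩
      · rw [hT P _ h2 le_rfl, if_pos rfl]
        exact h3
      · rintro ⟨P', x, h, hne⟩
        obtain ⟨rfl, h5⟩ := List.append_inj' h rfl
        simp only [List.cons.injEq, and_true] at h5
        exact hne h5.symm
    · rintro ⟨P, V⟩ hq ⟨P', V'⟩ hq' h
      rw [hA] at hq hq'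
      simp only [Prod.mk.injEq, and_true] at h
      obtain ⟨rfl, -⟩ := List.append_inj' h rfl
      rw [hq.2.1, hq'.2.1]
    · rintro ⟨P', V⟩ hq
      rw [Finset.mem_filter, hA] at hq
      obtain ⟨⟨h1, rfl, h2, h3⟩, hne⟩ := hq
      rcases List.eq_nil_or_concat P' with rfl | ⟨P, x, rfl⟩
      · simp at h1
      · rw [List.concat_eq_append] at *
        obtain rfl : x = numLetters P := by
          by_contra h
          exact hne ⟨P, x, rfl, h⟩
        rw [rgf_append_singleton] at h2
        rw [hT P _ h2.1 h2.2, if_pos rfl] at h3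
        exact ⟨(P, []), (hA _ _ _).2 ⟨by simpa using h1, rfl, h2.1, h3⟩, rfl⟩
    · rintro ⟨P, V⟩ hq
      rw [hA] at hq
      simp only
      rw [numLetters_append_singleton hq.2.2.1 le_rfl, if_pos rfl, pow_succ, mul_comm]

theorem barSum_newTail_succ_eq {w : ℚ} (hw : w ≠ 0) (k N : ℕ) :
    barSum w NewTail (k + 1) N = barSum w NewTail k N +
      (k + 1) * (barSum w (fun _ _ => True) k N - barSum w NewTail k N) :=
  gapOp.array_identity hw (distinctTail_split w) (barSum_posTail_zero w)
    (barSum_zeroTail_zero_right w) (barSum_zeroTail_zero_left w) (barSum_min w)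
    (barSum_distinctTail_succ w) (barSum_one w) (barSum_true_zero w) (barSum_true_succ w)
    (barSum_newTail_zero w) (barSum_newTail_succ w) k N

/-! ### Cutting words of both types at their largest letter. -/

/-- The words without a subsequence `b b a b`, `a < b`. -/
def TypeB (l : List ℕ) : Prop := ∀ a b, a < b → ¬ [b, b, a, b].Sublist l

theorem TypeB.sublist {l l' : List ℕ} (h : TypeB l') (hs : l.Sublist l') : TypeB l :=
  fun a b hab h1 => h a b hab (h1.trans hs)

/-- An occurrence with b = c would need a smaller letter between the second and the third c, but
after the first c all others form one run. -/
theorem typeB_insert_iff {c r : ℕ} {P V₁ V₂ : List ℕ} (hP : ∀ x ∈ P, x < c)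
    (h₁ : ∀ x ∈ V₁, x < c) (h₂ : ∀ x ∈ V₂, x < c) :
    TypeB (P ++ c :: (V₁ ++ (List.replicate r c ++ V₂))) ↔ TypeB (P ++ (V₁ ++ V₂)) := by
  constructor
  · intro h
    refine h.sublist (List.Sublist.append_left (List.Sublist.cons c ?_) P)
    exact List.Sublist.append_left (List.sublist_append_right _ _) _
  · intro h a b hab h1
    have hb : b ≤ c := by
      have := h1.subset (show b ∈ [b, b, a, b] by simp)
      simp only [List.mem_append, List.mem_cons, List.mem_replicate] at this
      rcases this with h | h | h | h | h
      · exact (hP b h).le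
      · exact h.le
      · exact (h₁ b h).le
      · exact h.2.le
      · exact (h₂ b h).le
    rcases hb.lt_or_eq with hb | rfl
    · refine h a b hab ?_
      have h2 := h1.filter (· < c)
      rw [List.filter_eq_self.2 (by intro x hx; simp at hx ⊢; omega), List.filter_append,
        List.filter_cons_of_neg (by simp), List.filter_append, List.filter_append,
        List.filter_replicate, List.filter_eq_self.2 (by simpa using hP),
        List.filter_eq_self.2 (by simpa using h₁), List.filter_eq_self.2 (by simpa using h₂)] at h2
      simpa using h2
    · have h2 := sublist_of_cons_sublist_append h1 fun h => lt_irrefl _ (hP b h)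
      rw [List.cons_sublist_cons] at h2
      have h3 := sublist_of_cons_sublist_append h2 fun h => lt_irrefl _ (h₁ b h)
      obtain ⟨l₁, l₂, h4, h5, h6⟩ := List.sublist_append_iff.1 h3
      rcases List.eq_nil_or_concat l₂ with rfl | ⟨l, x, rfl⟩
      · rw [List.append_nil] at h4
        have := List.eq_of_mem_replicate (h5.subset (show a ∈ l₁ by rw [← h4]; simp))
        omega
      · have h7 := congrArg (fun l => l.getLast?) h4
        simp at h7
        subst h7
        exact lt_irrefl _ (h₂ b (h6.subset (by simp)))

/-- After two c's, a further c preceded by a smaller letter would complete c c a c. -/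
theorem typeB_run {c : ℕ} {P V₁ V₂ : List ℕ}
    (h : TypeB (P ++ c :: (V₁ ++ c :: V₂))) (h₂ : ∀ x ∈ V₂, x ≤ c) :
    ∃ s V, V₂ = List.replicate s c ++ V ∧ ∀ x ∈ V, x < c := by
  refine ⟨(V₂.takeWhile (· = c)).length, V₂.dropWhile (· = c), ?_, ?_⟩
  · have : V₂.takeWhile (· = c) = List.replicate (V₂.takeWhile (· = c)).length c :=
      List.eq_replicate_iff.2 ⟨rfl, fun x hx => by simpa using List.mem_takeWhile_imp hx⟩
    rw [← this, List.takeWhile_append_dropWhile]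
  · intro x hx
    have hx2 : x ∈ V₂ := (List.dropWhile_sublist _).subset hx
    refine lt_of_le_of_ne (h₂ x hx2) ?_
    rintro rfl
    have hh := List.head?_dropWhile_not (p := fun y => decide (y = x)) (l := V₂)
    rcases hd : V₂.dropWhile (· = x) with _ | ⟨a, l⟩
    · rw [hd] at hx; simp at hx
    · rw [hd] at hh hx
      simp at hh
      have ha : a ∈ V₂ := (List.dropWhile_sublist (· = x)).subset (by rw [hd]; simp)
      have hxl : x ∈ l := by simpa [Ne.symm hh] using hx
      refine h a x (lt_of_le_of_ne (h₂ a ha) hh) ?_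
      refine List.Sublist.trans ?_ (List.sublist_append_right _ _)
      refine List.Sublist.cons_cons x (List.Sublist.trans ?_ (List.sublist_append_right _ _))
      refine List.Sublist.cons_cons x (List.Sublist.trans ?_ (List.dropWhile_sublist (· = x)))
      rw [hd]
      exact List.Sublist.cons_cons a (List.singleton_sublist.2 hxl)

/-- The words satisfying `T` that consist of a restricted growth function with `N` letters and `k`
further letters, none of which is new. -/
structure CoverWord (T : List ℕ → Prop) (N k : ℕ) (q : List ℕ × List ℕ) : Prop where
  length_fst : q.1.length = N
  length_snd : q.2.length = k
  rgf : Rgf q.1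
  lt : ∀ x ∈ q.2, x < numLetters q.1
  type : T (q.1 ++ q.2)

/-- The words satisfying `T` that consist of a restricted growth function with `N` letters, the next
new letter and `k` further letters, none of which is new. -/
structure MaxWord (T : List ℕ → Prop) (N k : ℕ) (q : List ℕ × List ℕ) : Prop where
  length_fst : q.1.length = N
  length_snd : q.2.length = k
  rgf : Rgf q.1
  le : ∀ x ∈ q.2, x ≤ numLetters q.1
  type : T (q.1 ++ numLetters q.1 :: q.2)

open scoped Classical in
/-- The finite set of cover words. -/
noncomputable def coverFinset (T : List ℕ → Prop) (N k : ℕ) : Finset (List ℕ × List ℕ) :=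
  (wordFinset (N + 1) N ×ˢ wordFinset (N + 1) k).filter (CoverWord T N k)

open scoped Classical in
/-- The finite set of max words. -/
noncomputable def maxFinset (T : List ℕ → Prop) (N k : ℕ) : Finset (List ℕ × List ℕ) :=
  (wordFinset (N + 1) N ×ˢ wordFinset (N + 1) k).filter (MaxWord T N k)

theorem mem_coverFinset {T : List ℕ → Prop} {N k : ℕ} {q : List ℕ × List ℕ} :
    q ∈ coverFinset T N k ↔ CoverWord T N k q := by
  classical
  rw [coverFinset, Finset.mem_filter, Finset.mem_product, mem_wordFinset, mem_wordFinset]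
  refine ⟨fun h => h.2, fun h => ⟨⟨⟨h.length_fst, fun x hx => ?_⟩, h.length_snd, fun x hx => ?_⟩, h⟩⟩
  · have := h.rgf.mem_iff.1 hx
    have := numLetters_le_length q.1
    have := h.length_fst
    omega
  · have := h.lt x hx
    have := numLetters_le_length q.1
    have := h.length_fst
    omega

theorem mem_maxFinset {T : List ℕ → Prop} {N k : ℕ} {q : List ℕ × List ℕ} :
    q ∈ maxFinset T N k ↔ MaxWord T N k q := by
  classical
  rw [maxFinset, Finset.mem_filter, Finset.mem_product, mem_wordFinset, mem_wordFinset]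
  refine ⟨fun h => h.2, fun h => ⟨⟨⟨h.length_fst, fun x hx => ?_⟩, h.length_snd, fun x hx => ?_⟩, h⟩⟩
  · have := h.rgf.mem_iff.1 hx
    have := numLetters_le_length q.1
    have := h.length_fst
    omega
  · have := h.le x hx
    have := numLetters_le_length q.1
    have := h.length_fst
    omega

/-- The weighted number of cover words. -/
noncomputable def coverSum (w : ℚ) (T : List ℕ → Prop) (N k : ℕ) : ℚ :=
  ∑ q ∈ coverFinset T N k, w ^ numLetters q.1

/-- The weighted number of max words. -/
noncomputable def maxSum (w : ℚ) (T : List ℕ → Prop) (N k : ℕ) : ℚ :=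
  ∑ q ∈ maxFinset T N k, w ^ numLetters q.1

theorem Rgf.append_of_lt {L V : List ℕ} (hL : Rgf L) (hV : ∀ x ∈ V, x < numLetters L) :
    Rgf (L ++ V) ∧ numLetters (L ++ V) = numLetters L := by
  have h : highPart (numLetters L) V = [] := highPart_eq_nil hV
  have hR : Rgf (highPart (numLetters L) V) := by rw [h]; exact rgf_nil
  refine ⟨hL.append rfl hR, ?_⟩
  rw [hL.numLetters_append rfl hR, h, numLetters_nil, add_zero]

theorem coverSum_zero (w : ℚ) {T : List ℕ → Prop} (hT : T []) (k : ℕ) :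
    coverSum w T 0 k = if k = 0 then 1 else 0 := by
  split_ifs with h
  · subst h
    have : coverFinset T 0 0 = {([], [])} := by
      ext ⟨P, V⟩
      rw [mem_coverFinset, Finset.mem_singleton, Prod.mk.injEq]
      constructor
      · exact fun h => ⟨List.length_eq_zero_iff.1 h.length_fst,
          List.length_eq_zero_iff.1 h.length_snd⟩
      · rintro ⟨rfl, rfl⟩
        exact ⟨rfl, rfl, rgf_nil, by simp, hT⟩
    rw [coverSum, this, Finset.sum_singleton, numLetters_nil, pow_zero]
  · refine Finset.sum_eq_zero fun q hq => absurd ?_ h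
    rw [mem_coverFinset] at hq
    have h1 := List.length_eq_zero_iff.1 hq.length_fst
    rw [← hq.length_snd, List.length_eq_zero_iff, List.eq_nil_iff_forall_not_mem]
    intro x hx
    have := hq.lt x hx
    rw [h1, numLetters_nil] at this
    omega

/-- Cutting a word at the first occurrence of its largest letter. -/
theorem coverSum_eq_sum_maxSum (w : ℚ) (T : List ℕ → Prop) (N k : ℕ) :
    coverSum w T (N + 1) k =
      ∑ i ∈ Finset.range (N + 1), w * maxSum w T i (N + k - i) := by
  have hX : ∀ i P V, MaxWord T i (N + k - i) (P, V) → i ≤ N →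
      Rgf (P ++ numLetters P :: V) ∧ numLetters ((P ++ numLetters P :: V).take (N + 1)) =
        numLetters P + 1 ∧ ∀ x ∈ P ++ numLetters P :: V, x < numLetters P + 1 := by
    rintro i P V ⟨h1, h2, h3, h4, h5⟩ hi
    simp only at h1 h2 h3 h4 h5
    have hP : Rgf (P ++ [numLetters P]) := rgf_append_singleton.2 ⟨h3, le_rfl⟩
    have hn : numLetters (P ++ [numLetters P]) = numLetters P + 1 := by
      rw [numLetters_append_singleton h3 le_rfl, if_pos rfl]
    have hr := hP.append_of_lt (V := V) fun x hx => by have := h4 x hx; omega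
    have e : P ++ numLetters P :: V = (P ++ [numLetters P]) ++ V := by simp
    refine ⟨by rw [e]; exact hr.1, ?_, ?_⟩
    · rw [e, List.take_append, List.take_of_length_le (by simp; omega)]
      have hlt : ∀ x ∈ V.take (N + 1 - (P ++ [numLetters P]).length),
          x < numLetters (P ++ [numLetters P]) := fun x hx => by
        have := h4 x (List.mem_of_mem_take hx)
        omega
      rw [(hP.append_of_lt hlt).2, hn]
    · rw [e, ← hn, ← hr.2]
      exact fun x => hr.1.mem_iff.1
  simp only [coverSum, maxSum, Finset.mul_sum]
  rw [Finset.sum_sigma']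
  refine (Finset.sum_bij (fun y _ => ((y.2.1 ++ numLetters y.2.1 :: y.2.2).take (N + 1),
    (y.2.1 ++ numLetters y.2.1 :: y.2.2).drop (N + 1))) ?_ ?_ ?_ ?_).symm
  · rintro ⟨i, P, V⟩ hy
    dsimp only
    rw [Finset.mem_sigma, Finset.mem_range, mem_maxFinset] at hy
    dsimp only at hy
    obtain ⟨h1, h2, h3⟩ := hX i P V hy.2 (by omega)
    have hl := hy.2.length_fst
    have hl' := hy.2.length_snd
    dsimp only at hl hl'
    rw [mem_coverFinset]
    refine ⟨?_, ?_, ?_, ?_, ?_⟩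
    · simp; omega
    · simp; omega
    · exact Rgf.of_prefix (l' := (P ++ numLetters P :: V).drop (N + 1))
        (by rw [List.take_append_drop]; exact h1)
    · intro x hx
      dsimp only
      rw [h2]
      exact h3 x (List.mem_of_mem_drop hx)
    · dsimp only
      rw [List.take_append_drop]
      exact hy.2.type
  · rintro ⟨i, P, V⟩ hy ⟨i', P', V'⟩ hy' h
    rw [Finset.mem_sigma, Finset.mem_range, mem_maxFinset] at hy hy'
    simp only [Prod.mk.injEq] at hy hy' h
    obtain ⟨-, h2, -⟩ := hX i P V hy.2 (by omega)
    obtain ⟨-, h2', -⟩ := hX i' P' V' hy'.2 (by omega)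
    have hm : numLetters P = numLetters P' := by
      rw [h.1, h2'] at h2
      omega
    have e : P ++ numLetters P :: V = P' ++ numLetters P' :: V' := by
      rw [← List.take_append_drop (N + 1) (P ++ numLetters P :: V), h.1, h.2,
        List.take_append_drop]
    have hP : numLetters P ∉ P := fun h => lt_irrefl _ (hy.2.rgf.mem_iff.1 h)
    have hP' : numLetters P' ∉ P' := fun h => lt_irrefl _ (hy'.2.rgf.mem_iff.1 h)
    -- The cut is recovered as the position of the first largest letter.
    have hlen : P.length = P'.length := by
      have h3 : (P ++ numLetters P :: V).idxOf (numLetters P) = P.length := by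
        rw [List.idxOf_append_of_notMem hP]; simp
      have h4 : (P' ++ numLetters P' :: V').idxOf (numLetters P') = P'.length := by
        rw [List.idxOf_append_of_notMem hP']; simp
      rw [← h3, ← h4, e, hm]
    obtain ⟨rfl, h5⟩ := List.append_inj e hlen
    obtain rfl := hy.2.length_fst
    obtain rfl := hy'.2.length_fst
    rw [List.cons.injEq] at h5
    rw [h5.2]
  · rintro ⟨U, Q⟩ hq
    rw [mem_coverFinset] at hq
    obtain ⟨h1, h2, h3, h4, h5⟩ := hq
    dsimp only at h1 h2 h3 h4 h5
    have hpos : numLetters U ≠ 0 := by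
      rw [Ne, h3.numLetters_eq_zero]
      rintro rfl
      simp at h1
    obtain ⟨P, U', hU, hPn⟩ := List.eq_append_cons_of_mem
      (h3.mem_iff.2 (show numLetters U - 1 < numLetters U by omega))
    have hP : Rgf P := Rgf.of_prefix (l' := (numLetters U - 1) :: U') (by rw [← hU]; exact h3)
    have hnP : numLetters P = numLetters U - 1 := by
      apply numLetters_eq
      intro x
      constructor
      · intro hx
        have : x < numLetters U := h3.mem_iff.1 (by rw [hU]; simp [hx])
        have : x ≠ numLetters U - 1 := by rintro rfl; exact hPn hx
        omega
      · intro hx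
        exact h3 P _ U' hU x hx
    have e : P ++ numLetters P :: (U' ++ Q) = U ++ Q := by
      rw [hnP]
      conv_rhs => rw [hU]
      simp
    have hlen := congrArg List.length hU
    simp at hlen
    refine ⟨⟨P.length, P, U' ++ Q⟩, ?_, ?_⟩
    · rw [Finset.mem_sigma, Finset.mem_range, mem_maxFinset]
      refine ⟨by dsimp only; omega, rfl, by simp; omega, hP, fun x hx => ?_, ?_⟩
      · have : x < numLetters U := by
          simp only [List.mem_append] at hx
          rcases hx with hx | hx
          · exact h3.mem_iff.1 (by rw [hU]; simp [hx])
          · exact h4 x hx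
        dsimp only
        omega
      · dsimp only
        rw [e]
        exact h5
    · dsimp only
      rw [e, ← h1, List.take_left, List.drop_left]
  · rintro ⟨i, P, V⟩ hy
    dsimp only
    rw [Finset.mem_sigma, Finset.mem_range, mem_maxFinset] at hy
    dsimp only at hy
    rw [(hX i P V hy.2 (by omega)).2.1, pow_succ, mul_comm]

theorem maxSum_typeA (w : ℚ) (N k : ℕ) :
    maxSum w TypeA N k = barSum w (fun _ _ => True) k N := by
  refine Finset.sum_congr (Finset.ext fun q => ?_) fun _ _ => rfl
  rw [mem_maxFinset, mem_barFinset]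
  constructor
  · rintro ⟨h1, h2, h3, h4, h5⟩
    exact ⟨h1, h2, ⟨h3, h4, h5⟩, trivial⟩
  · rintro ⟨h1, h2, ⟨h3, h4, h5⟩, -⟩
    exact ⟨h1, h2, h3, h4, h5⟩

/-- For nonempty `P`, what remains are the words whose new letter occurs only at the bar, where it
can be deleted. Length 0 is excluded because `NewTail` holds there by convention. -/
theorem barSum_true_sub_newTail (w : ℚ) (N k : ℕ) :
    barSum w (fun _ _ => True) k (N + 1) - barSum w NewTail k (N + 1) =
      coverSum w TypeA (N + 1) k := by
  classical
  rw [sub_eq_iff_eq_add, barSum, barSum, coverSum, ← Finset.sum_union]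
  · refine Finset.sum_congr (Finset.ext fun q => ?_) fun _ _ => rfl
    rw [Finset.mem_union, mem_coverFinset, mem_barFinset, mem_barFinset]
    constructor
    · rintro ⟨h1, h2, h3, -⟩
      by_cases h : NewTail q.1 q.2
      · exact Or.inr ⟨h1, h2, h3, h⟩
      · left
        rw [NewTail, not_or] at h
        have hlt : ∀ x ∈ q.2, x < numLetters q.1 := fun x hx =>
          lt_of_le_of_ne (h3.2.1 x hx) (by rintro rfl; exact h.2 hx)
        refine ⟨h1, h2, h3.1, hlt, ?_⟩
        rw [← typeA_insert_iff (fun x hx => h3.1.mem_iff.1 hx) hlt]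
        exact h3.2.2
    · rintro (h | h)
      · refine ⟨h.length_fst, h.length_snd, ⟨h.rgf, fun x hx => (h.lt x hx).le, ?_⟩, trivial⟩
        rw [typeA_insert_iff (fun x hx => h.rgf.mem_iff.1 hx) h.lt]
        exact h.type
      · exact ⟨h.1, h.2.1, h.2.2.1, trivial⟩
  · rw [Finset.disjoint_left]
    intro q h1 h2
    rw [mem_coverFinset] at h1
    rw [mem_barFinset] at h2
    rcases h2.2.2.2 with h | h
    · have := h1.length_fst
      rw [h] at this
      simp at this
    · exact lt_irrefl _ (h1.lt _ h)

/-- Summation of ζ_{k+1} = ζ_k + (k + 1) c_k, where c_k = Φ_k - ζ_k and ζ_0 = 0 at positive length.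
-/
theorem maxSum_typeA_succ_eq {w : ℚ} (hw : w ≠ 0) (N k : ℕ) : maxSum w TypeA (N + 1) k =
    coverSum w TypeA (N + 1) k +
      ∑ j ∈ Finset.range k, (j + 1 : ℚ) * coverSum w TypeA (N + 1) j := by
  have hζ : ∀ k, barSum w NewTail k (N + 1) =
      ∑ j ∈ Finset.range k, (j + 1 : ℚ) * coverSum w TypeA (N + 1) j := by
    intro k
    induction k with
    | zero => rw [barSum_newTail_zero, Finset.range_zero, Finset.sum_empty, if_neg (by omega)]
    | succ k ih =>
      rw [barSum_newTail_succ_eq hw, Finset.sum_range_succ, ← ih, barSum_true_sub_newTail]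
  rw [maxSum_typeA, ← hζ, ← barSum_true_sub_newTail]
  ring

theorem takeWhile_ne_append {c : ℕ} {A B : List ℕ} (hA : c ∉ A) :
    (A ++ c :: B).takeWhile (· ≠ c) = A := by
  rw [List.takeWhile_append_of_pos]
  · simp
  · intro x hx
    simp only [ne_eq, decide_eq_true_eq]
    rintro rfl
    exact hA hx

/-- If the new letter returns, its later occurrences form one run. Deleting the run leaves a cover
word with `j < k` further letters, and the run of length `k - j` has `j + 1` possible positions. -/
theorem maxSum_typeB (w : ℚ) (N k : ℕ) : maxSum w TypeB N k =
    coverSum w TypeB N k + ∑ j ∈ Finset.range k, (j + 1 : ℚ) * coverSum w TypeB N j := by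
  classical
  have hcov : ∀ j : ℕ, (j + 1 : ℚ) * coverSum w TypeB N j =
      ∑ y ∈ Finset.range (j + 1) ×ˢ coverFinset TypeB N j, w ^ numLetters y.2.1 := by
    intro j
    rw [Finset.sum_product]
    simp only [Finset.sum_const, Finset.card_range, nsmul_eq_mul, coverSum]
    push_cast
    rfl
  simp only [hcov]
  rw [maxSum, coverSum, Finset.sum_sigma',
    ← Finset.sum_filter_not_add_sum_filter (maxFinset TypeB N k)
      (fun q => numLetters q.1 ∈ q.2)]
  congr 1
  · refine Finset.sum_congr (Finset.ext fun q => ?_) fun _ _ => rfl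
    rw [Finset.mem_filter, mem_maxFinset, mem_coverFinset]
    constructor
    · rintro ⟨h, hn⟩
      have hlt : ∀ x ∈ q.2, x < numLetters q.1 := fun x hx =>
        lt_of_le_of_ne (h.le x hx) (by rintro rfl; exact hn hx)
      exact ⟨h.length_fst, h.length_snd, h.rgf, hlt,
        h.type.sublist (List.Sublist.append_left (List.sublist_cons_self _ _) _)⟩
    · intro h
      refine ⟨⟨h.length_fst, h.length_snd, h.rgf, fun x hx => (h.lt x hx).le, ?_⟩,
        fun hx => lt_irrefl _ (h.lt _ hx)⟩
      have := typeB_insert_iff (r := 0) (V₁ := []) (fun x hx => h.rgf.mem_iff.1 hx) (by simp) h.lt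
      simp only [List.replicate_zero, List.nil_append] at this
      exact this.2 h.type
  -- The inverse map: deleting the new letter recovers `W`, and the number of letters before the
  -- run, nonempty as `j < k`, recovers `p`.
  · have hrun : ∀ j p (P W : List ℕ), CoverWord TypeB N j (P, W) → j < k → p ≤ j →
        (∀ x ∈ W.take p, x < numLetters P) ∧ (∀ x ∈ W.drop p, x < numLetters P) ∧
        (W.take p ++ (List.replicate (k - j) (numLetters P) ++ W.drop p)).filter
          (· ≠ numLetters P) = W ∧
        ((W.take p ++ (List.replicate (k - j) (numLetters P) ++ W.drop p)).takeWhile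
          (· ≠ numLetters P)).length = p := by
      intro j p P W h hj hp
      have h1 : ∀ x ∈ W.take p, x < numLetters P := fun x hx => h.lt x (List.mem_of_mem_take hx)
      have h2 : ∀ x ∈ W.drop p, x < numLetters P := fun x hx => h.lt x (List.mem_of_mem_drop hx)
      refine ⟨h1, h2, ?_, ?_⟩
      · rw [List.filter_append, List.filter_append, List.filter_replicate,
          List.filter_eq_self.2 (by intro x hx; simpa using (h1 x hx).ne),
          List.filter_eq_self.2 (by intro x hx; simpa using (h2 x hx).ne)]
        simp
      · rw [show k - j = (k - j - 1) + 1 by omega, List.replicate_succ, List.cons_append,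
          takeWhile_ne_append fun hx => lt_irrefl _ (h1 _ hx), List.length_take]
        have := h.length_snd
        dsimp only at this
        omega
    refine (Finset.sum_bij (fun y _ => (y.2.2.1, y.2.2.2.take y.2.1 ++
      (List.replicate (k - y.1) (numLetters y.2.2.1) ++ y.2.2.2.drop y.2.1))) ?_ ?_ ?_ ?_).symm
    · rintro ⟨j, p, P, W⟩ hy
      dsimp only
      rw [Finset.mem_sigma, Finset.mem_product, Finset.mem_range, Finset.mem_range,
        mem_coverFinset] at hy
      dsimp only at hy
      obtain ⟨hj, hp, h⟩ := hy
      obtain ⟨h1, h2, -, -⟩ := hrun j p P W h hj (by omega)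
      have hl := h.length_snd
      dsimp only at hl
      rw [Finset.mem_filter, mem_maxFinset]
      refine ⟨⟨h.length_fst, by simp; omega, h.rgf, ?_, ?_⟩, ?_⟩
      · intro x hx
        simp only [List.mem_append, List.mem_replicate] at hx
        rcases hx with hx | hx | hx
        · exact (h1 x hx).le
        · exact hx.2.le
        · exact (h2 x hx).le
      · dsimp only
        rw [typeB_insert_iff (fun x hx => h.rgf.mem_iff.1 hx) h1 h2, List.take_append_drop]
        exact h.type
      · simp only [List.mem_append, List.mem_replicate]
        exact Or.inr (Or.inl ⟨by omega, trivial⟩)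
    · rintro ⟨j, p, P, W⟩ hy ⟨j', p', P', W'⟩ hy' h
      rw [Finset.mem_sigma, Finset.mem_product, Finset.mem_range, Finset.mem_range,
        mem_coverFinset] at hy hy'
      simp only [Prod.mk.injEq] at hy hy' h
      obtain ⟨rfl, h⟩ := h
      obtain ⟨-, -, h3, h4⟩ := hrun j p P W hy.2.2 hy.1 (by omega)
      obtain ⟨-, -, h3', h4'⟩ := hrun j' p' P W' hy'.2.2 hy'.1 (by omega)
      rw [h, h3'] at h3
      rw [h, h4'] at h4
      subst h3 h4
      obtain rfl := hy.2.2.length_snd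
      obtain rfl := hy'.2.2.length_snd
      rfl
    · rintro ⟨P, V⟩ hq
      rw [Finset.mem_filter, mem_maxFinset] at hq
      obtain ⟨⟨h1, h2, h3, h4, h5⟩, h6⟩ := hq
      dsimp only at h1 h2 h3 h4 h5 h6
      obtain ⟨V₁, V₂, rfl, hV₁⟩ := List.eq_append_cons_of_mem h6
      obtain ⟨s, V₂, rfl, hV₂⟩ := typeB_run h5 fun x hx => h4 x (by simp [hx])
      have hlt : ∀ x ∈ V₁, x < numLetters P := fun x hx =>
        lt_of_le_of_ne (h4 x (by simp [hx])) (by rintro rfl; exact hV₁ hx)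
      simp at h2
      refine ⟨⟨V₁.length + V₂.length, V₁.length, P, V₁ ++ V₂⟩, ?_, ?_⟩
      · rw [Finset.mem_sigma, Finset.mem_product, Finset.mem_range, Finset.mem_range,
          mem_coverFinset]
        refine ⟨by dsimp only; omega, by dsimp only; omega, h1, by simp, h3, ?_, ?_⟩
        · intro x hx
          rcases List.mem_append.1 hx with hx | hx
          · exact hlt x hx
          · exact hV₂ x hx
        · refine h5.sublist (List.Sublist.append_left (List.Sublist.cons _ ?_) P)
          refine List.Sublist.append_left (List.Sublist.cons _ ?_) V₁
          exact List.sublist_append_right _ _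
      · dsimp only
        rw [List.take_left, List.drop_left,
          show k - (V₁.length + V₂.length) = s + 1 by omega, List.replicate_succ,
          List.cons_append]
    · intro y _
      rfl

theorem typeB_nil : TypeB [] := fun _ _ _ h => by simp at h

/-- Both types obey the same recursion. The prefix of length 0 is separate, because the `TypeA`
formula needs positive length; there all letters are 0 and both conditions are void. -/
theorem coverSum_eq {w : ℚ} (hw : w ≠ 0) (N k : ℕ) :
    coverSum w TypeA N k = coverSum w TypeB N k := by
  induction N using Nat.strong_induction_on generalizing k with
  | _ N ih =>
    rcases N with _ | N
    · rw [coverSum_zero w typeA_nil, coverSum_zero w typeB_nil]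
    · rw [coverSum_eq_sum_maxSum, coverSum_eq_sum_maxSum]
      refine Finset.sum_congr rfl fun i hi => ?_
      rw [Finset.mem_range] at hi
      congr 1
      rcases i with _ | i
      · refine Finset.sum_congr (Finset.ext fun q => ?_) fun _ _ => rfl
        rw [mem_maxFinset, mem_maxFinset]
        have key : ∀ q : List ℕ × List ℕ, q.1.length = 0 → (∀ x ∈ q.2, x ≤ numLetters q.1) →
            ∀ x ∈ q.1 ++ numLetters q.1 :: q.2, x = 0 := by
          rintro ⟨P, V⟩ h h' x hx
          obtain rfl := List.length_eq_zero_iff.1 h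
          simp only [List.nil_append, numLetters_nil, List.mem_cons] at hx h'
          rcases hx with hx | hx
          · exact hx
          · have := h' x hx
            omega
        constructor
        · rintro ⟨h1, h2, h3, h4, -⟩
          refine ⟨h1, h2, h3, h4, fun a b hab h => ?_⟩
          have := key q h1 h4 b (h.subset (by simp))
          omega
        · rintro ⟨h1, h2, h3, h4, -⟩
          refine ⟨h1, h2, h3, h4, fun a b hab h => ?_⟩
          have := key q h1 h4 b (h.subset (by simp))
          omega
      · rw [maxSum_typeA_succ_eq hw, maxSum_typeB, ih _ hi]
        congr 1
        exact Finset.sum_congr rfl fun j _ => by rw [ih _ hi]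

/-! ### From weighted word counts to set partitions. -/

/-- Two polynomials in `w` that agree at all nonzero rationals have the same coefficients. -/
theorem card_eq_of_sum_pow_eq {α β : Type*} {s : Finset α} {t : Finset β} {f : α → ℕ} {g : β → ℕ}
    (h : ∀ w : ℚ, w ≠ 0 → ∑ x ∈ s, w ^ f x = ∑ y ∈ t, w ^ g y) (m : ℕ) :
    (s.filter fun x => f x = m).card = (t.filter fun y => g y = m).card := by
  have hp : (∑ x ∈ s, (Polynomial.X : Polynomial ℚ) ^ f x) = ∑ y ∈ t, Polynomial.X ^ g y := by
    refine Polynomial.eq_of_infinite_eval_eq _ _ (Set.Infinite.mono (s := {0}ᶜ) ?_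
      (Set.finite_singleton 0).infinite_compl)
    intro w hw
    simpa [Polynomial.eval_finsetSum] using h w hw
  have hc := congrArg (fun p => p.coeff m) hp
  simp only [Polynomial.finsetSum_coeff, Polynomial.coeff_X_pow, Finset.sum_boole,
    Nat.cast_inj] at hc
  simpa only [eq_comm (a := m)] using hc

theorem ofFn_four_sublist {n : ℕ} {g : Fin n → ℕ} {x₀ x₁ x₂ x₃ : ℕ} :
    [x₀, x₁, x₂, x₃].Sublist (List.ofFn g) ↔ ∃ i₀ i₁ i₂ i₃, i₀ < i₁ ∧ i₁ < i₂ ∧ i₂ < i₃ ∧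
      g i₀ = x₀ ∧ g i₁ = x₁ ∧ g i₂ = x₂ ∧ g i₃ = x₃ := by
  rw [List.sublist_iff_exists_fin_orderEmbedding_get_eq]
  constructor
  · rintro ⟨f, hf⟩
    have hlt : ∀ i j : Fin 4, i < j →
        Fin.cast (List.length_ofFn (f := g)) (f i) < Fin.cast (List.length_ofFn (f := g)) (f j) :=
      fun i j hij => by simpa using f.lt_iff_lt.2 hij
    have hg : ∀ i : Fin 4, g (Fin.cast (List.length_ofFn (f := g)) (f i)) =
        [x₀, x₁, x₂, x₃].get i := fun i => by
      rw [hf i, List.get_ofFn]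
    exact ⟨_, _, _, _, hlt 0 1 (by decide), hlt 1 2 (by decide), hlt 2 3 (by decide),
      hg 0, hg 1, hg 2, hg 3⟩
  · rintro ⟨i₀, i₁, i₂, i₃, h₁, h₂, h₃, rfl, rfl, rfl, rfl⟩
    let f : Fin 4 → Fin (List.ofFn g).length :=
      ![i₀.cast (by simp), i₁.cast (by simp), i₂.cast (by simp), i₃.cast (by simp)]
    have hf : StrictMono f := by
      rw [Fin.strictMono_iff_lt_succ]
      intro i
      fin_cases i
      · exact h₁
      · exact h₂
      · exact h₃
    refine ⟨OrderEmbedding.ofStrictMono f hf, fun i => ?_⟩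
    rw [List.get_ofFn]
    fin_cases i <;> rfl

/-- The positions of equal letters determine the word: each letter either repeats an earlier one or
is forced to be the next new one. -/
theorem Rgf.ext {l l' : List ℕ} (h : Rgf l) (h' : Rgf l') (hlen : l.length = l'.length)
    (hker : ∀ i j : ℕ, i < l.length → j < l.length → (l[i]? = l[j]? ↔ l'[i]? = l'[j]?)) :
    l = l' := by
  induction l using List.reverseRecOn generalizing l' with
  | nil => exact (List.length_eq_zero_iff.1 hlen.symm).symm
  | append_singleton l x ih =>
    rcases List.eq_nil_or_concat l' with rfl | ⟨l', x', rfl⟩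
    · simp at hlen
    · rw [List.concat_eq_append] at *
      rw [rgf_append_singleton] at h h'
      simp only [List.length_append, List.length_singleton, add_left_inj] at hlen hker
      have key : ∀ i, i < l.length → ((l ++ [x])[i]? = l[i]? ∧ (l' ++ [x'])[i]? = l'[i]?) :=
        fun i hi => ⟨List.getElem?_append_left hi, List.getElem?_append_left (hlen ▸ hi)⟩
      have e : l = l' := by
        refine ih h.1 h'.1 hlen fun i j hi hj => ?_
        have := hker i j (by omega) (by omega)
        rwa [(key i hi).1, (key i hi).2, (key j hj).1, (key j hj).2] at this
      subst e
      have hx : ∀ i, i < l.length → (l[i]? = some x ↔ l[i]? = some x') := fun i hi => by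
        have := hker i l.length (by omega) (by omega)
        simpa [List.getElem?_append_left hi] using this
      have hx' : x ∈ l → x = x' := fun hm => by
        obtain ⟨i, hi, hxi⟩ := List.getElem_of_mem hm
        have := (hx i hi).1 (by rw [List.getElem?_eq_getElem hi, hxi])
        rw [List.getElem?_eq_getElem hi, hxi] at this
        exact Option.some_injective _ this
      have hx'' : x' ∈ l → x = x' := fun hm => by
        obtain ⟨i, hi, hxi⟩ := List.getElem_of_mem hm
        have := (hx i hi).2 (by rw [List.getElem?_eq_getElem hi, hxi])
        rw [List.getElem?_eq_getElem hi, hxi] at this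
        exact (Option.some_injective _ this).symm
      have : x = x' := by
        by_contra hne
        have h1 : ¬ x < numLetters l := fun h3 => hne (hx' (h.1.mem_iff.2 h3))
        have h2 : ¬ x' < numLetters l := fun h3 => hne (hx'' (h.1.mem_iff.2 h3))
        omega
      rw [this]

namespace SetPartition

variable {n : ℕ} (P : SetPartition n)

/-- The number of blocks whose minimum is at most the minimum of `B`. -/
def rank (B : Finset (Fin n)) : ℕ := (P.parts.filter fun B' => B'.min ≤ B.min).card

theorem canonicalSeq_eq_rank (i : Fin n) : P.canonicalSeq i = P.rank (P.part i) := rfl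

theorem part_mem_parts (i : Fin n) : P.part i ∈ P.parts := P.part_mem.2 (Finset.mem_univ i)

theorem mem_part (i : Fin n) : i ∈ P.part i := P.mem_part_self.2 (Finset.mem_univ i)

theorem eq_of_min_eq {B B' : Finset (Fin n)} (hB : B ∈ P.parts) (hB' : B' ∈ P.parts)
    (h : B.min = B'.min) : B = B' := by
  obtain ⟨i, hi⟩ := Finset.min_of_nonempty (P.nonempty_of_mem_parts hB)
  exact P.eq_of_mem_parts hB hB' (Finset.mem_of_min hi) (Finset.mem_of_min (h ▸ hi))

theorem rank_lt_rank {B B' : Finset (Fin n)} (hB' : B' ∈ P.parts) (h : B.min < B'.min) :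
    P.rank B < P.rank B' := by
  refine Finset.card_lt_card (Finset.ssubset_iff_of_subset ?_ |>.2 ⟨B', ?_, ?_⟩)
  · intro C hC
    rw [Finset.mem_filter] at hC ⊢
    exact ⟨hC.1, hC.2.trans h.le⟩
  · exact Finset.mem_filter.2 ⟨hB', le_rfl⟩
  · rw [Finset.mem_filter]
    exact fun hC => absurd hC.2 (not_le.2 h)

theorem rank_le_rank {B B' : Finset (Fin n)} (h : B.min ≤ B'.min) : P.rank B ≤ P.rank B' := by
  refine Finset.card_le_card fun C hC => ?_
  rw [Finset.mem_filter] at hC ⊢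
  exact ⟨hC.1, hC.2.trans h⟩

theorem min_lt_of_rank_lt {B B' : Finset (Fin n)} (h : P.rank B < P.rank B') : B.min < B'.min := by
  by_contra hc
  exact absurd (P.rank_le_rank (not_lt.1 hc)) (not_le.2 h)

theorem rank_injOn : Set.InjOn P.rank P.parts := by
  intro B hB B' hB' h
  rcases lt_trichotomy B.min B'.min with h1 | h1 | h1
  · exact absurd h (P.rank_lt_rank hB' h1).ne
  · exact P.eq_of_min_eq hB hB' h1
  · exact absurd h (P.rank_lt_rank hB h1).ne'

theorem rank_pos {B : Finset (Fin n)} (hB : B ∈ P.parts) : 0 < P.rank B :=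
  Finset.card_pos.2 ⟨B, Finset.mem_filter.2 ⟨hB, le_rfl⟩⟩

theorem image_rank : P.parts.image P.rank = Finset.Icc 1 P.parts.card := by
  refine Finset.eq_of_subset_of_card_le ?_ ?_
  · intro x hx
    obtain ⟨B, hB, rfl⟩ := Finset.mem_image.1 hx
    exact Finset.mem_Icc.2 ⟨P.rank_pos hB, Finset.card_filter_le _ _⟩
  · rw [Finset.card_image_of_injOn P.rank_injOn, Nat.card_Icc, Nat.add_sub_cancel]

/-- The canonical sequence as a word with letters starting from `0`. -/
def word : List ℕ := List.ofFn fun i => P.canonicalSeq i - 1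

theorem length_word : P.word.length = n := List.length_ofFn

theorem canonicalSeq_pos (i : Fin n) : 0 < P.canonicalSeq i := P.rank_pos (P.part_mem_parts i)

theorem canonicalSeq_eq_iff {i j : Fin n} :
    P.canonicalSeq i = P.canonicalSeq j ↔ P.part i = P.part j := by
  refine ⟨fun h => P.rank_injOn (P.part_mem_parts i) (P.part_mem_parts j) h, fun h => ?_⟩
  rw [canonicalSeq_eq_rank, canonicalSeq_eq_rank, h]

theorem exists_canonicalSeq_eq {x : ℕ} (hx : 0 < x) (j : Fin n) (hxj : x < P.canonicalSeq j) :
    ∃ i < j, P.canonicalSeq i = x := by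
  have hj : P.canonicalSeq j ≤ P.parts.card := Finset.card_filter_le _ _
  have : x ∈ P.parts.image P.rank := by
    rw [image_rank, Finset.mem_Icc]
    omega
  obtain ⟨B, hB, rfl⟩ := Finset.mem_image.1 this
  obtain ⟨i, hi⟩ := Finset.min_of_nonempty (P.nonempty_of_mem_parts hB)
  have hiB := P.part_eq_of_mem hB (Finset.mem_of_min hi)
  have h1 := P.min_lt_of_rank_lt (B := B) (B' := P.part j) hxj
  rw [hi] at h1
  refine ⟨i, WithTop.coe_lt_coe.1 (h1.trans_le (Finset.min_le (P.mem_part j))), ?_⟩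
  rw [canonicalSeq_eq_rank, hiB]

theorem rgf_word : Rgf P.word := by
  intro l₁ x l₂ h y hy
  have hlen := congrArg List.length h
  rw [length_word] at hlen
  simp only [List.length_append, List.length_cons] at hlen
  have hget : ∀ i : Fin n, P.word[(i : ℕ)]? = some (P.canonicalSeq i - 1) := fun i => by
    rw [word, List.getElem?_ofFn]
    simp
  have hx := hget ⟨l₁.length, by omega⟩
  rw [h] at hx
  simp only [List.getElem?_append_right le_rfl, Nat.sub_self, List.getElem?_cons_zero,
    Option.some.injEq] at hx
  obtain ⟨i, hi, hiy⟩ := P.exists_canonicalSeq_eq (x := y + 1) (by omega) ⟨l₁.length, by omega⟩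
    (by omega)
  have h2 := hget i
  rw [h, List.getElem?_append_left hi, hiy] at h2
  exact List.mem_of_getElem? h2

theorem numLetters_word : numLetters P.word = P.parts.card := by
  apply numLetters_eq
  intro x
  rw [word, List.mem_ofFn]
  constructor
  · rintro ⟨i, rfl⟩
    have h1 := P.canonicalSeq_pos i
    have h2 : P.canonicalSeq i ≤ P.parts.card := Finset.card_filter_le _ _
    omega
  · intro hx
    have : x + 1 ∈ P.parts.image P.rank := by
      rw [image_rank, Finset.mem_Icc]
      omega
    obtain ⟨B, hB, h⟩ := Finset.mem_image.1 this
    obtain ⟨i, hi⟩ := P.nonempty_of_mem_parts hB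
    exact ⟨i, by rw [canonicalSeq_eq_rank, P.part_eq_of_mem hB hi, h, Nat.add_sub_cancel]⟩

theorem getElem?_word_eq_iff {i j : Fin n} :
    P.word[(i : ℕ)]? = P.word[(j : ℕ)]? ↔ P.part i = P.part j := by
  rw [← canonicalSeq_eq_iff, word, List.getElem?_ofFn, List.getElem?_ofFn]
  have h1 := P.canonicalSeq_pos i
  have h2 := P.canonicalSeq_pos j
  simp
  omega

theorem word_injective : Function.Injective (word (n := n)) := by
  intro P Q h
  have hpart : ∀ i, P.part i = Q.part i := by
    intro i
    ext j
    rw [P.mem_part_iff_part_eq_part (Finset.mem_univ _) (Finset.mem_univ _),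
      Q.mem_part_iff_part_eq_part (Finset.mem_univ _) (Finset.mem_univ _),
      ← getElem?_word_eq_iff, ← getElem?_word_eq_iff, h]
  have key : ∀ P Q : SetPartition n, (∀ i, P.part i = Q.part i) → P.parts ⊆ Q.parts := by
    intro P Q hpart B hB
    obtain ⟨i, hi⟩ := P.nonempty_of_mem_parts hB
    rw [← P.part_eq_of_mem hB hi, hpart]
    exact Q.part_mem_parts i
  exact Finpartition.ext ((key P Q hpart).antisymm (key Q P fun i => (hpart i).symm))

/-- The blocks are the level sets of `l`; the word of this partition has the same kernel as `l`. -/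
theorem exists_word_eq {l : List ℕ} (hl : Rgf l) (hn : l.length = n) :
    ∃ P : SetPartition n, P.word = l := by
  classical
  let s : Setoid (Fin n) := Setoid.ker fun i : Fin n => l[(i : ℕ)]?
  refine ⟨Finpartition.ofSetoid s, Rgf.ext (rgf_word _) hl ?_ fun i j hi hj => ?_⟩
  · rw [length_word, hn]
  · rw [length_word] at hi hj
    rw [getElem?_word_eq_iff _ (i := ⟨i, hi⟩) (j := ⟨j, hj⟩), eq_comm,
      ← Finpartition.mem_part_iff_part_eq_part _ (Finset.mem_univ _) (Finset.mem_univ _),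
      Finpartition.mem_part_ofSetoid_iff_rel]
    simp only [s, Setoid.ker_def]

/-- The leading 1 is free: before the first chosen `b`, the canonical sequence already contains the
smaller `a`. -/
theorem avoids_pattern12112_iff : P.Avoids pattern12112 ↔ TypeA P.word := by
  rw [Avoids, ← not_iff_not, not_not, TypeA]
  push Not
  simp only [word, ofFn_four_sublist, Contains, canonicalSeq_pattern12112]
  constructor
  · rintro ⟨f, hf, h⟩
    have h1 := P.canonicalSeq_pos (f 1)
    have h2 := P.canonicalSeq_pos (f 2)
    have h21 := (h 2 1).2 (by decide)
    have h23 := mt (h 2 3).1 (by decide)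
    have h32 := mt (h 3 2).1 (by decide)
    have h14 := mt (h 1 4).1 (by decide)
    have h41 := mt (h 4 1).1 (by decide)
    exact ⟨P.canonicalSeq (f 2) - 1, P.canonicalSeq (f 1) - 1, by omega, f 1, f 2, f 3, f 4,
      hf (by decide), hf (by decide), hf (by decide), rfl, rfl, by omega, by omega⟩
  · rintro ⟨a, b, hab, i₁, i₂, i₃, i₄, h12, h23, h34, e1, e2, e3, e4⟩
    have p1 := P.canonicalSeq_pos i₁
    have p2 := P.canonicalSeq_pos i₂
    have p3 := P.canonicalSeq_pos i₃
    have p4 := P.canonicalSeq_pos i₄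
    obtain ⟨i₀, h01, e0⟩ := P.exists_canonicalSeq_eq (x := a + 1) (by omega) i₁ (by omega)
    refine ⟨![i₀, i₁, i₂, i₃, i₄], ?_, ?_⟩
    · rw [Fin.strictMono_iff_lt_succ]
      intro i
      fin_cases i
      · exact h01
      · exact h12
      · exact h23
      · exact h34
    · have hc : ∀ i : Fin 5, P.canonicalSeq ((![i₀, i₁, i₂, i₃, i₄] : Fin 5 → Fin n) i) =
          (![a + 1, b + 1, a + 1, a + 1, b + 1] : Fin 5 → ℕ) i := by
        intro i
        fin_cases i
        · exact e0
        · show P.canonicalSeq i₁ = b + 1; omega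
        · show P.canonicalSeq i₂ = a + 1; omega
        · show P.canonicalSeq i₃ = a + 1; omega
        · show P.canonicalSeq i₄ = b + 1; omega
      intro i j
      rw [hc, hc]
      fin_cases i <;> fin_cases j <;> simp <;> omega

theorem avoids_pattern12212_iff : P.Avoids pattern12212 ↔ TypeB P.word := by
  rw [Avoids, ← not_iff_not, not_not, TypeB]
  push Not
  simp only [word, ofFn_four_sublist, Contains, canonicalSeq_pattern12212]
  constructor
  · rintro ⟨f, hf, h⟩
    have h1 := P.canonicalSeq_pos (f 1)
    have h3 := P.canonicalSeq_pos (f 3)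
    have h31 := (h 3 1).2 (by decide)
    have h12 := mt (h 1 2).1 (by decide)
    have h21 := mt (h 2 1).1 (by decide)
    have h14 := mt (h 1 4).1 (by decide)
    have h41 := mt (h 4 1).1 (by decide)
    exact ⟨P.canonicalSeq (f 3) - 1, P.canonicalSeq (f 1) - 1, by omega, f 1, f 2, f 3, f 4,
      hf (by decide), hf (by decide), hf (by decide), rfl, by omega, rfl, by omega⟩
  · rintro ⟨a, b, hab, i₁, i₂, i₃, i₄, h12, h23, h34, e1, e2, e3, e4⟩
    have p1 := P.canonicalSeq_pos i₁
    have p2 := P.canonicalSeq_pos i₂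
    have p3 := P.canonicalSeq_pos i₃
    have p4 := P.canonicalSeq_pos i₄
    obtain ⟨i₀, h01, e0⟩ := P.exists_canonicalSeq_eq (x := a + 1) (by omega) i₁ (by omega)
    refine ⟨![i₀, i₁, i₂, i₃, i₄], ?_, ?_⟩
    · rw [Fin.strictMono_iff_lt_succ]
      intro i
      fin_cases i
      · exact h01
      · exact h12
      · exact h23
      · exact h34
    · have hc : ∀ i : Fin 5, P.canonicalSeq ((![i₀, i₁, i₂, i₃, i₄] : Fin 5 → Fin n) i) =
          (![a + 1, b + 1, b + 1, a + 1, b + 1] : Fin 5 → ℕ) i := by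
        intro i
        fin_cases i
        · exact e0
        · show P.canonicalSeq i₁ = b + 1; omega
        · show P.canonicalSeq i₂ = b + 1; omega
        · show P.canonicalSeq i₃ = a + 1; omega
        · show P.canonicalSeq i₄ = b + 1; omega
      intro i j
      rw [hc, hc]
      fin_cases i <;> fin_cases j <;> simp <;> omega

/-- With `k = 0`, cover words are the restricted growth functions of type `T`, that is, the words of
the partitions in question. -/
theorem nonempty_equiv_coverFinset {T : List ℕ → Prop} {A : SetPartition n → Prop}
    (h : ∀ P, A P ↔ T P.word) (m : ℕ) : Nonempty ({P : SetPartition n // A P ∧ P.parts.card = m} ≃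
      (coverFinset T n 0).filter fun q => numLetters q.1 = m) := by
  refine ⟨Equiv.ofBijective (fun P => ⟨(P.1.word, []), ?_⟩) ⟨?_, ?_⟩⟩
  · rw [Finset.mem_filter, mem_coverFinset]
    refine ⟨⟨P.1.length_word, rfl, P.1.rgf_word, by simp, ?_⟩, ?_⟩
    · rw [List.append_nil]
      exact (h _).1 P.2.1
    · dsimp only
      rw [numLetters_word, P.2.2]
  · intro P Q hPQ
    simp only [Subtype.mk.injEq, Prod.mk.injEq, and_true] at hPQ
    exact Subtype.ext (word_injective hPQ)
  · rintro ⟨⟨l, V⟩, hq⟩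
    rw [Finset.mem_filter, mem_coverFinset] at hq
    obtain ⟨⟨h1, h2, h3, -, h5⟩, h6⟩ := hq
    obtain rfl := List.length_eq_zero_iff.1 h2
    rw [List.append_nil] at h5
    obtain ⟨P, rfl⟩ := exists_word_eq h3 h1
    exact ⟨⟨P, (h P).2 h5, by rw [← numLetters_word]; exact h6⟩, rfl⟩

theorem nonempty_equiv_avoids (m n : ℕ) : Nonempty
    ({P : SetPartition n // P.Avoids pattern12112 ∧ P.parts.card = m} ≃
      {P : SetPartition n // P.Avoids pattern12212 ∧ P.parts.card = m}) := by
  obtain ⟨e₁⟩ := nonempty_equiv_coverFinset (n := n) (fun P => P.avoids_pattern12112_iff) m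
  obtain ⟨e₂⟩ := nonempty_equiv_coverFinset (n := n) (fun P => P.avoids_pattern12212_iff) m
  have hcard := card_eq_of_sum_pow_eq (s := coverFinset TypeA n 0) (t := coverFinset TypeB n 0)
    (f := fun q => numLetters q.1) (g := fun q => numLetters q.1)
    (fun w hw => coverSum_eq hw n 0) m
  exact ⟨e₁.trans ((Finset.equivOfCardEq hcard).trans e₂.symm)⟩

theorem equivalent_patterns : Equivalent pattern12112 pattern12212 := by
  intro n
  -- The total count is recovered by sorting the partitions by their number of blocks.
  have e : ∀ A : SetPartition n → Prop, Nonempty ({P // A P} ≃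
      Σ m : ℕ, {P : SetPartition n // A P ∧ P.parts.card = m}) := fun A =>
    ⟨(Equiv.sigmaFiberEquiv fun P : {P // A P} => P.1.parts.card).symm.trans
      (Equiv.sigmaCongrRight fun m =>
        Equiv.subtypeSubtypeEquivSubtypeInter A fun P => P.parts.card = m)⟩
  obtain ⟨e₁⟩ := e fun P => P.Avoids pattern12112
  obtain ⟨e₂⟩ := e fun P => P.Avoids pattern12212
  exact Nat.card_congr (e₁.trans ((Equiv.sigmaCongrRight fun m =>
    (nonempty_equiv_avoids m n).some).trans e₂.symm))

end SetPartition

theorem theorem5p2 :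
    SetPartition.Equivalent SetPartition.pattern12112 SetPartition.pattern12212 ∧
      ∀ m n : ℕ, Nonempty
        ({P : SetPartition n // P.Avoids SetPartition.pattern12112 ∧ P.parts.card = m} ≃
          {P : SetPartition n // P.Avoids SetPartition.pattern12212 ∧ P.parts.card = m}) := by
  exact ⟨SetPartition.equivalent_patterns, SetPartition.nonempty_equiv_avoids⟩
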